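/- **Setting.** Let $T$ be a triangulation of the 3-ball, given by its finite set of tetrahedra: a simplicial complex homeomorphic to the closed 3-ball in which the link of every node is a triangulated 2-sphere or a triangulated disk. A face is *external* if it lies in exactly one tetrahedron; a node or edge is external if it lies in an external face; everything else is *internal*. An internal node $x$ is of type *C0* if some tetrahedron $(x,f)$ of $T$ has $f$ external, and of type *C1* if it is not of type C0 but lies in a face $(x,n,m)$ whose opposite edge $(n,m)$ is external. For an external node $n$, the hemisphere $\mathcal I(n)$ is the set of faces $f\not\ni n$ such that $(n,f)$ is a tetrahedron; it is a triangulated polygon with boundary $\partial\mathcal I(n)$. A *splitting path* in $\mathcal I(n)$ is a simple path along interior edges which joins two different nodes of $\partial\mathcal I(n)$ and whose other nodes are interior. If $\gamma$ is a splitting path dividing $\mathcal I(n)$ into $\mathcal I_L$ and $\mathcal I_R$ (so that $\mathcal I_L\cap\mathcal I_R=\gamma$), then *splitting $n$ along $\gamma$* means: remove $n$ and all tetrahedra containing it, and add two new nodes $n_L,n_R$ and the tetrahedra $(n_L,f)$ for $f\in\mathcal I_L$, $(n_R,f)$ for $f\in\mathcal I_R$, and $(n_L,n_R,e)$ for the edges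 $e$ of $\gamma$. **Algorithm.** Fix an external node $n_*$ of $T$ and let $\mathcal I=\mathcal I(n_*)$. Call a C1 node $x$ of $\mathcal I$ *promotable* if it is joined by an edge of $\mathcal I$ to a node of $\partial\mathcal I$, and for each promotable $x$ choose such a node $y(x)\in\partial\mathcal I$. Keep a list $\mathcal Y$ of edges, initially $\{(x,y(x)) : x \text{ promotable}\}$, and a set of pieces $\mathcal K(m)\subset\mathcal I$, each attached to a current node $m$, initially only $\mathcal K(n_*)=\mathcal I$. As long as $\mathcal Y\ne\emptyset$, pick any $(x,y)\in\mathcal Y$ and a piece $\mathcal K=\mathcal K(m)$ containing this edge, and choose a splitting path $\gamma$ of the current hemisphere $\mathcal I(m)$ as follows. * If $x$ is interior to $\mathcal K$: extend $[y,x]$ to a simple path along edges of $\mathcal K$ that ends at a node $z\ne y$ of $\partial\mathcal K$ and all of whose nodes other than $y,z$ are interior to $\mathcal K$. If $z\in\partial\mathcal I(m)$, this is $\gamma$; otherwise append to it a node $w$ that is joined to $z$ in $\mathcal I(m)$ and to which a piece is currently attached. * If $x\in\partial\mathcal K$: let $\gamma=[y,x,w]$, where $w$ is joined to $x$ in $\mathcal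 I(m)$ and a piece is currently attached to $w$. Split $m$ along $\gamma$ into $m_L,m_R$; replace the piece $\mathcal K(m)$ by the two parts $\mathcal K(m_L)$, $\mathcal K(m_R)$ into which $\gamma$ divides it; remove from $\mathcal Y$ all edges lying on $\gamma$. **Theorem 4.2.** Whatever choices of $y(\cdot)$, of the edges $(x,y)\in\mathcal Y$ and of the paths are made, the following holds. 1. The algorithm can always be carried out: in every state that it can reach, for every $(x,y)\in\mathcal Y$ there are a piece and a path as required along which the split is possible. It stops: at every moment the number of paths used so far plus $|\mathcal Y|$ is at most the initial $|\mathcal Y|$. In particular, there is a run that ends with $\mathcal Y=\emptyset$. 2. It decomposes $\mathcal I$ along a sequence of simple paths: at every moment the pieces are triangulated polygons without common triangles, their union is $\mathcal I$, and an edge of $\mathcal I\setminus\partial\mathcal I$ belongs to two different pieces if and only if it lies on one of the paths used so far. 3. Every edge of $\mathcal I\setminus\partial\mathcal I$ is in at most one of the paths. 4. When $\mathcal Y=\emptyset$, every promotable C1 node of $\mathcal I$ has become a node of type C0 of the current triangulation. -/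

import Mathlib

/-! Finite pure simplicial complexes are given by the finite set of their facets, each facet
being the finite set of its nodes: a triangulated surface by its triangles, a triangulated
3-manifold by its tetrahedra. -/

namespace BallSplitting

section Complexes

variable {V : Type*} [DecidableEq V]

/-- The nodes of the complex with facet set `K`. -/
def nodes (K : Finset (Finset V)) : Finset V := K.biUnion id

/-- The simplices with exactly `k` nodes: edges for `k = 2`, triangles for `k = 3`. -/
def simplices (k : ℕ) (K : Finset (Finset V)) : Finset (Finset V) :=
  (K.biUnion Finset.powerset).filter fun s => s.card = k

/-- The simplices with `k` nodes that lie in exactly one facet. If all facets have `k + 1` nodes,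
these are the top-dimensional simplices of the boundary: boundary edges of a surface for `k = 2`,
external faces of a triangulated 3-manifold for `k = 3`. -/
def boundary (k : ℕ) (K : Finset (Finset V)) : Finset (Finset V) :=
  (simplices k K).filter fun s => (K.filter fun t => s ⊆ t).card = 1

/-- The facet set of the link of `v`. -/
def link (K : Finset (Finset V)) (v : V) : Finset (Finset V) :=
  (K.filter fun t => v ∈ t).image fun t => t.erase v

/-- The 1-skeleton as a graph. -/
def skeleton (K : Finset (Finset V)) : SimpleGraph V where
  Adj u v := u ≠ v ∧ ∃ t ∈ K, u ∈ t ∧ v ∈ t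
  symm := ⟨fun _ _ h => ⟨h.1.symm, h.2.imp fun _ ht => ⟨ht.1, ht.2.2, ht.2.1⟩⟩⟩
  loopless := ⟨fun _ h => h.1 rfl⟩

/-- Any two nodes of the complex are joined by a path of edges. -/
def IsConnected (K : Finset (Finset V)) : Prop :=
  ∀ u ∈ nodes K, ∀ v ∈ nodes K, (skeleton K).Reachable u v

/-- The Euler characteristic (nodes minus edges plus triangles) of a complex of triangles. -/
def eulerChar (K : Finset (Finset V)) : ℤ :=
  ((nodes K).card : ℤ) - ((simplices 2 K).card : ℤ) + (K.card : ℤ)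

/-- Triangulated compact connected surface, possibly with boundary. As every edge lies in at most
two triangles, the link of a node has degrees at most two; being connected it is a path or a
cycle. -/
structure IsSurface (K : Finset (Finset V)) : Prop where
  nonempty : K.Nonempty
  card_eq : ∀ t ∈ K, t.card = 3
  edge_le_two : ∀ e ∈ simplices 2 K, (K.filter fun t => e ⊆ t).card ≤ 2
  link_connected : ∀ v ∈ nodes K, IsConnected (link K v)
  connected : IsConnected K

/-- A triangulation of a polygon, i.e. a triangulated disk: among the compact connected surfaces
with nonempty boundary the disk is the one of Euler characteristic one. -/
def IsTriangulatedPolygon (K : Finset (Finset V)) : Prop :=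
  IsSurface K ∧ (boundary 2 K).Nonempty ∧ eulerChar K = 1

/-- A triangulation of the 2-sphere: among the closed connected surfaces the sphere is the one of
Euler characteristic two. -/
def IsTriangulatedSphere (K : Finset (Finset V)) : Prop :=
  IsSurface K ∧ boundary 2 K = ∅ ∧ eulerChar K = 2

/-- The geometric realization, in barycentric coordinates. -/
def realization (K : Finset (Finset V)) : Set (V → ℝ) :=
  {w | (∀ v, 0 ≤ w v) ∧ ∃ t ∈ K, (∀ v, v ∉ t → w v = 0) ∧ ∑ v ∈ t, w v = 1}

/-- A triangulation of the 3-ball, given by its set of tetrahedra: a combinatorial 3-manifold with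
boundary (every node link is a triangulated sphere or a triangulated disk) whose realization
is homeomorphic to the closed 3-ball. -/
structure IsTriangulatedBall (T : Finset (Finset V)) : Prop where
  card_eq : ∀ t ∈ T, t.card = 4
  link_node : ∀ v ∈ nodes T, IsTriangulatedPolygon (link T v) ∨ IsTriangulatedSphere (link T v)
  homeo : Nonempty (realization T ≃ₜ Metric.closedBall (0 : EuclideanSpace ℝ (Fin 3)) 1)

/-- The nodes on the boundary polygon of a triangulated disk. -/
def boundaryNodes (K : Finset (Finset V)) : Finset V := nodes (boundary 2 K)

/-- The interior edges of a triangulated disk. -/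
def interiorEdges (K : Finset (Finset V)) : Finset (Finset V) := simplices 2 K \ boundary 2 K

end Complexes

section Types

variable {V : Type*} [DecidableEq V]

def IsExternalNode (T : Finset (Finset V)) (v : V) : Prop := ∃ f ∈ boundary 3 T, v ∈ f

def IsInternalNode (T : Finset (Finset V)) (v : V) : Prop := v ∈ nodes T ∧ ¬ IsExternalNode T v

def IsExternalEdge (T : Finset (Finset V)) (e : Finset V) : Prop :=
  e.card = 2 ∧ ∃ f ∈ boundary 3 T, e ⊆ f

/-- Type C0: `x` is the internal node of a removable tetrahedron, that is, of a tetrahedron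
whose face opposite to the internal node `x` is external. -/
def IsC0 (T : Finset (Finset V)) (x : V) : Prop :=
  IsInternalNode T x ∧ ∃ t ∈ T, x ∈ t ∧ t.erase x ∈ boundary 3 T

/-- Type C1: an internal node, not of type C0, in a face whose opposite edge is external. -/
def IsC1 (T : Finset (Finset V)) (x : V) : Prop :=
  IsInternalNode T x ∧ ¬ IsC0 T x ∧
    ∃ n m, IsExternalEdge T {n, m} ∧ {x, n, m} ∈ simplices 3 T

/-- The internal hemisphere of an external node `n`: all faces `f` not containing `n` such that
`n` and `f` span a tetrahedron. -/
abbrev hemisphere (T : Finset (Finset V)) (n : V) : Finset (Finset V) := link T n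

/-- `y` is a node of the boundary polygon of the hemisphere of `n`, and `x`, `y`, `n` span a face;
so if `x` is of type C1, this face witnesses it. -/
def IsWitness (T : Finset (Finset V)) (n x y : V) : Prop :=
  y ∈ boundaryNodes (hemisphere T n) ∧ {x, y} ∈ simplices 2 (hemisphere T n)

/-- The nodes of type C1 in the hemisphere of `n` that can be promoted at `n`: those joined to
the boundary polygon of the hemisphere. -/
def IsPromotable (T : Finset (Finset V)) (n x : V) : Prop :=
  IsC1 T x ∧ ∃ y, IsWitness T n x y

end Types

section Splitting

variable {V : Type*} [DecidableEq V]

/-- The edges of the path which visits the nodes of the list `γ` in this order. -/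
def pathEdges (γ : List V) : Finset (Finset V) :=
  ((γ.zip γ.tail).map fun p => {p.1, p.2}).toFinset

/-- A splitting path of a triangulated disk `I`: a simple path along edges of `I` that joins two
different boundary nodes, has all its other nodes in the interior, and uses no boundary edge. -/
def IsSplittingPath (I : Finset (Finset V)) (γ : List V) : Prop :=
  γ.Nodup ∧ pathEdges γ ⊆ interiorEdges I ∧
    ∃ a m b, γ = a :: (m ++ [b]) ∧ a ∈ boundaryNodes I ∧ b ∈ boundaryNodes I ∧
      ∀ v ∈ m, v ∉ boundaryNodes I

/-- The path `γ` divides `I` into `IL` and `IR`: the union of the two subcomplexes is `I` and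
their intersection, as complexes, consists of the nodes and edges of `γ`. -/
def Divides (I : Finset (Finset V)) (γ : List V) (IL IR : Finset (Finset V)) : Prop :=
  IL ∪ IR = I ∧ ∀ s : Finset V, s.Nonempty →
    (((∃ f ∈ IL, s ⊆ f) ∧ ∃ f ∈ IR, s ⊆ f) ↔ ((∃ v ∈ γ, s = {v}) ∨ s ∈ pathEdges γ))

/-- The result of splitting the node `n` into `nL` and `nR` along a path `γ` that divides the
hemisphere of `n` into `IL` and `IR`. -/
def splitNode (T : Finset (Finset V)) (n nL nR : V) (γ : List V) (IL IR : Finset (Finset V)) :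
    Finset (Finset V) :=
  (T.filter fun t => n ∉ t) ∪ IL.image (insert nL) ∪ IR.image (insert nR) ∪
    (pathEdges γ).image fun e => insert nL (insert nR e)

/-- State of the algorithm: the current triangulation, the leaves of the binary tree of pieces
(each one a child of the original node together with its piece of the original
hemisphere), and the list of edges still to be treated. -/
structure State (V : Type*) where
  tri : Finset (Finset V)
  leaves : Finset (V × Finset (Finset V))
  todo : Finset (V × V)

open Classical in
/-- The initial state: the tree of pieces has the hemisphere of `n` as its only leaf, and the list
consists of the edges `(x, y x)`, where `x` runs over the promotable C1 nodes. -/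
noncomputable def initState (T : Finset (Finset V)) (n : V) (y : V → V) : State V where
  tri := T
  leaves := {(n, hemisphere T n)}
  todo := ((nodes (hemisphere T n)).filter fun x => IsPromotable T n x).image fun x => (x, y x)

/-- `w` is the tip of a cone attached to the piece of `n` at its node `z`: a child of the original
node which is joined to `z` in the hemisphere of `n`. -/
def IsTip (s : State V) (n z w : V) : Prop :=
  (∃ K, (w, K) ∈ s.leaves) ∧ {z, w} ∈ simplices 2 (hemisphere s.tri n)

/-- The paths which the algorithm may choose for the edge `(x, y)` in the piece `K` of `n`.
If `x` is interior to `K`, continue the edge from `y` to `x` by a simple path in the interior of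
`K` that ends at a node `z` of the boundary of `K`; if `z` is not on the boundary of the
hemisphere of `n`, append the tip of a cone at `z`. If `x` is not interior to `K`, append to the
edge the tip of a cone at `x`. -/
def IsAlgorithmPath (s : State V) (n : V) (K : Finset (Finset V)) (x y : V) (γ : List V) : Prop :=
  (x ∉ boundaryNodes K ∧ ∃ m z,
      (y :: x :: (m ++ [z])).Nodup ∧
      pathEdges (y :: x :: (m ++ [z])) ⊆ simplices 2 K ∧
      (∀ v ∈ m, v ∉ boundaryNodes K) ∧ z ∈ boundaryNodes K ∧
      ((z ∈ boundaryNodes (hemisphere s.tri n) ∧ γ = y :: x :: (m ++ [z])) ∨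
        (z ∉ boundaryNodes (hemisphere s.tri n) ∧
          ∃ w, IsTip s n z w ∧ γ = y :: x :: (m ++ [z, w])))) ∨
  (x ∈ boundaryNodes K ∧ ∃ w, IsTip s n x w ∧ γ = [y, x, w])

/-- One round of the algorithm, for the edge `(x, y)` of the list and the path `γ`: in the leaf
`(n, K)` whose piece contains the edge, split `n` along `γ` into two new nodes, replace the leaf
by its two children, and remove from the list all edges which lie on `γ`. -/
def Step (s : State V) (x y : V) (γ : List V) (s' : State V) : Prop :=
  (x, y) ∈ s.todo ∧
  ∃ n K, (n, K) ∈ s.leaves ∧ {x, y} ∈ simplices 2 K ∧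
    IsAlgorithmPath s n K x y γ ∧ IsSplittingPath (hemisphere s.tri n) γ ∧
    ∃ IL IR nL nR, Divides (hemisphere s.tri n) γ IL IR ∧
      nL ≠ nR ∧ nL ∉ nodes s.tri ∧ nR ∉ nodes s.tri ∧
      s'.tri = splitNode s.tri n nL nR γ IL IR ∧
      s'.leaves = s.leaves.erase (n, K) ∪ {(nL, K ∩ IL), (nR, K ∩ IR)} ∧
      s'.todo = s.todo.filter fun p => {p.1, p.2} ∉ pathEdges γ

/-- `Run s₀ P s`: starting from `s₀`, some sequence of rounds along the successive paths in the
list `P` leads to the state `s`. -/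
inductive Run (s₀ : State V) : List (List V) → State V → Prop
  | start : Run s₀ [] s₀
  | step {P : List (List V)} {s s' : State V} {x y : V} {γ : List V} :
      Run s₀ P s → Step s x y γ s' → Run s₀ (P ++ [γ]) s'

end Splitting

end BallSplitting

/-! The proof is an invariant (`Invariant`) which every round preserves (`Invariant.step`) and which
supplies the next round (`Invariant.exists_step`). It says that each current node `m` with a piece
has a disk as hemisphere, which contains the piece, also a disk; that every triangle of this
hemisphere outside the piece contains another node carrying a piece, a tip; that two adjacent nodes
carrying pieces lie in a common external face; and that a node of the piece on the original boundary
polygon lies in an external face with `m`.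

Progress: let `(x, y)` be on the list and in the piece `K` of `m`. Then `y` is a boundary node of
the hemisphere of `m`. If `x` is interior to `K`, a path in the link of `y` in `K` leads from `x` to
some `z` on the boundary of `K`. If `z` is interior to the hemisphere, a boundary edge of `K` at `z`
has a triangle beyond `K`; it contains a tip, which is a boundary node of the hemisphere, so the
path can end there. If `x` is on the boundary of `K`, the same applies with `z = x`, because `x` is
an internal node of the triangulation.

Topology enters through linear algebra over `ZMod 2`. A connected surface with boundary has Euler
characteristic at most one (`IsSurface.eulerChar_le_one`). When it equals one, the first homology
relative to the boundary vanishes, so a splitting path, being a relative cycle, bounds a set of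
triangles: it divides the disk (`IsTriangulatedPolygon.exists_coloring`,
`IsTriangulatedPolygon.exists_divides`). The characteristics of the two parts add up to two and are
at most one each, so both parts are disks. The hemisphere of `nL` is one part with a cone over the
path attached; the hemisphere of a further node undergoes the same split one dimension lower
(`SplitData.link_of_ne`).

If `γ` starts with the edge from `y` to `x`, the new tetrahedron on `nL`, `nR`, `x`, `y` has the
face `nL`, `nR`, `y` opposite to `x`. Only one edge of `γ` ends at `y`, so this face is external and
`x` is C0; later splits preserve this. No edge is used twice, since an edge of an earlier path lies
in two pieces while those of the new path are interior to one. Each round removes its own edge from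
the list, hence the bound on the number of rounds. -/

namespace BallSplitting

/-! ### Faces, facet counts, links and connectedness of finite complexes. -/

section Basic

variable {V : Type*} [DecidableEq V] {K : Finset (Finset V)} {s e : Finset V} {u v : V}

/-- All faces of the complex with facet set `K`, including the empty one. -/
def faces (K : Finset (Finset V)) : Finset (Finset V) := K.biUnion Finset.powerset

/-- The number of facets containing the face `s`. -/
def facetCount (K : Finset (Finset V)) (s : Finset V) : ℕ := (K.filter fun t => s ⊆ t).card

theorem mem_faces : s ∈ faces K ↔ ∃ t ∈ K, s ⊆ t := by simp [faces]

theorem faces_mono_left (h : s ⊆ e) (he : e ∈ faces K) : s ∈ faces K := by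
  obtain ⟨t, ht, h'⟩ := mem_faces.1 he
  exact mem_faces.2 ⟨t, ht, h.trans h'⟩

theorem faces_union (K L : Finset (Finset V)) : faces (K ∪ L) = faces K ∪ faces L := by
  ext s; simp only [mem_faces, Finset.mem_union]; grind

theorem faces_mono {L : Finset (Finset V)} (h : K ⊆ L) : faces K ⊆ faces L := by
  intro s hs
  obtain ⟨t, ht, h'⟩ := mem_faces.1 hs
  exact mem_faces.2 ⟨t, h ht, h'⟩

theorem mem_faces_of_mem (h : s ∈ K) : s ∈ faces K := mem_faces.2 ⟨s, h, subset_rfl⟩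

theorem mem_nodes : v ∈ nodes K ↔ ∃ t ∈ K, v ∈ t := by simp [nodes]

theorem mem_nodes_iff_faces : v ∈ nodes K ↔ {v} ∈ faces K := by simp [mem_nodes, mem_faces]

theorem mem_nodes_of_faces (hs : s ∈ faces K) (hv : v ∈ s) : v ∈ nodes K := by
  obtain ⟨t, ht, h⟩ := mem_faces.1 hs
  exact mem_nodes.2 ⟨t, ht, h hv⟩

theorem mem_simplices {k : ℕ} : s ∈ simplices k K ↔ s ∈ faces K ∧ s.card = k := by
  simp [simplices, faces]

theorem facetCount_pos : 0 < facetCount K s ↔ s ∈ faces K := by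
  simp [facetCount, Finset.card_pos, Finset.Nonempty, mem_faces]

theorem facetCount_eq_zero : facetCount K s = 0 ↔ s ∉ faces K := by
  rw [← facetCount_pos]; omega

theorem facetCount_eq_one : facetCount K s = 1 ↔ ∃ t, (t ∈ K ∧ s ⊆ t) ∧
    ∀ t', t' ∈ K → s ⊆ t' → t' = t := by
  rw [facetCount, Finset.card_eq_one]
  constructor
  · rintro ⟨t, ht⟩
    have h : ∀ t', (t' ∈ K ∧ s ⊆ t') ↔ t' = t := by
      intro t'; rw [← Finset.mem_filter (p := fun t => s ⊆ t), ht, Finset.mem_singleton]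
    exact ⟨t, (h t).2 rfl, fun t' h1 h2 => (h t').1 ⟨h1, h2⟩⟩
  · rintro ⟨t, ht, h⟩
    refine ⟨t, ?_⟩
    ext t'
    simp only [Finset.mem_filter, Finset.mem_singleton]
    exact ⟨fun h' => h t' h'.1 h'.2, fun h' => h' ▸ ht⟩

theorem facetCount_eq_two (h : facetCount K s = 2) : ∃ t t', t ≠ t' ∧ (t ∈ K ∧ s ⊆ t) ∧
    (t' ∈ K ∧ s ⊆ t') ∧ (K.filter fun t => s ⊆ t) = {t, t'} := by
  obtain ⟨t, t', hne, h⟩ := Finset.card_eq_two.1 h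
  refine ⟨t, t', hne, ?_, ?_, h⟩
  · rw [← Finset.mem_filter (p := fun t => s ⊆ t), h]; simp
  · rw [← Finset.mem_filter (p := fun t => s ⊆ t), h]; simp

theorem facetCount_union {K L : Finset (Finset V)} (h : Disjoint K L) :
    facetCount (K ∪ L) s = facetCount K s + facetCount L s := by
  rw [facetCount, Finset.filter_union, Finset.card_union_of_disjoint]
  · rfl
  · exact Finset.disjoint_filter_filter h

theorem facetCount_mono {L : Finset (Finset V)} (h : K ⊆ L) : facetCount K s ≤ facetCount L s :=
  Finset.card_le_card (Finset.filter_subset_filter _ h)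

theorem mem_boundary {k : ℕ} : s ∈ boundary k K ↔ s.card = k ∧ facetCount K s = 1 := by
  rw [boundary, Finset.mem_filter, mem_simplices, ← facetCount_pos]
  change (_ ∧ _) ∧ facetCount K s = 1 ↔ _
  constructor
  · rintro ⟨⟨_, h⟩, h'⟩; exact ⟨h, h'⟩
  · rintro ⟨h, h'⟩; exact ⟨⟨by omega, h⟩, h'⟩

theorem mem_interiorEdges : e ∈ interiorEdges K ↔
    e.card = 2 ∧ e ∈ faces K ∧ facetCount K e ≠ 1 := by
  rw [interiorEdges, Finset.mem_sdiff, mem_simplices, mem_boundary]; tauto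

theorem mem_boundaryNodes : v ∈ boundaryNodes K ↔
    ∃ e, v ∈ e ∧ e.card = 2 ∧ facetCount K e = 1 := by
  simp only [boundaryNodes, mem_nodes, mem_boundary]; grind

theorem boundaryNodes_subset_nodes : boundaryNodes K ⊆ nodes K := by
  intro v hv
  obtain ⟨e, hve, -, h⟩ := mem_boundaryNodes.1 hv
  exact mem_nodes_of_faces (facetCount_pos.1 (by omega)) hve

theorem mem_link : s ∈ link K v ↔ v ∉ s ∧ insert v s ∈ K := by
  simp only [link, Finset.mem_image, Finset.mem_filter]
  constructor
  · rintro ⟨t, ⟨ht, hv⟩, rfl⟩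
    exact ⟨Finset.notMem_erase v t, by rwa [Finset.insert_erase hv]⟩
  · rintro ⟨h, h'⟩
    exact ⟨_, ⟨h', Finset.mem_insert_self _ _⟩, Finset.erase_insert h⟩

/-- Adding `v` matches facets of the link with facets of `K` at `v`; boundary and degree conditions
pass between dimensions through this. -/
theorem facetCount_link (h : v ∉ s) : facetCount (link K v) s = facetCount K (insert v s) := by
  refine Finset.card_bij (fun t _ => insert v t) ?_ ?_ ?_
  · intro t ht
    rw [Finset.mem_filter, mem_link] at ht
    exact Finset.mem_filter.2 ⟨ht.1.2, Finset.insert_subset_insert _ ht.2⟩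
  · intro t ht t' ht' heq
    rw [Finset.mem_filter, mem_link] at ht ht'
    rw [← Finset.erase_insert ht.1.1, heq, Finset.erase_insert ht'.1.1]
  · intro t ht
    rw [Finset.mem_filter, Finset.insert_subset_iff] at ht
    refine ⟨t.erase v, ?_, Finset.insert_erase ht.2.1⟩
    rw [Finset.mem_filter, mem_link, Finset.insert_erase ht.2.1]
    refine ⟨⟨Finset.notMem_erase _ _, ht.1⟩, fun x hx => Finset.mem_erase.2 ⟨?_, ht.2.2 hx⟩⟩
    rintro rfl; exact h hx

theorem mem_faces_link : s ∈ faces (link K v) ↔ v ∉ s ∧ insert v s ∈ faces K := by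
  constructor
  · intro h
    obtain ⟨t, ht, hst⟩ := mem_faces.1 h
    rw [mem_link] at ht
    exact ⟨fun h => ht.1 (hst h), mem_faces.2 ⟨_, ht.2, Finset.insert_subset_insert _ hst⟩⟩
  · rintro ⟨h, h'⟩
    rw [← facetCount_pos, facetCount_link h, facetCount_pos]; exact h'

theorem mem_nodes_link : u ∈ nodes (link K v) ↔ u ≠ v ∧ {u, v} ∈ faces K := by
  rw [mem_nodes_iff_faces, mem_faces_link, Finset.mem_singleton, Finset.pair_comm u v]
  tauto

theorem mem_nodes_link_of_mem_mem (ht : s ∈ K) (hu : u ∈ s) (hv : v ∈ s) (h : u ≠ v) :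
    u ∈ nodes (link K v) :=
  mem_nodes_link.2 ⟨h, mem_faces.2 ⟨s, ht, by grind⟩⟩

theorem link_comm (h : u ≠ v) : link (link K v) u = link (link K u) v := by
  ext s
  simp only [mem_link, Finset.mem_insert, Finset.insert_comm u v]
  grind

theorem link_union (K L : Finset (Finset V)) (v : V) :
    link (K ∪ L) v = link K v ∪ link L v := by
  ext s; simp only [mem_link, Finset.mem_union]; tauto

theorem link_mono {L : Finset (Finset V)} (h : K ⊆ L) : link K v ⊆ link L v := by
  intro s hs; rw [mem_link] at hs ⊢; exact ⟨hs.1, h hs.2⟩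

theorem link_eq_empty : link K v = ∅ ↔ v ∉ nodes K := by
  rw [Finset.eq_empty_iff_forall_notMem, mem_nodes]
  constructor
  · rintro h ⟨t, ht, hv⟩
    exact h (t.erase v) (mem_link.2 ⟨Finset.notMem_erase _ _, by rwa [Finset.insert_erase hv]⟩)
  · intro h s hs
    exact h ⟨_, (mem_link.1 hs).2, Finset.mem_insert_self _ _⟩

theorem card_of_mem_link {k : ℕ} (hK : ∀ t ∈ K, t.card = k + 1) : ∀ t ∈ link K v, t.card = k := by
  intro t ht
  obtain ⟨h, h'⟩ := mem_link.1 ht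
  have := hK _ h'
  rw [Finset.card_insert_of_notMem h] at this
  omega

/-- Connectedness as propagation of predicates: later proofs choose a predicate and check it on
single facets, without handling walks. -/
theorem isConnected_iff : IsConnected K ↔ ∀ p : V → Prop,
    (∀ t ∈ K, ∀ a ∈ t, ∀ b ∈ t, p a → p b) → ∀ u ∈ nodes K, ∀ v ∈ nodes K, p u → p v := by
  constructor
  · rintro h p hp u hu v hv hpu
    obtain ⟨w⟩ := h u hu v hv
    induction w with
    | nil => exact hpu
    | cons hadj w ih =>
      obtain ⟨-, t, ht, ha, hb⟩ := hadj
      exact ih (mem_nodes.2 ⟨t, ht, hb⟩) hv (hp t ht _ ha _ hb hpu)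
  · intro h u hu v hv
    refine h (fun x => (skeleton K).Reachable u x) ?_ u hu v hv (SimpleGraph.Reachable.refl _)
    intro t ht a ha b hb hua
    by_cases hab : a = b
    · rwa [← hab]
    · exact hua.trans (SimpleGraph.Adj.reachable ⟨hab, t, ht, ha, hb⟩)

/-- The number of nodes of odd degree at which a locally constant predicate holds is even. -/
theorem exists_ne_odd_facetCount {G : Finset (Finset V)} (hG : ∀ e ∈ G, e.card = 2) {p : V → Prop}
    (hp : ∀ e ∈ G, ∀ a ∈ e, ∀ b ∈ e, p a → p b) (hu : p u) (hodd : Odd (facetCount G {u})) :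
    ∃ v, v ≠ u ∧ p v ∧ Odd (facetCount G {v}) := by
  classical
  by_contra! hcon
  -- Incidences of edges with nodes satisfying `p`, counted mod 2 in two ways. Each edge has zero or
  -- two such ends, so the total is 0; if `u` were the only such node of odd degree it would be 1.
  have key : ∑ v ∈ nodes G, (facetCount G {v} : ZMod 2) * (if p v then 1 else 0) =
      ∑ e ∈ G, ∑ v ∈ e, (if p v then 1 else 0) := by
    have : ∀ v, (facetCount G {v} : ZMod 2) * (if p v then 1 else 0) =
        ∑ e ∈ G.filter (fun e => v ∈ e), (if p v then (1 : ZMod 2) else 0) := by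
      intro v
      rw [Finset.sum_const, nsmul_eq_mul]
      simp [facetCount]
    simp only [this]
    apply Finset.sum_comm'
    intro v e
    simp only [Finset.mem_filter, mem_nodes]
    grind
  have hzero : ∑ e ∈ G, ∑ v ∈ e, (if p v then (1 : ZMod 2) else 0) = 0 := by
    refine Finset.sum_eq_zero fun e he => ?_
    obtain ⟨a, b, hab, rfl⟩ := Finset.card_eq_two.1 (hG e he)
    have : p a ↔ p b := ⟨hp _ he a (by simp) b (by simp), hp _ he b (by simp) a (by simp)⟩
    rw [Finset.sum_pair hab]
    by_cases h : p a
    · rw [if_pos h, if_pos (this.1 h)]; decide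
    · rw [if_neg h, if_neg (fun h' => h (this.2 h'))]; decide
  rw [hzero, Finset.sum_eq_single u] at key
  · rw [if_pos hu, mul_one] at key
    rw [ZMod.natCast_eq_zero_iff_even] at key
    exact (Nat.not_even_iff_odd.2 hodd) key
  · intro v _ hv
    by_cases h : p v
    · have := hcon v hv h
      rw [if_pos h, mul_one, ZMod.natCast_eq_zero_iff_even]
      exact Nat.not_odd_iff_even.1 this
    · rw [if_neg h, mul_zero]
  · intro h
    exfalso
    apply h
    rw [mem_nodes_iff_faces, ← facetCount_pos]
    exact hodd.pos

end Basic

/-! ### Surfaces: boundary edges, strong connectivity, alternating face sums. -/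

section Surface

variable {V : Type*} [DecidableEq V] {K : Finset (Finset V)} {s e t : Finset V} {u v : V}

theorem exists_eq_pair (he : e.card = 2) (hv : v ∈ e) : ∃ u, u ≠ v ∧ e = {u, v} := by
  obtain ⟨a, b, hab, rfl⟩ := Finset.card_eq_two.1 he
  rcases Finset.mem_insert.1 hv with rfl | hv
  · exact ⟨b, hab.symm, Finset.pair_comm _ _⟩
  · rw [Finset.mem_singleton] at hv; subst hv; exact ⟨a, hab, rfl⟩

theorem facetCount_link_singleton (h : u ≠ v) :
    facetCount (link K v) {u} = facetCount K {u, v} := by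
  rw [facetCount_link (by simpa using h.symm), Finset.pair_comm]

theorem IsSurface.facetCount_le_two (hK : IsSurface K) (he : e.card = 2) :
    facetCount K e ≤ 2 := by
  by_cases h : e ∈ faces K
  · exact hK.edge_le_two e (mem_simplices.2 ⟨h, he⟩)
  · rw [facetCount_eq_zero.2 h]; omega

theorem IsSurface.mem_interiorEdges (hK : IsSurface K) :
    e ∈ interiorEdges K ↔ e.card = 2 ∧ facetCount K e = 2 := by
  rw [BallSplitting.mem_interiorEdges, ← facetCount_pos]
  constructor
  · rintro ⟨h, h1, h2⟩; have := hK.facetCount_le_two h; exact ⟨h, by omega⟩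
  · rintro ⟨h, h1⟩; exact ⟨h, by omega, by omega⟩

theorem IsSurface.card_of_mem_link (hK : IsSurface K) : ∀ e ∈ link K v, e.card = 2 :=
  BallSplitting.card_of_mem_link hK.card_eq

theorem mem_boundaryNodes_iff_pair :
    v ∈ boundaryNodes K ↔ ∃ u, u ≠ v ∧ facetCount K {u, v} = 1 := by
  rw [mem_boundaryNodes]
  constructor
  · rintro ⟨e, hv, hc, h⟩
    obtain ⟨u, hu, rfl⟩ := exists_eq_pair hc hv
    exact ⟨u, hu, h⟩
  · rintro ⟨u, hu, h⟩
    exact ⟨_, by simp, Finset.card_pair hu, h⟩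

/-- At a boundary node there are at least two boundary edges. -/
theorem IsSurface.exists_ne_boundary (hK : IsSurface K) (huv : u ≠ v)
    (h : facetCount K {u, v} = 1) : ∃ u', u' ≠ u ∧ u' ≠ v ∧ facetCount K {u', v} = 1 := by
  -- In the link of `v` the node `u` has degree one; by parity another node has odd degree, and
  -- degrees are at most two.
  obtain ⟨w, hw, -, hodd⟩ := exists_ne_odd_facetCount (G := link K v) (p := fun _ => True) (u := u)
    hK.card_of_mem_link (by simp) trivial (by rw [facetCount_link_singleton huv, h]; decide)
  have hwv : w ≠ v := by
    rintro rfl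
    have h' := facetCount_pos.1 hodd.pos
    rw [mem_faces_link] at h'
    simp at h'
  refine ⟨w, hw, hwv, ?_⟩
  rw [facetCount_link_singleton hwv] at hodd
  have := hK.facetCount_le_two (Finset.card_pair hwv)
  interval_cases hc : facetCount K {w, v}
  · simp at hodd
  · rfl
  · exact absurd hodd (by decide)

/-- A surface is strongly connected: any two triangles are joined through common edges. -/
theorem IsSurface.forall_of_locally (hK : IsSurface K) {p : Finset V → Prop}
    (hp : ∀ t ∈ K, ∀ t' ∈ K, ∀ e, e.card = 2 → e ⊆ t → e ⊆ t' → p t → p t')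
    {t₀ : Finset V} (h₀ : t₀ ∈ K) (hp₀ : p t₀) : ∀ t ∈ K, p t := by
  -- Around one node: two triangles at `v` with a further common node `x` share the edge `{x, v}`,
  -- and the link of `v` is connected.
  have star : ∀ v, ∀ t ∈ K, ∀ t' ∈ K, v ∈ t → v ∈ t' → p t → p t' := by
    intro v t ht t' ht' hv hv' hpt
    have hvn : v ∈ nodes K := mem_nodes.2 ⟨t, ht, hv⟩
    have hne : ∀ t ∈ K, v ∈ t → ∃ a ∈ t, a ≠ v := by
      intro t ht hv
      have : 0 < (t.erase v).card := by rw [Finset.card_erase_of_mem hv, hK.card_eq t ht]; omega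
      obtain ⟨a, ha⟩ := Finset.card_pos.1 this
      exact ⟨a, Finset.mem_of_mem_erase ha, Finset.ne_of_mem_erase ha⟩
    obtain ⟨a, ha, hav⟩ := hne t ht hv
    obtain ⟨b, hb, hbv⟩ := hne t' ht' hv'
    have := isConnected_iff.1 (hK.link_connected v hvn)
      (fun x => ∃ t ∈ K, v ∈ t ∧ x ∈ t ∧ p t) ?_ a (mem_nodes_link_of_mem_mem ht ha hv hav) b
      (mem_nodes_link_of_mem_mem ht' hb hv' hbv) ⟨t, ht, hv, ha, hpt⟩
    · obtain ⟨t₁, ht₁, hv₁, hb₁, hp₁⟩ := this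
      exact hp t₁ ht₁ t' ht' {b, v} (Finset.card_pair hbv) (by grind) (by grind) hp₁
    · rintro s hs x hx y hy ⟨t₁, ht₁, hv₁, hx₁, hp₁⟩
      rw [mem_link] at hs
      have hxv : x ≠ v := by rintro rfl; exact hs.1 hx
      exact ⟨_, hs.2, by simp, by simp [hy], hp t₁ ht₁ _ hs.2 {x, v} (Finset.card_pair hxv)
        (by grind) (by grind) hp₁⟩
  intro t ht
  have ne : ∀ t ∈ K, t.Nonempty := fun t ht => Finset.card_pos.1 (by rw [hK.card_eq t ht]; omega)
  obtain ⟨a, ha⟩ := ne _ h₀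
  obtain ⟨b, hb⟩ := ne _ ht
  obtain ⟨t₁, ht₁, hb₁, hp₁⟩ := isConnected_iff.1 hK.connected (fun x => ∃ t ∈ K, x ∈ t ∧ p t)
    (by
      rintro s hs x hx y hy ⟨t₁, ht₁, hx₁, hp₁⟩
      exact ⟨s, hs, hy, star x t₁ ht₁ s hs hx₁ hx hp₁⟩) a (mem_nodes.2 ⟨_, h₀, ha⟩) b
    (mem_nodes.2 ⟨_, ht, hb⟩) ⟨_, h₀, ha, hp₀⟩
  exact star b t₁ ht₁ t ht hb₁ hb hp₁

/-- The reduced Euler characteristic (up to sign) of a family of faces. -/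
def altSum (D : Finset (Finset V)) : ℤ := ∑ s ∈ D, (-1) ^ s.card

theorem altSum_union (D E : Finset (Finset V)) :
    altSum (D ∪ E) + altSum (D ∩ E) = altSum D + altSum E := Finset.sum_union_inter

theorem card_simplices_one (K : Finset (Finset V)) : (simplices 1 K).card = (nodes K).card := by
  symm
  refine Finset.card_bij (fun v _ => {v}) ?_ ?_ ?_
  · intro v hv; exact mem_simplices.2 ⟨mem_nodes_iff_faces.1 hv, by simp⟩
  · intro a _ b _ h; simpa using h
  · intro s hs
    obtain ⟨hs, hc⟩ := mem_simplices.1 hs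
    obtain ⟨v, rfl⟩ := Finset.card_eq_one.1 hc
    exact ⟨v, mem_nodes_iff_faces.2 hs, rfl⟩

theorem simplices_eq_of_card {k : ℕ} (hK : ∀ t ∈ K, t.card = k) : simplices k K = K := by
  ext s
  rw [mem_simplices, mem_faces]
  constructor
  · rintro ⟨⟨t, ht, hst⟩, hc⟩
    rwa [Finset.eq_of_subset_of_card_le hst (by rw [hK t ht, hc])]
  · exact fun h => ⟨⟨s, h, subset_rfl⟩, hK s h⟩

/-- The empty face is counted and contributes the 1; nodes, edges and triangles follow with
alternating signs. -/
theorem altSum_faces (hne : K.Nonempty) (hK : ∀ t ∈ K, t.card = 3) :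
    altSum (faces K) = 1 - eulerChar K := by
  have hmaps : ∀ s ∈ faces K, s.card ∈ Finset.range 4 := by
    intro s hs
    obtain ⟨t, ht, hst⟩ := mem_faces.1 hs
    have := Finset.card_le_card hst
    rw [hK t ht] at this
    exact Finset.mem_range.2 (by omega)
  rw [altSum, ← Finset.sum_fiberwise_of_maps_to hmaps]
  have hs : ∀ k, ∑ s ∈ faces K with s.card = k, (-1 : ℤ) ^ s.card =
      (simplices k K).card * (-1) ^ k := by
    intro k
    rw [Finset.sum_congr rfl (g := fun _ => (-1 : ℤ) ^ k), Finset.sum_const, nsmul_eq_mul]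
    · rfl
    · intro s hs; rw [(Finset.mem_filter.1 hs).2]
  have h0 : simplices 0 K = {∅} := by
    ext s
    rw [mem_simplices, Finset.card_eq_zero, Finset.mem_singleton, mem_faces]
    obtain ⟨t, ht⟩ := hne
    exact ⟨fun h => h.2, fun h => ⟨⟨t, ht, by simp [h]⟩, h⟩⟩
  simp only [hs, Finset.sum_range_succ, Finset.sum_range_zero, h0, card_simplices_one,
    simplices_eq_of_card hK, eulerChar, Finset.card_singleton]
  ring

/-- In this normalization disks, paths and cones all have sum zero, so gluing computations carry no
constants. -/
theorem isTriangulatedPolygon_iff : IsTriangulatedPolygon K ↔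
    IsSurface K ∧ (boundary 2 K).Nonempty ∧ altSum (faces K) = 0 := by
  refine and_congr_right fun h => and_congr_right fun _ => ?_
  rw [altSum_faces h.nonempty h.card_eq]
  constructor <;> intro h <;> linarith

end Surface

/-! ### Incidence maps over the field with two elements. -/

section Homology

variable {V : Type*}

/-- The linear map with the matrix of an incidence relation between two families of simplices. -/
noncomputable def incidence (P Q : Finset (Finset V)) (r : Finset V → Finset V → Prop)
    [DecidableRel r] : (P → ZMod 2) →ₗ[ZMod 2] (Q → ZMod 2) where
  toFun c q := ∑ p : P, if r p q then c p else 0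
  map_add' c d := by
    ext q; simp only [Pi.add_apply, ← Finset.sum_add_distrib]
    exact Finset.sum_congr rfl fun p _ => by split_ifs <;> simp
  map_smul' a c := by
    ext q; simp only [Pi.smul_apply, smul_eq_mul, RingHom.id_apply, Finset.mul_sum]
    exact Finset.sum_congr rfl fun p _ => by split_ifs <;> simp

variable {P Q R : Finset (Finset V)} {r : Finset V → Finset V → Prop} [DecidableRel r]
  {r' : Finset V → Finset V → Prop} [DecidableRel r']

/-- Extending a cochain from the subtype to all finsets turns its image into a sum over a filtered
finset. -/
theorem incidence_apply_of_eq (c : P → ZMod 2) (f : Finset V → ZMod 2) (hf : ∀ p : P, f p = c p)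
    (q : Q) : incidence P Q r c q = ∑ p ∈ P.filter (fun p => r p q), f p := by
  rw [Finset.sum_filter, ← Finset.sum_coe_sort P]
  exact Finset.sum_congr rfl fun p _ => by rw [hf]

variable [DecidableEq V]

/-- The indicator function of a simplex, as a cochain on the family `P`. -/
def indicator (P : Finset (Finset V)) (s : Finset V) : P → ZMod 2 := fun p => if p = s then 1 else 0

theorem incidence_indicator {p : Finset V} (hp : p ∈ P) (q : Q) :
    incidence P Q r (indicator P p) q = if r p q then 1 else 0 := by
  rw [incidence_apply_of_eq (indicator P p) (fun s => if s = p then 1 else 0) (fun _ => rfl) q,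
    Finset.sum_ite_eq']
  simp [hp]

theorem eq_top_of_indicator_mem (S : Submodule (ZMod 2) (Q → ZMod 2))
    (h : ∀ q ∈ Q, indicator Q q ∈ S) : S = ⊤ := by
  rw [eq_top_iff]
  intro c _
  have : c = ∑ q : Q, c q • indicator Q q := by
    ext x
    simp [indicator, Finset.sum_apply]
  rw [this]
  exact S.sum_mem fun q _ => S.smul_mem _ (h q q.2)

/-- The matrix entry of the composite at `(p, q)` is the parity of the number of intermediate
simplices. -/
theorem incidence_comp_eq_zero
    (h : ∀ p ∈ P, ∀ q ∈ R, Even (Q.filter fun e => r p e ∧ r' e q).card) :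
    (incidence Q R r') ∘ₗ (incidence P Q r) = 0 := by
  ext1 p
  ext q
  have hs : (Pi.single p 1 : P → ZMod 2) = indicator P p := by
    ext x; rw [Pi.single_apply, indicator]; exact if_congr Subtype.ext_iff rfl rfl
  change incidence Q R r' (incidence P Q r (Pi.single p 1)) q = 0
  rw [hs, incidence_apply_of_eq _ (fun e => if r p e then 1 else 0)
    (fun e => (incidence_indicator p.2 e).symm), Finset.sum_boole, Finset.filter_filter,
    ZMod.natCast_eq_zero_iff_even]
  rw [Finset.filter_congr (q := fun e => r p e ∧ r' e q) fun _ _ => and_comm]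
  exact h p p.2 q q.2

/-- Rank–nullity for `f` and `g`: the kernel of `f` has dimension at most one and the range of `f`
lies in the kernel of `g`. The inequality bounds the Euler characteristic; its reverse forces
exactness in the middle. -/
theorem finrank_of_exact {k X Y Z : Type*} [Field k] [AddCommGroup X] [Module k X]
    [AddCommGroup Y] [Module k Y] [AddCommGroup Z] [Module k Z] [FiniteDimensional k X]
    [FiniteDimensional k Y] {f : X →ₗ[k] Y} {g : Y →ₗ[k] Z} (hgf : g ∘ₗ f = 0)
    (hg : LinearMap.range g = ⊤) {x : X} (hf : LinearMap.ker f ≤ Submodule.span k {x}) :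
    Module.finrank k X + Module.finrank k Z ≤ Module.finrank k Y + 1 ∧
    (Module.finrank k Y + 1 ≤ Module.finrank k X + Module.finrank k Z →
      LinearMap.range f = LinearMap.ker g) := by
  have h1 := LinearMap.finrank_range_add_finrank_ker f
  have h2 := LinearMap.finrank_range_add_finrank_ker g
  rw [hg, finrank_top] at h2
  have h3 : Module.finrank k (LinearMap.ker f) ≤ 1 :=
    (Submodule.finrank_mono hf).trans ((finrank_span_le_card _).trans (by simp))
  have hle : LinearMap.range f ≤ LinearMap.ker g := by
    rintro _ ⟨a, rfl⟩; exact LinearMap.congr_fun hgf a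
  have h4 := Submodule.finrank_mono hle
  exact ⟨by omega, fun h => Submodule.eq_of_le_of_finrank_le hle (by omega)⟩

end Homology

/-! ### The Euler characteristic of a surface with boundary. -/

section Surface

variable {V : Type*} [DecidableEq V] {K : Finset (Finset V)} {s e t : Finset V} {u v : V}

/-- The evenness of this number makes consecutive incidence maps compose to zero. -/
theorem card_edges_at (ht : t.card = 3) (hv : v ∈ t) :
    ((t.powersetCard 2).filter (fun e => v ∈ e)).card = 2 := by
  obtain ⟨a, b, hab, h⟩ := Finset.card_eq_two.1
    (show (t.erase v).card = 2 by rw [Finset.card_erase_of_mem hv, ht])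
  have ha : a ∈ t.erase v := by simp [h]
  have hb : b ∈ t.erase v := by simp [h]
  have htt : t = {v, a, b} := by rw [← h, Finset.insert_erase hv]
  have hav := Finset.ne_of_mem_erase ha
  have hbv := Finset.ne_of_mem_erase hb
  have : (t.powersetCard 2).filter (fun e => v ∈ e) = {{v, a}, {v, b}} := by
    ext e
    simp only [Finset.mem_filter, Finset.mem_powersetCard, Finset.mem_insert,
      Finset.mem_singleton]
    constructor
    · rintro ⟨⟨hsub, hc⟩, hve⟩
      obtain ⟨x, hx, rfl⟩ := exists_eq_pair hc hve
      have : x ∈ t := hsub (by simp)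
      rw [htt] at this
      simp only [Finset.mem_insert, Finset.mem_singleton, hx, false_or] at this
      rcases this with rfl | rfl
      · exact Or.inl (Finset.pair_comm _ _)
      · exact Or.inr (Finset.pair_comm _ _)
    · rintro (rfl | rfl)
      · exact ⟨⟨by grind, Finset.card_pair hav.symm⟩, by simp⟩
      · exact ⟨⟨by grind, Finset.card_pair hbv.symm⟩, by simp⟩
  rw [this, Finset.card_pair]
  intro h'
  have : a ∈ ({v, b} : Finset V) := by rw [← h']; simp
  grind

/-- A connected surface with nonempty boundary has Euler characteristic at most one. -/
theorem IsSurface.eulerChar_le_one (hK : IsSurface K) (hb : (boundary 2 K).Nonempty) :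
    eulerChar K ≤ 1 := by
  classical
  have hcomp : incidence (simplices 2 K) K (· ⊆ ·) ∘ₗ
      incidence (simplices 1 K) (simplices 2 K) (· ⊆ ·) = 0 := by
    refine incidence_comp_eq_zero fun p hp t ht => ?_
    obtain ⟨v, rfl⟩ := Finset.card_eq_one.1 (mem_simplices.1 hp).2
    by_cases hv : v ∈ t
    · rw [show (simplices 2 K).filter (fun e => {v} ⊆ e ∧ e ⊆ t) =
        (t.powersetCard 2).filter (fun e => v ∈ e) by
          ext e
          simp only [Finset.mem_filter, mem_simplices, Finset.mem_powersetCard,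
            Finset.singleton_subset_iff]
          have : e ⊆ t → e ∈ faces K := fun h => mem_faces.2 ⟨t, ht, h⟩
          tauto, card_edges_at (hK.card_eq t ht) hv]
      decide
    · rw [Finset.filter_false_of_mem]
      · simp
      · rintro e - ⟨h, h'⟩; exact hv (h' (h (by simp)))
  -- The coboundary of a boundary edge is the indicator of its only triangle; that of an edge
  -- between `t` and `t'` is the sum of their indicators. Strong connectivity then puts every
  -- indicator in the range.
  have hsurj : LinearMap.range (incidence (simplices 2 K) K (· ⊆ ·)) = ⊤ := by
    refine eq_top_of_indicator_mem _ ?_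
    obtain ⟨e, he⟩ := hb
    rw [mem_boundary] at he
    obtain ⟨t₀, ⟨ht₀, hset⟩, huniq⟩ := facetCount_eq_one.1 he.2
    refine hK.forall_of_locally (p := fun t => indicator K t ∈ _) ?_ ht₀ ?_
    · intro t ht t' ht' e he het het' hmem
      by_cases htt : t = t'
      · rwa [← htt]
      have hes : e ∈ simplices 2 K := mem_simplices.2 ⟨mem_faces.2 ⟨t, ht, het⟩, he⟩
      have hsum : incidence (simplices 2 K) K (· ⊆ ·) (indicator _ e) =
          indicator K t + indicator K t' := by
        ext q
        rw [incidence_indicator hes]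
        have hle := hK.facetCount_le_two he
        have hsub : ({t, t'} : Finset (Finset V)) ⊆ K.filter (fun t => e ⊆ t) := by
          intro x; simp only [Finset.mem_insert, Finset.mem_singleton, Finset.mem_filter]
          rintro (rfl | rfl) <;> tauto
        have heq := Finset.eq_of_subset_of_card_le hsub (by rw [Finset.card_pair htt]; exact hle)
        have hq : e ⊆ (q : Finset V) ↔ (q : Finset V) = t ∨ (q : Finset V) = t' := by
          have : (q : Finset V) ∈ K.filter (fun t => e ⊆ t) ↔ e ⊆ (q : Finset V) := by
            simp
          rw [← this, ← heq]; simp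
        simp only [hq, indicator, Pi.add_apply]
        by_cases h1 : (q : Finset V) = t
        · have h2 : (q : Finset V) ≠ t' := by rw [h1]; exact htt
          simp [h1, htt]
        · simp [h1]
      have : indicator K t' = incidence (simplices 2 K) K (· ⊆ ·) (indicator _ e) -
          indicator K t := by rw [hsum]; abel
      rw [this]
      exact Submodule.sub_mem _ ⟨_, rfl⟩ hmem
    · refine ⟨indicator _ e, ?_⟩
      ext q
      rw [incidence_indicator (mem_simplices.2 ⟨mem_faces.2 ⟨_, ht₀, hset⟩, he.1⟩)]
      simp only [indicator]
      congr 1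
      exact propext ⟨fun h => huniq q q.2 h, fun h => h ▸ hset⟩
  -- A function on nodes with zero coboundary agrees at the ends of each edge, so it is constant.
  have hker : LinearMap.ker (incidence (simplices 1 K) (simplices 2 K) (· ⊆ ·)) ≤
      Submodule.span (ZMod 2) {fun _ => 1} := by
    intro c hc
    rw [LinearMap.mem_ker] at hc
    set f : Finset V → ZMod 2 := fun s => if h : s ∈ simplices 1 K then c ⟨s, h⟩ else 0 with hf
    have hfc : ∀ p : simplices 1 K, f p = c p := fun p => by simp [hf]
    have hedge : ∀ t ∈ K, ∀ a ∈ t, ∀ b ∈ t, f {a} = f {b} := by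
      intro t ht a ha b hb
      by_cases hab : a = b
      · rw [hab]
      have he : ({a, b} : Finset V) ∈ simplices 2 K :=
        mem_simplices.2 ⟨mem_faces.2 ⟨t, ht, by grind⟩, Finset.card_pair hab⟩
      have := congrFun hc ⟨_, he⟩
      rw [incidence_apply_of_eq c f hfc] at this
      have hfil : (simplices 1 K).filter (fun p => p ⊆ ({a, b} : Finset V)) = {{a}, {b}} := by
        ext p
        simp only [Finset.mem_filter, mem_simplices, Finset.mem_insert, Finset.mem_singleton]
        constructor
        · rintro ⟨⟨-, hp⟩, hsub⟩
          obtain ⟨x, rfl⟩ := Finset.card_eq_one.1 hp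
          grind
        · rintro (rfl | rfl)
          · exact ⟨⟨mem_faces.2 ⟨t, ht, by grind⟩, by simp⟩, by simp⟩
          · exact ⟨⟨mem_faces.2 ⟨t, ht, by grind⟩, by simp⟩, by simp⟩
      rw [hfil, Finset.sum_pair (by simpa using hab)] at this
      exact CharTwo.add_eq_zero.1 this
    obtain ⟨t₀, ht₀⟩ := hK.nonempty
    obtain ⟨a, ha⟩ := Finset.card_pos.1 (show 0 < t₀.card by rw [hK.card_eq _ ht₀]; omega)
    rw [Submodule.mem_span_singleton]
    refine ⟨f {a}, ?_⟩
    ext p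
    obtain ⟨v, hv⟩ := Finset.card_eq_one.1 (mem_simplices.1 p.2).2
    have := isConnected_iff.1 hK.connected (fun x => f {x} = f {a})
      (fun t ht x hx y hy h => (hedge t ht y hy x hx).trans h) a (mem_nodes.2 ⟨_, ht₀, ha⟩) v
      (mem_nodes_iff_faces.2 (hv ▸ (mem_simplices.1 p.2).1)) rfl
    rw [← hfc, hv, this]; simp
  have := (finrank_of_exact hcomp hsurj hker).1
  simp only [Module.finrank_fintype_fun_eq_card, Fintype.card_coe, card_simplices_one] at this
  rw [eulerChar]
  omega

end Surface

/-! ### Relative cycles in a disk separate. -/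

section Coloring

variable {V : Type*} [DecidableEq V] {K : Finset (Finset V)} {s e t t' : Finset V} {u v : V}

theorem IsSurface.filter_eq_pair (hK : IsSurface K) (he : e.card = 2) (ht : t ∈ K) (ht' : t' ∈ K)
    (htt : t ≠ t') (het : e ⊆ t) (het' : e ⊆ t') : K.filter (fun t => e ⊆ t) = {t, t'} := by
  symm
  refine Finset.eq_of_subset_of_card_le ?_ ?_
  · intro x; simp only [Finset.mem_insert, Finset.mem_singleton, Finset.mem_filter]
    rintro (rfl | rfl) <;> tauto
  · rw [Finset.card_pair htt]; exact hK.facetCount_le_two he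

theorem IsSurface.mem_interiorEdges_of_ne (hK : IsSurface K) (he : e.card = 2) (ht : t ∈ K)
    (ht' : t' ∈ K) (htt : t ≠ t') (het : e ⊆ t) (het' : e ⊆ t') : e ∈ interiorEdges K := by
  rw [hK.mem_interiorEdges, facetCount, hK.filter_eq_pair he ht ht' htt het het',
    Finset.card_pair htt]
  exact ⟨he, rfl⟩

theorem mem_interiorEdges_of_notMem_boundaryNodes (he : e.card = 2) (hf : e ∈ faces K)
    (hv : v ∈ e) (hvb : v ∉ boundaryNodes K) : e ∈ interiorEdges K := by
  refine BallSplitting.mem_interiorEdges.2 ⟨he, hf, fun h => hvb ?_⟩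
  exact mem_boundaryNodes.2 ⟨e, hv, he, h⟩

/-- Double counting: each boundary node is in at least two boundary edges, and each edge has two
ends. -/
theorem IsSurface.card_boundaryNodes_le (hK : IsSurface K) :
    (boundaryNodes K).card ≤ (boundary 2 K).card := by
  have := Finset.card_mul_le_card_mul (s := boundaryNodes K) (t := boundary 2 K)
    (fun v e => v ∈ e) (m := 2) (n := 2) ?_ ?_
  · omega
  · intro v hv
    obtain ⟨u, huv, h⟩ := mem_boundaryNodes_iff_pair.1 hv
    obtain ⟨u', huu', hu'v, h'⟩ := hK.exists_ne_boundary huv h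
    have hne : ({u, v} : Finset V) ≠ {u', v} := by
      intro heq
      have : u ∈ ({u', v} : Finset V) := heq ▸ by simp
      grind
    refine (Finset.card_pair hne).symm.le.trans (Finset.card_le_card ?_)
    intro e he
    rw [Finset.mem_bipartiteAbove, mem_boundary]
    simp only [Finset.mem_insert, Finset.mem_singleton] at he
    rcases he with rfl | rfl
    · exact ⟨⟨Finset.card_pair huv, h⟩, by simp⟩
    · exact ⟨⟨Finset.card_pair hu'v, h'⟩, by simp⟩
  · intro e he
    rw [mem_boundary] at he
    rw [← he.1]
    exact Finset.card_le_card fun v hv => (Finset.mem_bipartiteBelow _).1 hv |>.2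

/-- In a triangulated disk every relative cycle modulo the boundary separates. -/
theorem IsTriangulatedPolygon.exists_coloring (hP : IsTriangulatedPolygon K)
    {S : Finset (Finset V)} (hS : S ⊆ interiorEdges K)
    (heven : ∀ v ∈ nodes K, v ∉ boundaryNodes K → Even (S.filter fun e => v ∈ e).card) :
    ∃ L ⊆ K, ∀ t ∈ K, ∀ t' ∈ K, ∀ e, t ≠ t' → e.card = 2 → e ⊆ t → e ⊆ t' →
      (e ∈ S ↔ ¬ (t ∈ L ↔ t' ∈ L)) := by
  classical
  obtain ⟨hK, hb, hchi⟩ := hP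
  -- Triangles, interior edges and interior nodes form the chain complex relative to the boundary;
  -- the goal is exactness at the interior edges.
  set Q : Finset (Finset V) := (nodes K \ boundaryNodes K).image fun v => {v} with hQ
  have hmemQ : ∀ v : V, {v} ∈ Q ↔ v ∈ nodes K ∧ v ∉ boundaryNodes K := by
    intro v; simp [hQ]
  have hcomp : incidence (interiorEdges K) Q (fun e q => q ⊆ e) ∘ₗ
      incidence K (interiorEdges K) (fun t e => e ⊆ t) = 0 := by
    refine incidence_comp_eq_zero fun t ht q hq => ?_
    obtain ⟨v, hv, rfl⟩ := Finset.mem_image.1 hq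
    rw [Finset.mem_sdiff] at hv
    by_cases hvt : v ∈ t
    · rw [show (interiorEdges K).filter (fun e => e ⊆ t ∧ {v} ⊆ e) =
        (t.powersetCard 2).filter (fun e => v ∈ e) by
          ext e
          simp only [Finset.mem_filter, Finset.mem_powersetCard, Finset.singleton_subset_iff]
          constructor
          · rintro ⟨he, het, hve⟩
            exact ⟨⟨het, (BallSplitting.mem_interiorEdges.1 he).1⟩, hve⟩
          · rintro ⟨⟨het, hc⟩, hve⟩
            exact ⟨mem_interiorEdges_of_notMem_boundaryNodes hc (mem_faces.2 ⟨t, ht, het⟩) hve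
              hv.2, het, hve⟩, card_edges_at (hK.card_eq t ht) hvt]
      decide
    · rw [Finset.filter_false_of_mem]
      · simp
      · rintro e - ⟨h, h'⟩; exact hvt (h (h' (by simp)))
  -- A boundary node has zero indicator on `Q`; connectedness carries membership in the range from
  -- such a node to all others.
  have hsurj : LinearMap.range (incidence (interiorEdges K) Q (fun e q => q ⊆ e)) = ⊤ := by
    set p : V → Prop := fun v => indicator Q {v} ∈
      LinearMap.range (incidence (interiorEdges K) Q (fun e q => q ⊆ e)) with hp
    have hpb : ∀ v ∈ boundaryNodes K, p v := by
      intro v hv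
      have : indicator Q {v} = 0 := by
        ext q
        simp only [indicator, Pi.zero_apply, ite_eq_right_iff, one_ne_zero, imp_false]
        intro h
        have := q.2
        rw [h, hmemQ] at this
        exact this.2 hv
      simp only [hp, this]; exact Submodule.zero_mem _
    refine eq_top_of_indicator_mem _ fun q hq => ?_
    obtain ⟨v, hv, rfl⟩ := Finset.mem_image.1 hq
    obtain ⟨e, he⟩ := hb
    have he' := mem_boundary.1 he
    obtain ⟨a, ha⟩ := Finset.card_pos.1 (show 0 < e.card by omega)
    have hab : a ∈ boundaryNodes K := mem_boundaryNodes.2 ⟨e, ha, he'⟩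
    refine isConnected_iff.1 hK.connected p ?_ a (boundaryNodes_subset_nodes hab) v
      (Finset.mem_sdiff.1 hv).1 (hpb a hab)
    intro t ht x hx y hy hpx
    by_cases hxy : x = y
    · rwa [← hxy]
    by_cases hy' : y ∈ boundaryNodes K
    · exact hpb y hy'
    have hei : ({x, y} : Finset V) ∈ interiorEdges K :=
      mem_interiorEdges_of_notMem_boundaryNodes (Finset.card_pair hxy)
        (mem_faces.2 ⟨t, ht, by grind⟩) (by simp) hy'
    have hsum : incidence (interiorEdges K) Q (fun e q => q ⊆ e) (indicator _ {x, y}) =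
        indicator Q {x} + indicator Q {y} := by
      ext q
      rw [incidence_indicator hei]
      obtain ⟨v, -, hv⟩ := Finset.mem_image.1 q.2
      simp only [indicator, Pi.add_apply, ← hv, Finset.singleton_subset_iff, Finset.mem_insert,
        Finset.mem_singleton, Finset.singleton_inj]
      by_cases h1 : v = x
      · simp [h1, hxy]
      · simp [h1]
    have : indicator Q {y} = incidence (interiorEdges K) Q (fun e q => q ⊆ e)
        (indicator _ {x, y}) - indicator Q {x} := by rw [hsum]; abel
    simp only [hp, this]
    exact Submodule.sub_mem _ ⟨_, rfl⟩ hpx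
  have hpair : ∀ (c : K → ZMod 2) (f : Finset V → ZMod 2), (∀ t : K, f t = c t) →
      ∀ t ∈ K, ∀ t' ∈ K, ∀ e, t ≠ t' → e.card = 2 → e ⊆ t → e ⊆ t' →
      ∃ q : interiorEdges K, (q : Finset V) = e ∧
        incidence K (interiorEdges K) (fun t e => e ⊆ t) c q = f t + f t' := by
    intro c f hf t ht t' ht' e htt he het het'
    refine ⟨⟨e, hK.mem_interiorEdges_of_ne he ht ht' htt het het'⟩, rfl, ?_⟩
    rw [incidence_apply_of_eq c f hf]
    simp only
    rw [hK.filter_eq_pair he ht ht' htt het het', Finset.sum_pair htt]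
  -- A relative 2-cycle takes equal values on triangles with a common edge, so it is constant.
  have hker : LinearMap.ker (incidence K (interiorEdges K) (fun t e => e ⊆ t)) ≤
      Submodule.span (ZMod 2) {fun _ => 1} := by
    intro c hc
    rw [LinearMap.mem_ker] at hc
    set f : Finset V → ZMod 2 := fun s => if h : s ∈ K then c ⟨s, h⟩ else 0 with hf
    have hfc : ∀ p : K, f p = c p := fun p => by simp [hf]
    obtain ⟨t₀, ht₀⟩ := hK.nonempty
    rw [Submodule.mem_span_singleton]
    refine ⟨f t₀, ?_⟩
    ext p
    have := hK.forall_of_locally (p := fun t => f t = f t₀) ?_ ht₀ rfl p p.2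
    · rw [← hfc, this]; simp
    · intro t ht t' ht' e he het het' h
      by_cases htt : t = t'
      · rwa [← htt]
      obtain ⟨q, -, hq⟩ := hpair c f hfc t ht t' ht' e htt he het het'
      rw [hc] at hq
      rw [← h]
      exact (CharTwo.add_eq_zero.1 hq.symm).symm
  -- Characteristic one, with at most as many boundary nodes as boundary edges, gives the reverse of
  -- the dimension inequality.
  have hcard : Module.finrank (ZMod 2) (interiorEdges K → ZMod 2) + 1 ≤
      Module.finrank (ZMod 2) (K → ZMod 2) + Module.finrank (ZMod 2) (Q → ZMod 2) := by
    simp only [Module.finrank_fintype_fun_eq_card, Fintype.card_coe]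
    have h1 : Q.card = (nodes K).card - (boundaryNodes K).card := by
      rw [hQ, Finset.card_image_of_injective _ Finset.singleton_injective,
        Finset.card_sdiff_of_subset boundaryNodes_subset_nodes]
    have hsub : boundary 2 K ⊆ simplices 2 K := Finset.filter_subset _ _
    have h2 : (interiorEdges K).card = (simplices 2 K).card - (boundary 2 K).card := by
      rw [interiorEdges, Finset.card_sdiff_of_subset hsub]
    have h3 := hK.card_boundaryNodes_le
    have h4 := Finset.card_le_card hsub
    have h5 := Finset.card_le_card (boundaryNodes_subset_nodes (K := K))
    rw [eulerChar] at hchi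
    omega
  have hexact := (finrank_of_exact hcomp hsurj hker).2 hcard
  -- Evenness at interior nodes makes `S` a relative cycle; exactness gives a set of triangles
  -- bounded by it, the colour class `L`.
  have hmem : (fun e : interiorEdges K => if (e : Finset V) ∈ S then (1 : ZMod 2) else 0) ∈
      LinearMap.ker (incidence (interiorEdges K) Q (fun e q => q ⊆ e)) := by
    rw [LinearMap.mem_ker]
    ext q
    obtain ⟨v, hv, hvq⟩ := Finset.mem_image.1 q.2
    rw [incidence_apply_of_eq _ (fun e => if e ∈ S then 1 else 0) (fun _ => rfl),
      Finset.sum_boole, Pi.zero_apply, ZMod.natCast_eq_zero_iff_even]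
    convert heven v (Finset.mem_sdiff.1 hv).1 (Finset.mem_sdiff.1 hv).2 using 2
    ext e
    simp only [Finset.mem_filter, ← hvq, Finset.singleton_subset_iff]
    have : e ∈ S → e ∈ interiorEdges K := fun h => hS h
    tauto
  rw [← hexact] at hmem
  obtain ⟨c, hc⟩ := hmem
  set f : Finset V → ZMod 2 := fun s => if h : s ∈ K then c ⟨s, h⟩ else 0 with hf
  have hfc : ∀ p : K, f p = c p := fun p => by simp [hf]
  refine ⟨K.filter (fun t => f t = 1), Finset.filter_subset _ _, ?_⟩
  intro t ht t' ht' e htt he het het'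
  obtain ⟨q, hqe, hq⟩ := hpair c f hfc t ht t' ht' e htt he het het'
  rw [hc] at hq
  change (if (q : Finset V) ∈ S then (1 : ZMod 2) else 0) = _ at hq
  rw [hqe] at hq
  simp only [Finset.mem_filter, ht, ht', true_and]
  have key : ∀ x y : ZMod 2, (x + y = 1 ↔ ¬ (x = 1 ↔ y = 1)) := by decide
  rw [← key, ← hq]
  simp

end Coloring

/-! ### Edges, degrees and faces of a path. -/

section Paths

variable {V : Type*} [DecidableEq V] {γ : List V} {e s : Finset V} {a b u v : V}

theorem pathEdges_nil : pathEdges ([] : List V) = ∅ := rfl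

theorem pathEdges_singleton (a : V) : pathEdges [a] = ∅ := rfl

theorem pathEdges_cons_cons (a b : V) (l : List V) :
    pathEdges (a :: b :: l) = insert {a, b} (pathEdges (b :: l)) := by
  simp [pathEdges]

theorem pathEdges_append (l₁ : List V) (u : V) (l₂ : List V) :
    pathEdges (l₁ ++ u :: l₂) = pathEdges (l₁ ++ [u]) ∪ pathEdges (u :: l₂) := by
  induction l₁ with
  | nil => simp [pathEdges_singleton]
  | cons a l ih =>
    cases l with
    | nil =>
      rw [List.cons_append, List.nil_append, List.cons_append, List.nil_append,
        pathEdges_cons_cons, pathEdges_cons_cons, pathEdges_singleton]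
      rfl
    | cons b l =>
      simp only [List.cons_append, pathEdges_cons_cons] at ih ⊢
      rw [ih, Finset.insert_union]

theorem mem_of_mem_pathEdges (he : e ∈ pathEdges γ) (hv : v ∈ e) : v ∈ γ := by
  induction γ with
  | nil => simp [pathEdges_nil] at he
  | cons a l ih =>
    cases l with
    | nil => simp [pathEdges_singleton] at he
    | cons b l =>
      rw [pathEdges_cons_cons, Finset.mem_insert] at he
      rcases he with rfl | he
      · simp only [Finset.mem_insert, Finset.mem_singleton] at hv
        rcases hv with rfl | rfl <;> simp
      · exact List.mem_cons_of_mem _ (ih he)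

theorem card_of_mem_pathEdges (h : γ.Nodup) (he : e ∈ pathEdges γ) : e.card = 2 := by
  induction γ with
  | nil => simp [pathEdges_nil] at he
  | cons a l ih =>
    cases l with
    | nil => simp [pathEdges_singleton] at he
    | cons b l =>
      rw [pathEdges_cons_cons, Finset.mem_insert] at he
      rcases he with rfl | he
      · refine Finset.card_pair ?_
        rintro rfl
        simp at h
      · exact ih h.of_cons he

theorem exists_mem_pathEdges (h : 2 ≤ γ.length) (hv : v ∈ γ) : ∃ e ∈ pathEdges γ, v ∈ e := by
  induction γ with
  | nil => simp at hv
  | cons a l ih =>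
    cases l with
    | nil => simp at h
    | cons b l =>
      rcases List.mem_cons.1 hv with rfl | hv
      · exact ⟨{v, b}, by simp [pathEdges_cons_cons], by simp⟩
      · cases l with
        | nil =>
          rw [List.mem_singleton] at hv
          subst hv
          exact ⟨{a, v}, by simp [pathEdges_cons_cons], by simp⟩
        | cons c l =>
          obtain ⟨e, he, hve⟩ := ih (by simp) hv
          exact ⟨e, by rw [pathEdges_cons_cons]; exact Finset.mem_insert_of_mem he, hve⟩

theorem facetCount_pathEdges_of_notMem (h : v ∉ γ) : facetCount (pathEdges γ) {v} = 0 := by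
  rw [facetCount_eq_zero, mem_faces]
  rintro ⟨e, he, hv⟩
  exact h (mem_of_mem_pathEdges he (hv (by simp)))

theorem facetCount_singleton_singleton (hv : v ∈ e) :
    facetCount ({e} : Finset (Finset V)) {v} = 1 := by
  simp [facetCount, Finset.filter_singleton, hv]

theorem facetCount_pathEdges_head {l : List V} (h : (a :: b :: l).Nodup) :
    facetCount (pathEdges (a :: b :: l)) {a} = 1 := by
  have ha : a ∉ b :: l := (List.nodup_cons.1 h).1
  rw [pathEdges_cons_cons, Finset.insert_eq, facetCount_union, facetCount_pathEdges_of_notMem ha,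
    facetCount_singleton_singleton (by simp)]
  rw [Finset.disjoint_singleton_left]
  exact fun h => ha (mem_of_mem_pathEdges h (by simp))

theorem facetCount_pathEdges_last {l : List V} (h : (l ++ [b, a]).Nodup) :
    facetCount (pathEdges (l ++ [b, a])) {a} = 1 := by
  have ha : a ∉ l ++ [b] := by
    rw [show l ++ [b, a] = (l ++ [b]) ++ [a] by simp, List.nodup_append] at h
    exact fun h' => h.2.2 a h' a (by simp) rfl
  rw [pathEdges_append, facetCount_union, facetCount_pathEdges_of_notMem ha]
  · rw [zero_add]
    exact facetCount_singleton_singleton (by simp)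
  · rw [Finset.disjoint_left]
    intro e he he'
    rw [pathEdges_cons_cons, pathEdges_singleton] at he'
    rw [Finset.mem_insert] at he'
    rcases he' with rfl | he'
    · exact ha (mem_of_mem_pathEdges he (by simp))
    · simp at he'

/-- Cut at `v`, the simple path falls into two paths which share no node but `v`, hence no edge, and
each has one edge at `v`. -/
theorem facetCount_pathEdges_mid {l₁ l₂ : List V} {c : V}
    (h : (l₁ ++ a :: v :: c :: l₂).Nodup) :
    facetCount (pathEdges (l₁ ++ a :: v :: c :: l₂)) {v} = 2 := by
  rw [show l₁ ++ a :: v :: c :: l₂ = (l₁ ++ [a]) ++ v :: (c :: l₂) by simp] at h ⊢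
  have h1 : (l₁ ++ [a, v]).Nodup := by
    refine h.sublist ?_
    simp
  have h2 : (v :: c :: l₂).Nodup := (List.nodup_append.1 h).2.1
  rw [pathEdges_append, facetCount_union, facetCount_pathEdges_head h2,
    show l₁ ++ [a] ++ [v] = l₁ ++ [a, v] by simp, facetCount_pathEdges_last h1]
  rw [Finset.disjoint_left]
  intro e he he'
  have hsub : e ⊆ {v} := by
    intro x hx
    have hx1 := mem_of_mem_pathEdges he hx
    have hx2 := mem_of_mem_pathEdges he' hx
    rw [List.mem_append] at hx1
    rcases hx1 with hx1 | hx1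
    · exact absurd rfl ((List.nodup_append.1 h).2.2 x hx1 x hx2)
    · simpa using hx1
  have := Finset.card_le_card hsub
  rw [card_of_mem_pathEdges h2 he'] at this
  simp at this

theorem forall_of_pathEdges {p : V → Prop}
    (hp : ∀ e ∈ pathEdges γ, ∀ a ∈ e, ∀ b ∈ e, p a → p b) (hu : u ∈ γ) (hv : v ∈ γ) (h : p u) :
    p v := by
  have key : ∀ (l : List V) (a : V), (∀ e ∈ pathEdges (a :: l), ∀ a ∈ e, ∀ b ∈ e, p a → p b) →
      ∀ x ∈ a :: l, (p a ↔ p x) := by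
    intro l
    induction l with
    | nil => intro a _ x hx; rw [List.mem_singleton] at hx; rw [hx]
    | cons b l ih =>
      intro a hp x hx
      rw [pathEdges_cons_cons] at hp
      have hab : p a ↔ p b :=
        ⟨hp _ (Finset.mem_insert_self _ _) a (by simp) b (by simp),
          hp _ (Finset.mem_insert_self _ _) b (by simp) a (by simp)⟩
      rcases List.mem_cons.1 hx with rfl | hx
      · rfl
      · exact hab.trans (ih b (fun e he => hp e (Finset.mem_insert_of_mem he)) x hx)
  cases γ with
  | nil => simp at hu
  | cons a l => exact (key l a hp v hv).1 ((key l a hp u hu).2 h)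

theorem mem_faces_pathEdges (hγ : γ.Nodup) (hl : 2 ≤ γ.length) :
    s ∈ faces (pathEdges γ) ↔ s = ∅ ∨ (∃ v ∈ γ, s = {v}) ∨ s ∈ pathEdges γ := by
  constructor
  · intro h
    obtain ⟨e, he, hs⟩ := mem_faces.1 h
    have hc := card_of_mem_pathEdges hγ he
    have hle := Finset.card_le_card hs
    rw [hc] at hle
    interval_cases hcs : s.card
    · exact Or.inl (Finset.card_eq_zero.1 hcs)
    · obtain ⟨v, rfl⟩ := Finset.card_eq_one.1 hcs
      exact Or.inr (Or.inl ⟨v, mem_of_mem_pathEdges he (hs (by simp)), rfl⟩)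
    · rw [Finset.eq_of_subset_of_card_le hs (by omega)]
      exact Or.inr (Or.inr he)
  · rintro (rfl | ⟨v, hv, rfl⟩ | h)
    · obtain ⟨e, he, -⟩ := exists_mem_pathEdges hl (List.getElem_mem (show 0 < γ.length by omega))
      exact mem_faces.2 ⟨e, he, by simp⟩
    · obtain ⟨e, he, h⟩ := exists_mem_pathEdges hl hv
      exact mem_faces.2 ⟨e, he, by simpa using h⟩
    · exact mem_faces_of_mem h

/-- Each further edge is glued on along a single node, and the alternating sum over the powerset of
a nonempty set is zero. -/
theorem altSum_faces_pathEdges (hγ : γ.Nodup) (hl : 2 ≤ γ.length) :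
    altSum (faces (pathEdges γ)) = 0 := by
  induction γ with
  | nil => simp at hl
  | cons a l ih =>
    cases l with
    | nil => simp at hl
    | cons b l =>
      have hsingle : faces {({a, b} : Finset V)} = ({a, b} : Finset V).powerset := by simp [faces]
      have hpair : altSum (({a, b} : Finset V).powerset) = 0 :=
        Finset.sum_powerset_neg_one_pow_card_of_nonempty (by simp)
      cases l with
      | nil =>
        rw [pathEdges_cons_cons, pathEdges_singleton]
        change altSum (faces {({a, b} : Finset V)}) = 0
        rw [hsingle, hpair]
      | cons c l =>
        have ha : a ∉ b :: c :: l := (List.nodup_cons.1 hγ).1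
        have hint : ({a, b} : Finset V).powerset ∩ faces (pathEdges (b :: c :: l)) =
            ({b} : Finset V).powerset := by
          ext s
          rw [Finset.mem_inter, Finset.mem_powerset, Finset.mem_powerset]
          constructor
          · rintro ⟨hs, hs'⟩ x hx
            obtain ⟨e, he, hse⟩ := mem_faces.1 hs'
            have hxl := mem_of_mem_pathEdges he (hse hx)
            rcases Finset.mem_insert.1 (hs hx) with rfl | h
            · exact absurd hxl ha
            · exact h
          · intro hs
            exact ⟨hs.trans (by simp), faces_mono_left hs
              ((mem_faces_pathEdges hγ.of_cons (by simp)).2 (Or.inr (Or.inl ⟨b, by simp, rfl⟩)))⟩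
        have := altSum_union ({a, b} : Finset V).powerset (faces (pathEdges (b :: c :: l)))
        rw [hint, hpair, ih hγ.of_cons (by simp), ← hsingle, ← faces_union, ← Finset.insert_eq,
          ← pathEdges_cons_cons, show altSum (({b} : Finset V).powerset) = 0 from
            Finset.sum_powerset_neg_one_pow_card_of_nonempty (by simp)] at this
        simpa using this

end Paths

/-! ### Degrees along a splitting path, and division as an equation of face sets. -/

section SplittingPaths

variable {V : Type*} [DecidableEq V] {I : Finset (Finset V)} {γ : List V} {e s : Finset V}
  {u v : V}

theorem IsSplittingPath.two_le_length (h : IsSplittingPath I γ) : 2 ≤ γ.length := by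
  obtain ⟨-, -, a, m, b, rfl, -⟩ := h
  simp

/-- The ends of the path are exactly its nodes on the boundary of `I`, so degrees are determined by
the position in the disk. -/
theorem IsSplittingPath.facetCount_eq (h : IsSplittingPath I γ) (hv : v ∈ γ) :
    facetCount (pathEdges γ) {v} = if v ∈ boundaryNodes I then 1 else 2 := by
  obtain ⟨hnd, -, a, m, b, rfl, ha, hb, hm⟩ := h
  by_cases hvm : v ∈ m
  · rw [if_neg (hm v hvm)]
    obtain ⟨l₁, l₂, rfl⟩ := List.append_of_mem hvm
    rcases List.eq_nil_or_concat l₁ with rfl | ⟨l₁, x, rfl⟩ <;> rcases l₂ with _ | ⟨y, l₂⟩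
    · exact facetCount_pathEdges_mid (l₁ := []) (l₂ := []) hnd
    · exact facetCount_pathEdges_mid (l₁ := []) (l₂ := l₂ ++ [b]) hnd
    · have := facetCount_pathEdges_mid (l₁ := a :: l₁) (a := x) (v := v) (c := b) (l₂ := [])
        (by simpa using hnd)
      simpa using this
    · have := facetCount_pathEdges_mid (l₁ := a :: l₁) (a := x) (v := v) (c := y)
        (l₂ := l₂ ++ [b]) (by simpa using hnd)
      simpa using this
  · have hvab : v = a ∨ v = b := by
      simp only [List.mem_cons, List.mem_append, List.not_mem_nil, or_false] at hv
      tauto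
    rcases hvab with rfl | rfl
    · rw [if_pos ha]
      cases m with
      | nil => exact facetCount_pathEdges_head hnd
      | cons c m => exact facetCount_pathEdges_head hnd
    · rw [if_pos hb]
      rcases List.eq_nil_or_concat m with rfl | ⟨m, x, rfl⟩
      · exact facetCount_pathEdges_last (l := []) hnd
      · have := facetCount_pathEdges_last (l := a :: m) (b := x) (a := v) (by simpa using hnd)
        simpa using this

/-- Including the empty face gives an equation of face families, as `altSum_union` requires. -/
theorem divides_iff {IL IR : Finset (Finset V)} (hγ : γ.Nodup) (hl : 2 ≤ γ.length) :
    Divides I γ IL IR ↔ IL ∪ IR = I ∧ faces IL ∩ faces IR = faces (pathEdges γ) := by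
  refine and_congr_right fun _ => ?_
  constructor
  · intro h
    have h0 : ∀ s : Finset V, s.Nonempty → (s ∈ faces IL ∩ faces IR ↔ s ∈ faces (pathEdges γ)) := by
      intro s hs
      rw [Finset.mem_inter, mem_faces, mem_faces, h s hs, mem_faces_pathEdges hγ hl]
      simp [hs.ne_empty]
    ext s
    rcases s.eq_empty_or_nonempty with rfl | hs
    · obtain ⟨e, he, h'⟩ := exists_mem_pathEdges hl
        (List.getElem_mem (show 0 < γ.length by omega))
      have hmem := (h0 e ⟨_, h'⟩).2 (mem_faces_of_mem he)
      rw [Finset.mem_inter] at hmem ⊢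
      have := Finset.empty_subset e
      exact ⟨fun _ => faces_mono_left this (mem_faces_of_mem he), fun _ =>
        ⟨faces_mono_left this hmem.1, faces_mono_left this hmem.2⟩⟩
    · exact h0 s hs
  · intro h s hs
    rw [← mem_faces, ← mem_faces, ← Finset.mem_inter, h, mem_faces_pathEdges hγ hl]
    simp [hs.ne_empty]

end SplittingPaths

/-! ### Cutting a disk along a splitting path gives two disks. -/

section Cutting

variable {V : Type*} [DecidableEq V] {I IL IR : Finset (Finset V)} {γ : List V} {e s : Finset V}
  {u v : V}

/-- A splitting path divides a triangulated disk. -/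
theorem IsTriangulatedPolygon.exists_divides (hI : IsTriangulatedPolygon I)
    (hγ : IsSplittingPath I γ) : ∃ IL IR, Divides I γ IL IR := by
  have hS := hI.1
  -- At an interior node the path has degree two or zero, so it is a relative cycle.
  obtain ⟨L, hL, hcol⟩ := hI.exists_coloring hγ.2.1 (by
    intro v hv hvb
    have : ((pathEdges γ).filter fun e => v ∈ e).card = facetCount (pathEdges γ) {v} := by
      simp [facetCount]
    rw [this]
    by_cases hvγ : v ∈ γ
    · rw [hγ.facetCount_eq hvγ, if_neg hvb]; decide
    · rw [facetCount_pathEdges_of_notMem hvγ]; decide)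
  refine ⟨L, I \ L, (divides_iff hγ.1 hγ.two_le_length).2
    ⟨Finset.union_sdiff_of_subset hL, ?_⟩⟩
  -- Off the path no edge at `v` is a path edge, so the colour cannot change around the connected
  -- link of `v`.
  have hnode : ∀ v, ∀ t ∈ L, ∀ t' ∈ I \ L, v ∈ t → v ∈ t' → v ∈ γ := by
    intro v t ht t' ht' hv hv'
    rw [Finset.mem_sdiff] at ht'
    by_contra hvγ
    have hsame : ∀ t ∈ I, ∀ t' ∈ I, ∀ x, x ≠ v → x ∈ t → v ∈ t →
        x ∈ t' → v ∈ t' → t ∈ L → t' ∈ L := by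
      intro t ht t' ht' x hxv hx hv hx' hv' htL
      by_cases htt : t = t'
      · rwa [← htt]
      have h := hcol t ht t' ht' {x, v} htt (Finset.card_pair hxv) (by grind) (by grind)
      have hne : ({x, v} : Finset V) ∉ pathEdges γ :=
        fun h => hvγ (mem_of_mem_pathEdges h (by simp))
      tauto
    have hne : ∀ t ∈ I, v ∈ t → ∃ a ∈ t, a ≠ v := by
      intro t ht hv
      have : 0 < (t.erase v).card := by rw [Finset.card_erase_of_mem hv, hS.card_eq t ht]; omega
      obtain ⟨a, ha⟩ := Finset.card_pos.1 this
      exact ⟨a, Finset.mem_of_mem_erase ha, Finset.ne_of_mem_erase ha⟩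
    obtain ⟨a, ha, hav⟩ := hne t (hL ht) hv
    obtain ⟨b, hb, hbv⟩ := hne t' ht'.1 hv'
    obtain ⟨t₁, ht₁, hb₁, hv₁⟩ := isConnected_iff.1
      (hS.link_connected v (mem_nodes.2 ⟨t, hL ht, hv⟩))
      (fun x => ∃ t ∈ L, x ∈ t ∧ v ∈ t) (by
        rintro s hs x hx y hy ⟨t₁, ht₁, hx₁, hv₁⟩
        rw [mem_link] at hs
        have hxv : x ≠ v := by rintro rfl; exact hs.1 hx
        exact ⟨_, hsame t₁ (hL ht₁) _ hs.2 x hxv hx₁ hv₁ (by simp [hx]) (by simp) ht₁,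
          by simp [hy], by simp⟩)
      a (mem_nodes_link_of_mem_mem (hL ht) ha hv hav) b
      (mem_nodes_link_of_mem_mem ht'.1 hb hv' hbv) ⟨t, ht, ha, hv⟩
    exact ht'.2 (hsame t₁ (hL ht₁) t' ht'.1 b hbv hb₁ hv₁ hb hv' ht₁)
  ext s
  rw [Finset.mem_inter]
  constructor
  · rintro ⟨h, h'⟩
    obtain ⟨t, ht, hst⟩ := mem_faces.1 h
    obtain ⟨t', ht', hst'⟩ := mem_faces.1 h'
    rw [mem_faces_pathEdges hγ.1 hγ.two_le_length]
    have htt : t ≠ t' := by rintro rfl; exact (Finset.mem_sdiff.1 ht').2 ht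
    have hle := Finset.card_le_card hst
    rw [hS.card_eq t (hL ht)] at hle
    interval_cases hc : s.card
    · exact Or.inl (Finset.card_eq_zero.1 hc)
    · obtain ⟨v, rfl⟩ := Finset.card_eq_one.1 hc
      exact Or.inr (Or.inl ⟨v, hnode v t ht t' ht' (hst (by simp)) (hst' (by simp)), rfl⟩)
    · refine Or.inr (Or.inr ((hcol t (hL ht) t' (Finset.mem_sdiff.1 ht').1 s htt hc hst hst').2 ?_))
      have := (Finset.mem_sdiff.1 ht').2
      tauto
    · exfalso
      refine htt ?_
      rw [← Finset.eq_of_subset_of_card_le hst (by rw [hS.card_eq t (hL ht), hc]),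
        ← Finset.eq_of_subset_of_card_le hst' (by rw [hS.card_eq t' (Finset.mem_sdiff.1 ht').1, hc])]
  · intro h
    obtain ⟨e, he, hse⟩ := mem_faces.1 h
    have hei := hS.mem_interiorEdges.1 (hγ.2.1 he)
    obtain ⟨t, t', htt, ⟨ht, het⟩, ⟨ht', het'⟩, -⟩ := facetCount_eq_two hei.2
    have := (hcol t ht t' ht' e htt hei.1 het het').1 he
    have hmem : ∀ t, t ∈ I → t ∉ L → t ∈ I \ L := fun t h h' => Finset.mem_sdiff.2 ⟨h, h'⟩
    by_cases htL : t ∈ L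
    · exact ⟨mem_faces.2 ⟨t, htL, hse.trans het⟩,
        mem_faces.2 ⟨t', hmem t' ht' (by tauto), hse.trans het'⟩⟩
    · exact ⟨mem_faces.2 ⟨t', by tauto, hse.trans het'⟩,
        mem_faces.2 ⟨t, hmem t ht htL, hse.trans het⟩⟩

/-- If a connected complex is a union of two subcomplexes which meet, then every component of one
of them meets the other. -/
theorem IsConnected.exists_mem_inter {K KL KR : Finset (Finset V)} (hK : IsConnected K)
    (hu : KL ∪ KR = K) {s₀ : V} (hL : s₀ ∈ nodes KL) (hR : s₀ ∈ nodes KR) {p : V → Prop}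
    (hp : ∀ t ∈ KL, ∀ a ∈ t, ∀ b ∈ t, p a → p b) (hv : v ∈ nodes KL) (hpv : p v) :
    ∃ s ∈ nodes KL, s ∈ nodes KR ∧ p s := by
  by_contra! hcon
  have hmono : ∀ x, x ∈ nodes KL → x ∈ nodes K := by
    intro x hx
    obtain ⟨t, ht, hxt⟩ := mem_nodes.1 hx
    exact mem_nodes.2 ⟨t, hu ▸ Finset.mem_union_left _ ht, hxt⟩
  -- If no node satisfying `p` were shared, this set would be closed under adjacency in `K`; by
  -- connectedness it would contain the shared node `s₀`.
  have := isConnected_iff.1 hK (fun x => x ∈ nodes KL ∧ p x) (by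
    rintro t ht a ha b hb ⟨haL, hpa⟩
    rw [← hu, Finset.mem_union] at ht
    rcases ht with ht | ht
    · exact ⟨mem_nodes.2 ⟨t, ht, hb⟩, hp t ht a ha b hb hpa⟩
    · exact absurd hpa (hcon a haL (mem_nodes.2 ⟨t, ht, ha⟩))) v (hmono v hv) s₀ (hmono s₀ hL)
    ⟨hv, hpv⟩
  exact hcon s₀ hL hR this.2

theorem Divides.symm (h : Divides I γ IL IR) : Divides I γ IR IL := by
  refine ⟨by rw [Finset.union_comm]; exact h.1, fun s hs => ?_⟩
  rw [and_comm]; exact h.2 s hs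

/-- The data of a disk divided by a splitting path. -/
structure Cut (I : Finset (Finset V)) (γ : List V) (IL IR : Finset (Finset V)) : Prop where
  surface : IsSurface I
  path : IsSplittingPath I γ
  divides : Divides I γ IL IR

namespace Cut

theorem symm (h : Cut I γ IL IR) : Cut I γ IR IL := ⟨h.surface, h.path, h.divides.symm⟩

theorem union_eq (h : Cut I γ IL IR) : IL ∪ IR = I := h.divides.1

theorem left_subset (h : Cut I γ IL IR) : IL ⊆ I := h.union_eq ▸ Finset.subset_union_left

theorem right_subset (h : Cut I γ IL IR) : IR ⊆ I := h.union_eq ▸ Finset.subset_union_right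

theorem faces_inter (h : Cut I γ IL IR) : faces IL ∩ faces IR = faces (pathEdges γ) :=
  ((divides_iff h.path.1 h.path.two_le_length).1 h.divides).2

theorem mem_faces_inter (h : Cut I γ IL IR) :
    s ∈ faces (pathEdges γ) ↔ s ∈ faces IL ∧ s ∈ faces IR := by
  rw [← h.faces_inter, Finset.mem_inter]

theorem mem_pathEdges (h : Cut I γ IL IR) (he : e.card = 2) :
    e ∈ pathEdges γ ↔ e ∈ faces IL ∧ e ∈ faces IR := by
  rw [← h.mem_faces_inter]
  refine ⟨mem_faces_of_mem, fun h' => ?_⟩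
  obtain ⟨e', he', hsub⟩ := mem_faces.1 h'
  rwa [Finset.eq_of_subset_of_card_le hsub (by rw [card_of_mem_pathEdges h.path.1 he', he])]

theorem mem_path (h : Cut I γ IL IR) : v ∈ γ ↔ v ∈ nodes IL ∧ v ∈ nodes IR := by
  rw [mem_nodes_iff_faces, mem_nodes_iff_faces, ← h.mem_faces_inter,
    mem_faces_pathEdges h.path.1 h.path.two_le_length]
  constructor
  · exact fun hv => Or.inr (Or.inl ⟨v, hv, rfl⟩)
  · rintro (h' | ⟨w, hw, h'⟩ | h')
    · simp at h'
    · rw [Finset.singleton_inj] at h'; rwa [h']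
    · exact mem_of_mem_pathEdges h' (by simp)

theorem disjoint (h : Cut I γ IL IR) : Disjoint IL IR := by
  rw [Finset.disjoint_left]
  intro t ht ht'
  obtain ⟨e, he, hsub⟩ := mem_faces.1 (h.mem_faces_inter.2
    ⟨mem_faces_of_mem ht, mem_faces_of_mem ht'⟩)
  have := Finset.card_le_card hsub
  rw [card_of_mem_pathEdges h.path.1 he, h.surface.card_eq t (h.left_subset ht)] at this
  omega

theorem facetCount_add (h : Cut I γ IL IR) (s : Finset V) :
    facetCount IL s + facetCount IR s = facetCount I s := by
  rw [← facetCount_union h.disjoint, h.union_eq]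

/-- The edge is a face of both parts and lies in at most two triangles altogether. -/
theorem facetCount_pathEdge (h : Cut I γ IL IR) (he : e ∈ pathEdges γ) : facetCount IL e = 1 := by
  have hc := card_of_mem_pathEdges h.path.1 he
  obtain ⟨h1, h2⟩ := (h.mem_pathEdges hc).1 he
  rw [← facetCount_pos] at h1 h2
  have := h.facetCount_add e
  have := h.surface.facetCount_le_two hc
  omega

theorem exists_pathEdge (h : Cut I γ IL IR) : ∃ e, e ∈ pathEdges γ := by
  obtain ⟨e, he, -⟩ := exists_mem_pathEdges h.path.two_le_length
    (List.getElem_mem (show 0 < γ.length by have := h.path.two_le_length; omega))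
  exact ⟨e, he⟩

theorem boundary_nonempty (h : Cut I γ IL IR) : (boundary 2 IL).Nonempty := by
  obtain ⟨e, he⟩ := h.exists_pathEdge
  exact ⟨e, mem_boundary.2 ⟨card_of_mem_pathEdges h.path.1 he, h.facetCount_pathEdge he⟩⟩

/-- Since `I` is connected, every component of `IL` reaches the path, and the path is connected
within `IL`. -/
theorem isConnected_left (h : Cut I γ IL IR) : IsConnected IL := by
  rw [isConnected_iff]
  intro p hp u hu v hv hpu
  by_contra hpv
  obtain ⟨e, he⟩ := h.exists_pathEdge
  obtain ⟨x, hx⟩ := Finset.card_pos.1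
    (show 0 < e.card by rw [card_of_mem_pathEdges h.path.1 he]; omega)
  have hxγ := h.mem_path.1 (mem_of_mem_pathEdges he hx)
  obtain ⟨a, haL, haR, hpa⟩ := h.surface.connected.exists_mem_inter h.union_eq hxγ.1 hxγ.2 hp hu hpu
  obtain ⟨b, hbL, hbR, hpb⟩ := h.surface.connected.exists_mem_inter h.union_eq hxγ.1 hxγ.2
    (p := fun x => ¬ p x) (fun t ht a ha b hb h h' => h (hp t ht b hb a ha h')) hv hpv
  refine hpb (forall_of_pathEdges (p := p) ?_ (h.mem_path.2 ⟨haL, haR⟩) (h.mem_path.2 ⟨hbL, hbR⟩) hpa)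
  intro e he x hx y hy hpx
  obtain ⟨t, ht, het⟩ := mem_faces.1 ((h.mem_pathEdges (card_of_mem_pathEdges h.path.1 he)).1 he).1
  exact hp t ht x (het hx) y (het hy) hpx

/-- The two parts of the connected link of `v` meet only in path neighbours of `v`. If the left part
were disconnected, two of its components would contain path neighbours `s` and `s'`, so `v` would be
interior with no third path neighbour. As `s` has degree one in the left link, parity gives another
node `w` of odd degree in its component. It is not a path neighbour, so `{w, v}` would be a boundary
edge of `I` at the interior node `v`. -/
theorem link_connected_left (h : Cut I γ IL IR) (hv : v ∈ nodes IL) : IsConnected (link IL v) := by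
  have hvI : v ∈ nodes I := by
    obtain ⟨t, ht, h'⟩ := mem_nodes.1 hv
    exact mem_nodes.2 ⟨t, h.left_subset ht, h'⟩
  have hcon := h.surface.link_connected v hvI
  have hunion : link IL v ∪ link IR v = link I v := by rw [← link_union, h.union_eq]
  by_cases hvγ : v ∈ γ
  swap
  · rw [h.mem_path] at hvγ
    rw [link_eq_empty.2 (fun h' => hvγ ⟨hv, h'⟩), Finset.union_empty] at hunion
    rwa [hunion]
  have hshare : ∀ x, x ∈ nodes (link IL v) → x ∈ nodes (link IR v) →
      x ≠ v ∧ {x, v} ∈ pathEdges γ := by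
    intro x hx hx'
    rw [mem_nodes_link] at hx hx'
    exact ⟨hx.1, (h.mem_pathEdges (Finset.card_pair hx.1)).2 ⟨hx.2, hx'.2⟩⟩
  obtain ⟨e, he, hve⟩ := exists_mem_pathEdges h.path.two_le_length hvγ
  have hec := card_of_mem_pathEdges h.path.1 he
  obtain ⟨x, hxv, rfl⟩ := exists_eq_pair hec hve
  have hef := (h.mem_pathEdges hec).1 he
  have hxL := mem_nodes_link.2 ⟨hxv, hef.1⟩
  have hxR := mem_nodes_link.2 ⟨hxv, hef.2⟩
  rw [isConnected_iff]
  intro p hp a ha b hb hpa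
  by_contra hpb
  obtain ⟨s, hsL, hsR, hps⟩ := hcon.exists_mem_inter hunion hxL hxR hp ha hpa
  obtain ⟨s', hsL', hsR', hps'⟩ := hcon.exists_mem_inter hunion hxL hxR
    (p := fun x => ¬ p x) (fun t ht a ha b hb h h' => h (hp t ht b hb a ha h')) hb hpb
  obtain ⟨hsv, hs⟩ := hshare s hsL hsR
  obtain ⟨hsv', hs'⟩ := hshare s' hsL' hsR'
  have hcount : ∀ T : Finset V, (∀ x ∈ T, x ≠ v ∧ {x, v} ∈ pathEdges γ) →
      T.card ≤ facetCount (pathEdges γ) {v} := by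
    intro T hT
    refine Finset.card_le_card_of_injOn (fun x => {x, v}) ?_ ?_
    · intro x hx
      simpa using (hT x hx).2
    · intro x hx y hy heq
      have : x ∈ ({y, v} : Finset V) := by
        have h' : ({x, v} : Finset V) = {y, v} := heq
        rw [← h']; simp
      have hxv := (hT x hx).1
      simpa [hxv] using this
  have hss : s ≠ s' := by rintro rfl; exact hps' hps
  have h2 := hcount {s, s'} (by
    intro x hx; rw [Finset.mem_insert, Finset.mem_singleton] at hx
    rcases hx with rfl | rfl <;> tauto)
  rw [Finset.card_pair hss, h.path.facetCount_eq hvγ] at h2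
  have hvb : v ∉ boundaryNodes I := by
    intro h'; rw [if_pos h'] at h2; omega
  have hodd : Odd (facetCount (link IL v) {s}) := by
    rw [facetCount_link_singleton hsv, h.facetCount_pathEdge hs]; decide
  have hcardL : ∀ e ∈ link IL v, e.card = 2 :=
    fun e he => h.surface.card_of_mem_link e (link_mono h.left_subset he)
  obtain ⟨w, hws, hpw, hwodd⟩ := exists_ne_odd_facetCount hcardL hp hps hodd
  have hwv : w ≠ v := (mem_nodes_link.1 (mem_nodes_iff_faces.2 (facetCount_pos.1 hwodd.pos))).1
  rw [facetCount_link_singleton hwv] at hwodd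
  by_cases hwγ : {w, v} ∈ pathEdges γ
  · have h3 := hcount {w, s, s'} (by
      intro x hx; simp only [Finset.mem_insert, Finset.mem_singleton] at hx
      rcases hx with rfl | rfl | rfl <;> tauto)
    have hws' : w ≠ s' := by rintro rfl; exact hps' hpw
    rw [Finset.card_insert_of_notMem (by simp [hws, hws']), Finset.card_pair hss,
      h.path.facetCount_eq hvγ, if_neg hvb] at h3
    omega
  · have hR : facetCount IR {w, v} = 0 := by
      rw [facetCount_eq_zero]
      intro h'
      exact hwγ ((h.mem_pathEdges (Finset.card_pair hwv)).2 ⟨facetCount_pos.1 hwodd.pos, h'⟩)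
    have hadd := h.facetCount_add {w, v}
    have hle := h.surface.facetCount_le_two (Finset.card_pair hwv)
    have hone : facetCount I {w, v} = 1 := by
      obtain ⟨k, hk⟩ := hwodd
      omega
    exact hvb (mem_boundaryNodes_iff_pair.2 ⟨w, hwv, hone⟩)

theorem isSurface_left (h : Cut I γ IL IR) : IsSurface IL where
  nonempty := by
    obtain ⟨e, he⟩ := h.exists_pathEdge
    obtain ⟨t, ht, -⟩ := mem_faces.1 (h.mem_faces_inter.1 (mem_faces_of_mem he)).1
    exact ⟨t, ht⟩
  card_eq t ht := h.surface.card_eq t (h.left_subset ht)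
  edge_le_two e he :=
    (facetCount_mono h.left_subset).trans (h.surface.facetCount_le_two (mem_simplices.1 he).2)
  link_connected _ hv := h.link_connected_left hv
  connected := h.isConnected_left

/-- A splitting path divides a triangulated disk into triangulated disks. -/
theorem isTriangulatedPolygon_left (h : Cut I γ IL IR) (hI : IsTriangulatedPolygon I) :
    IsTriangulatedPolygon IL := by
  refine isTriangulatedPolygon_iff.2 ⟨h.isSurface_left, h.boundary_nonempty, ?_⟩
  have hL := h.isSurface_left.eulerChar_le_one h.boundary_nonempty
  have hR := h.symm.isSurface_left.eulerChar_le_one h.symm.boundary_nonempty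
  -- The parts meet in a path, so their characteristics sum to two; as neither exceeds one, both
  -- equal one.
  have hsum := altSum_union (faces IL) (faces IR)
  rw [← faces_union, h.union_eq, h.faces_inter, altSum_faces_pathEdges h.path.1
    h.path.two_le_length, (isTriangulatedPolygon_iff.1 hI).2.2,
    altSum_faces h.isSurface_left.nonempty h.isSurface_left.card_eq,
    altSum_faces h.symm.isSurface_left.nonempty h.symm.isSurface_left.card_eq] at hsum
  rw [altSum_faces h.isSurface_left.nonempty h.isSurface_left.card_eq]
  omega

end Cut

end Cutting

/-! ### Cones, deletion and contraction. -/

section Cones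

variable {V : Type*} [DecidableEq V] {K L : Finset (Finset V)} {s t : Finset V} {a u v : V}

theorem notMem_of_notMem_nodes (h : a ∉ nodes K) (ht : t ∈ K) : a ∉ t :=
  fun h' => h (mem_nodes.2 ⟨t, ht, h'⟩)

theorem mem_image_insert (h : a ∉ nodes L) : s ∈ L.image (insert a) ↔ a ∈ s ∧ s.erase a ∈ L := by
  rw [Finset.mem_image]
  constructor
  · rintro ⟨x, hx, rfl⟩
    exact ⟨Finset.mem_insert_self _ _,
      by rwa [Finset.erase_insert (notMem_of_notMem_nodes h hx)]⟩
  · rintro ⟨h1, h2⟩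
    exact ⟨_, h2, Finset.insert_erase h1⟩

theorem facetCount_image_insert (h : a ∉ nodes L) (s : Finset V) :
    facetCount (L.image (insert a)) s = facetCount L (s.erase a) := by
  symm
  refine Finset.card_bij (fun x _ => insert a x) ?_ ?_ ?_
  · intro x hx
    rw [Finset.mem_filter] at hx ⊢
    exact ⟨Finset.mem_image_of_mem _ hx.1, by rw [← Finset.erase_subset_iff_of_mem
      (Finset.mem_insert_self _ _), Finset.subset_insert_iff, Finset.erase_idem]; exact hx.2⟩
  · intro x hx y hy heq
    rw [Finset.mem_filter] at hx hy
    rw [← Finset.erase_insert (notMem_of_notMem_nodes h hx.1), heq,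
      Finset.erase_insert (notMem_of_notMem_nodes h hy.1)]
  · intro t ht
    rw [Finset.mem_filter, mem_image_insert h] at ht
    exact ⟨t.erase a, Finset.mem_filter.2 ⟨ht.1.2, Finset.erase_subset_erase _ ht.2⟩,
      Finset.insert_erase ht.1.1⟩

theorem mem_faces_image_insert (h : a ∉ nodes L) :
    s ∈ faces (L.image (insert a)) ↔ s.erase a ∈ faces L := by
  rw [← facetCount_pos, facetCount_image_insert h, facetCount_pos]

theorem facetCount_eq_zero_of_notMem_nodes (h : a ∉ nodes L) (ha : a ∈ s) : facetCount L s = 0 :=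
  facetCount_eq_zero.2 fun h' => h (mem_nodes_of_faces h' ha)

/-- Deletion and contraction of a node. -/
theorem altSum_eq_sub (D : Finset (Finset V)) (a : V) :
    altSum D = altSum (D.filter fun s => a ∉ s) -
      altSum ((D.filter fun s => a ∈ s).image fun s => s.erase a) := by
  have h2 : altSum ((D.filter fun s => a ∈ s).image fun s => s.erase a) =
      - altSum (D.filter fun s => a ∈ s) := by
    rw [altSum, altSum, Finset.sum_image, ← Finset.sum_neg_distrib]
    · refine Finset.sum_congr rfl fun s hs => ?_
      rw [← Finset.card_erase_add_one (Finset.mem_filter.1 hs).2, pow_succ]; ring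
    · intro s hs t ht h
      have h' : s.erase a = t.erase a := h
      rw [← Finset.insert_erase (Finset.mem_filter.1 hs).2, h',
        Finset.insert_erase (Finset.mem_filter.1 ht).2]
  rw [h2, sub_neg_eq_add, add_comm]
  exact (Finset.sum_filter_add_sum_filter_not D (fun s => a ∈ s) _).symm

/-- Deleting the apex and contracting it leave the same family, so faces with and without the apex
cancel. -/
theorem altSum_faces_cone (h : a ∉ nodes L) : altSum (faces (L.image (insert a))) = 0 := by
  rw [altSum_eq_sub _ a, sub_eq_zero]
  congr 1
  ext s
  simp only [Finset.mem_filter, Finset.mem_image, mem_faces_image_insert h]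
  constructor
  · rintro ⟨hs, ha⟩
    exact ⟨insert a s, ⟨by rwa [Finset.erase_insert ha, ← Finset.erase_eq_of_notMem ha],
      Finset.mem_insert_self _ _⟩, Finset.erase_insert ha⟩
  · rintro ⟨t, ⟨ht, -⟩, rfl⟩
    exact ⟨by rwa [Finset.erase_idem], Finset.notMem_erase _ _⟩

theorem altSum_faces_eq_sub (K : Finset (Finset V)) (a : V) :
    altSum (faces K) = altSum ((faces K).filter fun s => a ∉ s) - altSum (faces (link K a)) := by
  rw [altSum_eq_sub _ a]
  congr 2
  ext s
  simp only [Finset.mem_filter, Finset.mem_image, mem_faces_link]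
  constructor
  · rintro ⟨t, ⟨ht, hat⟩, rfl⟩
    exact ⟨Finset.notMem_erase _ _, by rwa [Finset.insert_erase hat]⟩
  · rintro ⟨h1, h2⟩
    exact ⟨_, ⟨h2, Finset.mem_insert_self _ _⟩, Finset.erase_insert h1⟩

end Cones

/-! ### Splitting a node of a complex of any dimension. -/

section VertexSplit

variable {V : Type*} [DecidableEq V] {K L R E : Finset (Finset V)} {n nL nR u v w : V}
  {s t e f : Finset V}

/-- Splitting a node of a complex, in any dimension: `L`, `R` are the two parts of its link and `E`
is their common boundary. -/
def vertexSplit (K : Finset (Finset V)) (n nL nR : V) (L R E : Finset (Finset V)) :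
    Finset (Finset V) :=
  (K.filter fun t => n ∉ t) ∪ L.image (insert nL) ∪ R.image (insert nR) ∪
    E.image fun e => insert nL (insert nR e)

theorem vertexSplit_swap (K : Finset (Finset V)) (n nL nR : V) (L R E : Finset (Finset V)) :
    vertexSplit K n nL nR L R E = vertexSplit K n nR nL R L E := by
  simp only [vertexSplit, Finset.insert_comm nL nR]
  ext s
  simp only [Finset.mem_union]
  tauto

/-- What the split of a 3-manifold and the induced splits of its links have in common; all fields
pass to links (`SplitData.link_of_ne`). -/
structure SplitData (K : Finset (Finset V)) (n nL nR : V) (L R E : Finset (Finset V)) : Prop where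
  union_eq : L ∪ R = link K n
  faces_inter : faces L ∩ faces R = faces E
  disjoint : Disjoint L R
  ne : nL ≠ nR
  ne_left : nL ≠ n
  ne_right : nR ≠ n
  notMem_left : nL ∉ nodes K
  notMem_right : nR ∉ nodes K

theorem nodes_link_subset : nodes (link K v) ⊆ nodes K := by
  intro u hu
  obtain ⟨s, hs, hus⟩ := mem_nodes.1 hu
  exact mem_nodes.2 ⟨_, (mem_link.1 hs).2, Finset.mem_insert_of_mem hus⟩

theorem notMem_nodes_link : v ∉ nodes (link K v) := fun h => (mem_nodes_link.1 h).1 rfl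

theorem nodes_mono (h : K ⊆ L) : nodes K ⊆ nodes L := by
  intro u hu
  obtain ⟨s, hs, hus⟩ := mem_nodes.1 hu
  exact mem_nodes.2 ⟨s, h hs, hus⟩

theorem facetCount_filter_add (K : Finset (Finset V)) (h : v ∉ s) :
    facetCount (K.filter fun t => v ∉ t) s + facetCount (link K v) s = facetCount K s := by
  have hK : (K.filter fun t => v ∉ t) ∪ (link K v).image (insert v) = K := by
    ext t
    rw [Finset.mem_union, Finset.mem_filter, mem_image_insert notMem_nodes_link, mem_link]
    constructor
    · rintro (h | ⟨h1, -, h2⟩)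
      · exact h.1
      · rwa [Finset.insert_erase h1] at h2
    · intro h
      by_cases hv : v ∈ t
      · exact Or.inr ⟨hv, Finset.notMem_erase _ _, by rwa [Finset.insert_erase hv]⟩
      · exact Or.inl ⟨h, hv⟩
  conv_rhs => rw [← hK]
  rw [facetCount_union, facetCount_image_insert notMem_nodes_link, Finset.erase_eq_of_notMem h]
  rw [Finset.disjoint_left]
  intro t ht ht'
  exact (Finset.mem_filter.1 ht).2 ((mem_image_insert notMem_nodes_link).1 ht').1

namespace SplitData

theorem symm (h : SplitData K n nL nR L R E) : SplitData K n nR nL R L E where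
  union_eq := by rw [Finset.union_comm, h.union_eq]
  faces_inter := by rw [Finset.inter_comm, h.faces_inter]
  disjoint := h.disjoint.symm
  ne := h.ne.symm
  ne_left := h.ne_right
  ne_right := h.ne_left
  notMem_left := h.notMem_right
  notMem_right := h.notMem_left

theorem left_subset (h : SplitData K n nL nR L R E) : L ⊆ link K n :=
  h.union_eq ▸ Finset.subset_union_left

theorem mem_faces_inter (h : SplitData K n nL nR L R E) :
    s ∈ faces E ↔ s ∈ faces L ∧ s ∈ faces R := by
  rw [← h.faces_inter, Finset.mem_inter]

theorem nodes_left (h : SplitData K n nL nR L R E) : nodes L ⊆ nodes K :=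
  (nodes_mono h.left_subset).trans nodes_link_subset

theorem nodes_edge (h : SplitData K n nL nR L R E) : nodes E ⊆ nodes L := by
  intro v hv
  rw [mem_nodes_iff_faces] at hv ⊢
  exact (h.mem_faces_inter.1 hv).1

theorem left_notMem_L (h : SplitData K n nL nR L R E) : nL ∉ nodes L :=
  fun h' => h.notMem_left (h.nodes_left h')

theorem right_notMem_L (h : SplitData K n nL nR L R E) : nR ∉ nodes L :=
  fun h' => h.notMem_right (h.nodes_left h')

theorem left_notMem_R (h : SplitData K n nL nR L R E) : nL ∉ nodes R := h.symm.right_notMem_L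

theorem right_notMem_R (h : SplitData K n nL nR L R E) : nR ∉ nodes R := h.symm.left_notMem_L

theorem left_notMem_E (h : SplitData K n nL nR L R E) : nL ∉ nodes E :=
  fun h' => h.left_notMem_L (h.nodes_edge h')

theorem right_notMem_E (h : SplitData K n nL nR L R E) : nR ∉ nodes E :=
  fun h' => h.right_notMem_L (h.nodes_edge h')

theorem center_notMem_L (h : SplitData K n nL nR L R E) : n ∉ nodes L :=
  fun h' => notMem_nodes_link (nodes_mono h.left_subset h')

theorem image_insert_insert :
    (E.image fun e => insert nL (insert nR e)) = (E.image (insert nR)).image (insert nL) := by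
  rw [Finset.image_image]; rfl

theorem left_notMem_cone (h : SplitData K n nL nR L R E) : nL ∉ nodes (E.image (insert nR)) := by
  rw [mem_nodes_iff_faces, mem_faces_image_insert h.right_notMem_E,
    Finset.erase_eq_of_notMem (by simpa using h.ne.symm), ← mem_nodes_iff_faces]
  exact h.left_notMem_E

theorem mem_vertexSplit (h : SplitData K n nL nR L R E) :
    t ∈ vertexSplit K n nL nR L R E ↔ (t ∈ K ∧ n ∉ t) ∨ (nL ∈ t ∧ t.erase nL ∈ L) ∨
      (nR ∈ t ∧ t.erase nR ∈ R) ∨ (nL ∈ t ∧ nR ∈ t ∧ (t.erase nL).erase nR ∈ E) := by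
  rw [vertexSplit, image_insert_insert, Finset.mem_union, Finset.mem_union, Finset.mem_union,
    Finset.mem_filter, mem_image_insert h.left_notMem_L, mem_image_insert h.right_notMem_R,
    mem_image_insert h.left_notMem_cone, mem_image_insert h.right_notMem_E, Finset.mem_erase]
  have := h.ne
  tauto

theorem insert_left_mem (h : SplitData K n nL nR L R E) (hs : s ∈ L) :
    insert nL s ∈ vertexSplit K n nL nR L R E :=
  h.mem_vertexSplit.2 (Or.inr (Or.inl ⟨by simp, by
    rwa [Finset.erase_insert (notMem_of_notMem_nodes h.left_notMem_L hs)]⟩))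

theorem insert_right_mem (h : SplitData K n nL nR L R E) (hs : s ∈ R) :
    insert nR s ∈ vertexSplit K n nL nR L R E := by
  rw [vertexSplit_swap]; exact h.symm.insert_left_mem hs

theorem insert_insert_mem (hs : s ∈ E) :
    insert nL (insert nR s) ∈ vertexSplit K n nL nR L R E :=
  Finset.mem_union_right _ (Finset.mem_image_of_mem _ hs)

theorem mem_of_mem (ht : t ∈ K) (hn : n ∉ t) :
    t ∈ vertexSplit K n nL nR L R E :=
  Finset.mem_union_left _ (Finset.mem_union_left _
    (Finset.mem_union_left _ (Finset.mem_filter.2 ⟨ht, hn⟩)))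

/-- The four families of facets are told apart by the new nodes they contain. Erasing makes one
formula valid for all `f`: counts over families that cannot contain `f` vanish. -/
theorem facetCount_eq (h : SplitData K n nL nR L R E) (f : Finset V) :
    facetCount (vertexSplit K n nL nR L R E) f = facetCount (K.filter fun t => n ∉ t) f +
      facetCount L (f.erase nL) + facetCount R (f.erase nR) +
      facetCount E ((f.erase nL).erase nR) := by
  rw [vertexSplit, image_insert_insert, facetCount_union, facetCount_union, facetCount_union,
    facetCount_image_insert h.left_notMem_L, facetCount_image_insert h.right_notMem_R,
    facetCount_image_insert h.left_notMem_cone, facetCount_image_insert h.right_notMem_E]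
  · rw [Finset.disjoint_left]
    intro t ht ht'
    rw [mem_image_insert h.left_notMem_L] at ht'
    exact notMem_of_notMem_nodes h.notMem_left (Finset.mem_filter.1 ht).1 ht'.1
  · rw [Finset.disjoint_left]
    intro t ht ht'
    rw [mem_image_insert h.right_notMem_R] at ht'
    rw [Finset.mem_union, mem_image_insert h.left_notMem_L] at ht
    rcases ht with ht | ht
    · exact notMem_of_notMem_nodes h.notMem_right (Finset.mem_filter.1 ht).1 ht'.1
    · exact notMem_of_notMem_nodes h.right_notMem_L ht.2 (Finset.mem_erase.2 ⟨h.ne.symm, ht'.1⟩)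
  · rw [Finset.disjoint_left]
    intro t ht ht'
    rw [mem_image_insert h.left_notMem_cone, mem_image_insert h.right_notMem_E] at ht'
    have hnL := ht'.1
    have hnR := Finset.mem_of_mem_erase ht'.2.1
    rw [Finset.mem_union, Finset.mem_union, mem_image_insert h.left_notMem_L,
      mem_image_insert h.right_notMem_R] at ht
    rcases ht with (ht | ht) | ht
    · exact notMem_of_notMem_nodes h.notMem_right (Finset.mem_filter.1 ht).1 hnR
    · exact notMem_of_notMem_nodes h.right_notMem_L ht.2 (Finset.mem_erase.2 ⟨h.ne.symm, hnR⟩)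
    · exact notMem_of_notMem_nodes h.left_notMem_R ht.2 (Finset.mem_erase.2 ⟨h.ne, hnL⟩)

theorem facetCount_link_eq (h : SplitData K n nL nR L R E) (f : Finset V) :
    facetCount (link K n) f = facetCount L f + facetCount R f := by
  rw [← h.union_eq, facetCount_union h.disjoint]

theorem facetCount_of_notMem (h : SplitData K n nL nR L R E) (hn : n ∉ f) (hnL : nL ∉ f)
    (hnR : nR ∉ f) :
    facetCount (vertexSplit K n nL nR L R E) f = facetCount K f + facetCount E f := by
  rw [h.facetCount_eq, Finset.erase_eq_of_notMem hnL, Finset.erase_eq_of_notMem hnR,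
    ← facetCount_filter_add K hn, h.facetCount_link_eq]
  omega

theorem facetCount_insert_left (h : SplitData K n nL nR L R E) (hnL : nL ∉ f) (hnR : nR ∉ f) :
    facetCount (vertexSplit K n nL nR L R E) (insert nL f) = facetCount L f + facetCount E f := by
  have hnR' : nR ∉ insert nL f := by
    rw [Finset.mem_insert]; rintro (h' | h'); exacts [h.ne h'.symm, hnR h']
  rw [h.facetCount_eq, Finset.erase_insert hnL, Finset.erase_eq_of_notMem hnR',
    Finset.erase_eq_of_notMem hnR, facetCount_eq_zero_of_notMem_nodes h.left_notMem_R
      (Finset.mem_insert_self _ _),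
    facetCount_eq_zero_of_notMem_nodes (a := nL) _ (Finset.mem_insert_self _ _)]
  · omega
  · exact fun h' => h.notMem_left (nodes_mono (Finset.filter_subset _ _) h')

theorem facetCount_insert_insert (h : SplitData K n nL nR L R E) (hnL : nL ∉ f) (hnR : nR ∉ f) :
    facetCount (vertexSplit K n nL nR L R E) (insert nL (insert nR f)) = facetCount E f := by
  have hnL' : nL ∉ insert nR f := by
    rw [Finset.mem_insert]; rintro (h' | h'); exacts [h.ne h', hnL h']
  rw [h.facetCount_eq, Finset.erase_insert hnL', Finset.erase_insert hnR,
    facetCount_eq_zero_of_notMem_nodes h.right_notMem_L (Finset.mem_insert_self _ _),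
    facetCount_eq_zero_of_notMem_nodes (a := nL) h.left_notMem_R
      (Finset.mem_erase.2 ⟨h.ne, Finset.mem_insert_self _ _⟩),
    facetCount_eq_zero_of_notMem_nodes (a := nL) _ (Finset.mem_insert_self _ _)]
  · omega
  · exact fun h' => h.notMem_left (nodes_mono (Finset.filter_subset _ _) h')

theorem center_notMem (h : SplitData K n nL nR L R E) :
    n ∉ nodes (vertexSplit K n nL nR L R E) := by
  rw [mem_nodes]
  rintro ⟨t, ht, hn⟩
  have h1 := h.ne_left
  have h2 := h.ne_right
  rcases h.mem_vertexSplit.1 ht with ht | ht | ht | ht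
  · exact ht.2 hn
  · exact notMem_of_notMem_nodes h.center_notMem_L ht.2 (Finset.mem_erase.2 ⟨h1.symm, hn⟩)
  · exact notMem_of_notMem_nodes h.symm.center_notMem_L ht.2 (Finset.mem_erase.2 ⟨h2.symm, hn⟩)
  · exact notMem_of_notMem_nodes (fun h' => h.center_notMem_L (h.nodes_edge h')) ht.2.2
      (Finset.mem_erase.2 ⟨h2.symm, Finset.mem_erase.2 ⟨h1.symm, hn⟩⟩)

/-- The new hemisphere: the left part with a cone of apex `nR` attached along the cut. -/
theorem link_left (h : SplitData K n nL nR L R E) :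
    link (vertexSplit K n nL nR L R E) nL = L ∪ E.image (insert nR) := by
  ext s
  rw [mem_link, Finset.mem_union, mem_image_insert h.right_notMem_E]
  constructor
  · rintro ⟨hs, hs'⟩
    rw [h.mem_vertexSplit, Finset.erase_insert hs] at hs'
    rcases hs' with h' | h' | h' | h'
    · exact absurd (Finset.mem_insert_self _ _) (notMem_of_notMem_nodes h.notMem_left h'.1)
    · exact Or.inl h'.2
    · exact absurd (Finset.mem_erase.2 ⟨h.ne, Finset.mem_insert_self _ _⟩)
        (notMem_of_notMem_nodes h.left_notMem_R h'.2)
    · exact Or.inr ⟨(Finset.mem_insert.1 h'.2.1).resolve_left h.ne.symm, h'.2.2⟩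
  · rintro (h' | ⟨h1, h2⟩)
    · exact ⟨notMem_of_notMem_nodes h.left_notMem_L h', h.insert_left_mem h'⟩
    · refine ⟨fun h3 => notMem_of_notMem_nodes h.left_notMem_E h2
        (Finset.mem_erase.2 ⟨h.ne, h3⟩), ?_⟩
      have := insert_insert_mem (K := K) (n := n) (nL := nL) (nR := nR) (L := L) (R := R) h2
      rwa [Finset.insert_erase h1] at this

/-- Links commute with splitting, so the hemisphere of an old node is itself split, one dimension
lower. -/
theorem link_of_ne (h : SplitData K n nL nR L R E) (hn : w ≠ n) (hL : w ≠ nL) (hR : w ≠ nR) :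
    SplitData (link K w) n nL nR (link L w) (link R w) (link E w) ∧
    link (vertexSplit K n nL nR L R E) w =
      vertexSplit (link K w) n nL nR (link L w) (link R w) (link E w) := by
  have hd : SplitData (link K w) n nL nR (link L w) (link R w) (link E w) :=
    { union_eq := by rw [← link_union, h.union_eq, link_comm hn]
      faces_inter := by
        ext s
        rw [Finset.mem_inter, mem_faces_link, mem_faces_link, mem_faces_link, h.mem_faces_inter]
        tauto
      disjoint := by
        rw [Finset.disjoint_left]
        intro t ht ht'
        rw [mem_link] at ht ht'
        exact Finset.disjoint_left.1 h.disjoint ht.2 ht'.2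
      ne := h.ne
      ne_left := h.ne_left
      ne_right := h.ne_right
      notMem_left := fun h' => h.notMem_left (nodes_link_subset h')
      notMem_right := fun h' => h.notMem_right (nodes_link_subset h') }
  refine ⟨hd, ?_⟩
  ext s
  rw [mem_link, h.mem_vertexSplit, hd.mem_vertexSplit]
  simp only [mem_link, Finset.mem_insert, Finset.mem_erase, Finset.erase_insert_of_ne hL,
    Finset.erase_insert_of_ne hR, hn.symm, hL.symm, hR.symm, false_or, not_false_eq_true,
    true_and, ne_eq, hL, hR]
  tauto

/-- Splitting a node preserves connectedness. -/
theorem isConnected (h : SplitData K n nL nR L R E) (hK : IsConnected K) :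
    IsConnected (vertexSplit K n nL nR L R E) := by
  rw [isConnected_iff]
  intro p hp
  have hLR : ∀ x ∈ nodes (vertexSplit K n nL nR L R E), ∀ y ∈ nodes (vertexSplit K n nL nR L R E),
      (x = nL ∨ x = nR) → (y = nL ∨ y = nR) → p x → p y := by
    -- If both new nodes occur, the empty face belongs to `L` and to `R`, hence to `E`; so `E` is
    -- nonempty and a facet joins them.
    have key : nL ∈ nodes (vertexSplit K n nL nR L R E) →
        nR ∈ nodes (vertexSplit K n nL nR L R E) → (p nL ↔ p nR) := by
      intro hL hR
      have hE : E.Nonempty := by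
        have hL' : ∅ ∈ faces L := by
          rw [← facetCount_pos]
          obtain ⟨t, ht, h'⟩ := mem_nodes.1 hL
          have hlink : t.erase nL ∈ link (vertexSplit K n nL nR L R E) nL :=
            mem_link.2 ⟨Finset.notMem_erase _ _, by rwa [Finset.insert_erase h']⟩
          rw [facetCount_pos]
          rw [h.link_left, Finset.mem_union, mem_image_insert h.right_notMem_E] at hlink
          rcases hlink with h1 | h1
          · exact mem_faces.2 ⟨_, h1, by simp⟩
          · exact faces_mono_left (Finset.empty_subset _)
              (h.mem_faces_inter.1 (mem_faces_of_mem h1.2)).1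
        have hR' : ∅ ∈ faces R := by
          obtain ⟨t, ht, h'⟩ := mem_nodes.1 hR
          rw [vertexSplit_swap] at ht
          have hlink : t.erase nR ∈ link (vertexSplit K n nR nL R L E) nR :=
            mem_link.2 ⟨Finset.notMem_erase _ _, by rwa [Finset.insert_erase h']⟩
          rw [h.symm.link_left, Finset.mem_union, mem_image_insert h.left_notMem_E] at hlink
          rcases hlink with h1 | h1
          · exact mem_faces.2 ⟨_, h1, by simp⟩
          · exact faces_mono_left (Finset.empty_subset _)
              (h.mem_faces_inter.1 (mem_faces_of_mem h1.2)).2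
        obtain ⟨e, he, -⟩ := mem_faces.1 (h.mem_faces_inter.2 ⟨hL', hR'⟩)
        exact ⟨e, he⟩
      obtain ⟨e, he⟩ := hE
      have hm := insert_insert_mem (K := K) (n := n) (nL := nL) (nR := nR) (L := L) (R := R) he
      exact ⟨hp _ hm nL (by simp) nR (by simp), hp _ hm nR (by simp) nL (by simp)⟩
    rintro x hx y hy (rfl | rfl) (rfl | rfl) hpx
    · exact hpx
    · exact (key hx hy).1 hpx
    · exact (key hy hx).2 hpx
    · exact hpx
  intro u hu v hv hpu
  -- `c x` collapses the two new nodes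
  set c : V → V := fun x => if x = nL ∨ x = nR then n else x with hc
  have hcoll : ∀ t ∈ vertexSplit K n nL nR L R E, ∃ t' ∈ K, ∀ x ∈ t, c x ∈ t' := by
    intro t ht
    have hlink : ∀ s, s ∈ L ∨ s ∈ R → insert n s ∈ K := by
      intro s hs
      rw [← Finset.mem_union, h.union_eq, mem_link] at hs
      exact hs.2
    have aux : ∀ s : Finset V, (∀ x ∈ t, x = nL ∨ x = nR ∨ x ∈ s) → ∀ x ∈ t, c x ∈ insert n s := by
      intro s hs x hx
      simp only [hc]
      split_ifs with hx'
      · simp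
      · have := hs x hx
        rw [Finset.mem_insert]; tauto
    rcases h.mem_vertexSplit.1 ht with h' | h' | h' | h'
    · refine ⟨t, h'.1, fun x hx => ?_⟩
      have hx1 : x ≠ nL := by rintro rfl; exact notMem_of_notMem_nodes h.notMem_left h'.1 hx
      have hx2 : x ≠ nR := by rintro rfl; exact notMem_of_notMem_nodes h.notMem_right h'.1 hx
      simpa only [hc, hx1, hx2, or_self, if_false] using hx
    · exact ⟨_, hlink _ (Or.inl h'.2), aux _ fun x hx => by rw [Finset.mem_erase]; tauto⟩
    · exact ⟨_, hlink _ (Or.inr h'.2), aux _ fun x hx => by rw [Finset.mem_erase]; tauto⟩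
    · obtain ⟨s, hs, hsub⟩ := mem_faces.1 (h.mem_faces_inter.1 (mem_faces_of_mem h'.2.2)).1
      refine ⟨_, hlink s (Or.inl hs), aux _ fun x hx => ?_⟩
      by_cases h1 : x = nL
      · exact Or.inl h1
      · by_cases h2 : x = nR
        · exact Or.inr (Or.inl h2)
        · exact Or.inr (Or.inr (hsub (Finset.mem_erase.2 ⟨h2, Finset.mem_erase.2 ⟨h1, hx⟩⟩)))
  have hcnode : ∀ x ∈ nodes (vertexSplit K n nL nR L R E), c x ∈ nodes K := by
    intro x hx
    obtain ⟨t, ht, hxt⟩ := mem_nodes.1 hx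
    obtain ⟨t', ht', h'⟩ := hcoll t ht
    exact mem_nodes.2 ⟨t', ht', h' x hxt⟩
  have hcx : ∀ x ∈ nodes (vertexSplit K n nL nR L R E), x ≠ n := by
    rintro x hx rfl; exact h.center_notMem hx
  have hceq : ∀ x ∈ nodes (vertexSplit K n nL nR L R E),
      ∀ y ∈ nodes (vertexSplit K n nL nR L R E), c x = c y → p x → p y := by
    intro x hx y hy hxy hpx
    have h1 := hcx x hx
    have h2 := hcx y hy
    by_cases hx' : x = nL ∨ x = nR <;> by_cases hy' : y = nL ∨ y = nR
    · exact hLR x hx y hy hx' hy' hpx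
    · simp only [hc, hx', hy', if_true, if_false] at hxy; exact absurd hxy.symm h2
    · simp only [hc, hx', hy', if_true, if_false] at hxy; exact absurd hxy h1
    · simp only [hc, hx', hy', if_false] at hxy; rwa [← hxy]
  -- The transported predicate on `K`: some preimage under the collapse satisfies `p`. It propagates
  -- because each facet of `K` lifts to the split.
  obtain ⟨x, hx, hxv, hpx⟩ := isConnected_iff.1 hK
    (fun z => ∃ x ∈ nodes (vertexSplit K n nL nR L R E), c x = z ∧ p x) (by
      rintro t ht a ha b hb ⟨x, hx, rfl, hpx⟩
      have hlift : ∃ t' ∈ vertexSplit K n nL nR L R E, ∀ z ∈ t, ∃ z' ∈ t', c z' = z := by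
        by_cases hn : n ∈ t
        · have hl : t.erase n ∈ link K n :=
            mem_link.2 ⟨Finset.notMem_erase _ _, by rwa [Finset.insert_erase hn]⟩
          have aux : ∀ a, (a = nL ∨ a = nR) → ∀ z ∈ t, ∃ z' ∈ insert a (t.erase n), c z' = z := by
            intro a ha z hz
            by_cases hzn : z = n
            · exact ⟨a, by simp, by simp only [hc, ha, if_true, hzn]⟩
            · have hz1 : z ≠ nL := by
                rintro rfl; exact notMem_of_notMem_nodes h.notMem_left ht hz
              have hz2 : z ≠ nR := by
                rintro rfl; exact notMem_of_notMem_nodes h.notMem_right ht hz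
              exact ⟨z, by simp [hzn, hz], by simp only [hc, hz1, hz2, or_self, if_false]⟩
          rw [← h.union_eq, Finset.mem_union] at hl
          rcases hl with hl | hl
          · exact ⟨_, h.insert_left_mem hl, aux nL (Or.inl rfl)⟩
          · exact ⟨_, h.insert_right_mem hl, aux nR (Or.inr rfl)⟩
        · refine ⟨t, mem_of_mem ht hn, fun z hz => ⟨z, hz, ?_⟩⟩
          have hz1 : z ≠ nL := by rintro rfl; exact notMem_of_notMem_nodes h.notMem_left ht hz
          have hz2 : z ≠ nR := by rintro rfl; exact notMem_of_notMem_nodes h.notMem_right ht hz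
          simp only [hc, hz1, hz2, or_self, if_false]
      obtain ⟨t', ht', hz⟩ := hlift
      obtain ⟨a', ha', hca⟩ := hz _ ha
      obtain ⟨b', hb', hcb⟩ := hz _ hb
      have hna := mem_nodes.2 ⟨t', ht', ha'⟩
      exact ⟨b', mem_nodes.2 ⟨t', ht', hb'⟩, hcb, hp t' ht' a' ha' b' hb'
        (hceq x hx a' hna hca.symm hpx)⟩)
    (c u) (hcnode u hu) (c v) (hcnode v hv) ⟨u, hu, rfl, hpu⟩
  exact hceq x hx v hv hxv hpx

/-- Splitting a node preserves the Euler characteristic. -/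
theorem altSum_faces (h : SplitData K n nL nR L R E) :
    altSum (faces (vertexSplit K n nL nR L R E)) = altSum (faces K) := by
  have hmemf : ∀ s, s ∈ faces (vertexSplit K n nL nR L R E) ↔
      s ∈ faces (K.filter fun t => n ∉ t) ∨ s.erase nL ∈ faces L ∨ s.erase nR ∈ faces R ∨
      (s.erase nL).erase nR ∈ faces E := by
    intro s
    rw [← facetCount_pos, h.facetCount_eq, ← facetCount_pos, ← facetCount_pos, ← facetCount_pos,
      ← facetCount_pos]
    omega
  have hlinkface : ∀ s, (s ∈ faces L ∨ s ∈ faces R) → s ∈ faces K ∧ n ∉ s := by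
    intro s hs
    rw [← Finset.mem_union, ← faces_union, h.union_eq, mem_faces_link] at hs
    exact ⟨faces_mono_left (Finset.subset_insert _ _) hs.2, hs.1⟩
  -- Without `nL` there remains `K` without `n`, with the cone of apex `nR` glued on along `R`.
  have hdel : (faces (vertexSplit K n nL nR L R E)).filter (fun s => nL ∉ s) =
      (faces K).filter (fun s => n ∉ s) ∪ faces (R.image (insert nR)) := by
    ext s
    rw [Finset.mem_filter, Finset.mem_union, Finset.mem_filter, hmemf,
      mem_faces_image_insert h.right_notMem_R]
    have hfil : s ∈ faces (K.filter fun t => n ∉ t) → s ∈ faces K ∧ n ∉ s := by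
      intro hs
      obtain ⟨t, ht, hst⟩ := mem_faces.1 hs
      rw [Finset.mem_filter] at ht
      exact ⟨mem_faces.2 ⟨t, ht.1, hst⟩, fun h' => ht.2 (hst h')⟩
    constructor
    · rintro ⟨hs, hnL⟩
      rw [Finset.erase_eq_of_notMem hnL] at hs
      rcases hs with hs | hs | hs | hs
      · exact Or.inl (hfil hs)
      · exact Or.inl (hlinkface s (Or.inl hs))
      · exact Or.inr hs
      · exact Or.inr (h.mem_faces_inter.1 hs).2
    · rintro (⟨hs, hn⟩ | hs)
      · have hnL : nL ∉ s := fun h' => h.notMem_left (mem_nodes_of_faces hs h')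
        have hnR : nR ∉ s := fun h' => h.notMem_right (mem_nodes_of_faces hs h')
        refine ⟨?_, hnL⟩
        rw [Finset.erase_eq_of_notMem hnL, Finset.erase_eq_of_notMem hnR]
        obtain ⟨t, ht, hst⟩ := mem_faces.1 hs
        by_cases hnt : n ∈ t
        · have hl : s ∈ faces (link K n) :=
            mem_faces_link.2 ⟨hn, mem_faces.2 ⟨t, ht, Finset.insert_subset hnt hst⟩⟩
          rw [← h.union_eq, faces_union, Finset.mem_union] at hl
          tauto
        · exact Or.inl (mem_faces.2 ⟨t, Finset.mem_filter.2 ⟨ht, hnt⟩, hst⟩)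
      · refine ⟨Or.inr (Or.inr (Or.inl hs)), fun h' => h.left_notMem_R
          (mem_nodes_of_faces hs (Finset.mem_erase.2 ⟨h.ne, h'⟩))⟩
  have hint : (faces K).filter (fun s => n ∉ s) ∩ faces (R.image (insert nR)) = faces R := by
    ext s
    rw [Finset.mem_inter, Finset.mem_filter, mem_faces_image_insert h.right_notMem_R]
    constructor
    · rintro ⟨⟨hs, -⟩, hs'⟩
      rwa [Finset.erase_eq_of_notMem fun h' => h.notMem_right (mem_nodes_of_faces hs h')] at hs'
    · intro hs
      exact ⟨hlinkface s (Or.inr hs), faces_mono_left (Finset.erase_subset _ _) hs⟩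
  have hint' : faces L ∩ faces (E.image (insert nR)) = faces E := by
    ext s
    rw [Finset.mem_inter, mem_faces_image_insert h.right_notMem_E]
    constructor
    · rintro ⟨hs, hs'⟩
      rwa [Finset.erase_eq_of_notMem fun h' => h.right_notMem_L (mem_nodes_of_faces hs h')] at hs'
    · intro hs
      exact ⟨(h.mem_faces_inter.1 hs).1, faces_mono_left (Finset.erase_subset _ _) hs⟩
  have h1 := altSum_union ((faces K).filter fun s => n ∉ s) (faces (R.image (insert nR)))
  have h2 := altSum_union (faces L) (faces (E.image (insert nR)))
  have h3 := altSum_union (faces L) (faces R)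
  rw [hint, altSum_faces_cone h.right_notMem_R] at h1
  rw [hint', altSum_faces_cone h.right_notMem_E] at h2
  rw [← faces_union, h.union_eq, h.faces_inter] at h3
  -- Deletion and contraction at `nL` and at `n`: cones contribute zero, and the terms of `L`, `R`
  -- and `E` agree by inclusion–exclusion.
  rw [altSum_faces_eq_sub _ nL, hdel, h.link_left, faces_union, altSum_faces_eq_sub K n]
  linarith

/-- A triangulated disk stays one when a node is split, if this is so at the new nodes. -/
theorem isTriangulatedPolygon (h : SplitData K n nL nR L R E) (hK : IsTriangulatedPolygon K)
    (hcard : ∀ t ∈ vertexSplit K n nL nR L R E, t.card = 3)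
    (hlink : ∀ a, (a = nL ∨ a = nR) → a ∈ nodes (vertexSplit K n nL nR L R E) →
      IsConnected (link (vertexSplit K n nL nR L R E) a))
    (hedge : ∀ a, (a = nL ∨ a = nR) → ∀ e, e.card = 2 → a ∈ e →
      facetCount (vertexSplit K n nL nR L R E) e ≤ 2)
    (hb : (boundary 2 (vertexSplit K n nL nR L R E)).Nonempty) :
    IsTriangulatedPolygon (vertexSplit K n nL nR L R E) := by
  refine isTriangulatedPolygon_iff.2 ⟨?_, hb, ?_⟩
  · refine ⟨?_, hcard, ?_, ?_, h.isConnected hK.1.connected⟩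
    · obtain ⟨e, he⟩ := hb
      obtain ⟨t, ht, -⟩ := mem_faces.1
        (facetCount_pos.1 (show 0 < facetCount _ e by rw [(mem_boundary.1 he).2]; omega))
      exact ⟨t, ht⟩
    · intro e he
      rw [mem_simplices] at he
      change facetCount _ e ≤ 2
      by_cases hL : nL ∈ e
      · exact hedge nL (Or.inl rfl) e he.2 hL
      by_cases hR : nR ∈ e
      · exact hedge nR (Or.inr rfl) e he.2 hR
      have hn : n ∉ e := fun h' => h.center_notMem (mem_nodes_of_faces he.1 h')
      rw [h.facetCount_of_notMem hn hL hR]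
      -- Facets have three nodes, two of them new, so the members of `E` are single nodes and
      -- contain no edge.
      have hE : facetCount E e = 0 := by
        rw [facetCount_eq_zero, mem_faces]
        rintro ⟨s, hs, hes⟩
        have hc := hcard _ (insert_insert_mem (K := K) (n := n) (nL := nL) (nR := nR) (L := L)
          (R := R) hs)
        have hsR := notMem_of_notMem_nodes h.right_notMem_E hs
        have hsL := notMem_of_notMem_nodes h.left_notMem_E hs
        rw [Finset.card_insert_of_notMem, Finset.card_insert_of_notMem hsR] at hc
        · have := Finset.card_le_card hes
          omega
        · rw [Finset.mem_insert]; rintro (h' | h'); exacts [h.ne h', hsL h']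
      rw [hE]
      exact hK.1.facetCount_le_two he.2
    · intro v hv
      by_cases hL : v = nL
      · exact hlink v (Or.inl hL) hv
      by_cases hR : v = nR
      · exact hlink v (Or.inr hR) hv
      have hn : v ≠ n := by rintro rfl; exact h.center_notMem hv
      obtain ⟨hd, heq⟩ := h.link_of_ne hn hL hR
      rw [heq]
      refine hd.isConnected ?_
      by_cases hvK : v ∈ nodes K
      · exact hK.1.link_connected v hvK
      · rw [link_eq_empty.2 hvK]
        intro u hu
        simp [nodes] at hu
  · rw [h.altSum_faces]; exact (isTriangulatedPolygon_iff.1 hK).2.2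

end SplitData

end VertexSplit

/-! ### Attaching a cone along the cut. -/

section Cone

variable {V : Type*} [DecidableEq V] {I IL IR : Finset (Finset V)} {γ : List V} {a v : V}

/-- Attaching a cone along the splitting path to one of the two parts of a divided disk gives a
triangulated disk. -/
theorem Cut.isTriangulatedPolygon_cone (h : Cut I γ IL IR) (hI : IsTriangulatedPolygon I)
    (ha : a ∉ nodes I) : IsTriangulatedPolygon (IL ∪ (pathEdges γ).image (insert a)) := by
  have hP := h.isTriangulatedPolygon_left hI
  have hS := hP.1
  have haL : a ∉ nodes IL := fun h' => ha (nodes_mono h.left_subset h')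
  have haγ' : a ∉ γ := fun h' => haL (h.mem_path.1 h').1
  have haγ : a ∉ nodes (pathEdges γ) := by
    rw [mem_nodes]; rintro ⟨e, he, h'⟩; exact haγ' (mem_of_mem_pathEdges he h')
  have hdisj : Disjoint IL ((pathEdges γ).image (insert a)) := by
    rw [Finset.disjoint_left]
    intro t ht ht'
    exact notMem_of_notMem_nodes haL ht ((mem_image_insert haγ).1 ht').1
  have hcount : ∀ e, facetCount (IL ∪ (pathEdges γ).image (insert a)) e =
      facetCount IL e + facetCount (pathEdges γ) (e.erase a) := by
    intro e
    rw [facetCount_union hdisj, facetCount_image_insert haγ]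
  have hdeg : ∀ v, facetCount (pathEdges γ) {v} ≤ 2 := by
    intro v
    by_cases hv : v ∈ γ
    · rw [h.path.facetCount_eq hv]; split_ifs <;> omega
    · rw [facetCount_pathEdges_of_notMem hv]; omega
  have herase : ∀ v, v ≠ a → ({v, a} : Finset V).erase a = {v} := by
    intro v hv; ext x; simp only [Finset.mem_erase, Finset.mem_insert, Finset.mem_singleton]
    constructor
    · tauto
    · rintro rfl; exact ⟨hv, Or.inl rfl⟩
  obtain ⟨-, -, x, m, y, hγ, hxb, -, -⟩ := id h.path
  have hxγ : x ∈ γ := by rw [hγ]; simp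
  have hxa : x ≠ a := by rintro rfl; exact haγ' hxγ
  refine isTriangulatedPolygon_iff.2 ⟨⟨?_, ?_, ?_, ?_, ?_⟩, ?_, ?_⟩
  · exact hS.nonempty.mono Finset.subset_union_left
  · intro t ht
    rcases Finset.mem_union.1 ht with ht | ht
    · exact hS.card_eq t ht
    · obtain ⟨e, he, rfl⟩ := Finset.mem_image.1 ht
      rw [Finset.card_insert_of_notMem (notMem_of_notMem_nodes haγ he),
        card_of_mem_pathEdges h.path.1 he]
  · intro e he
    have hc := (mem_simplices.1 he).2
    change facetCount _ e ≤ 2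
    rw [hcount]
    by_cases hae : a ∈ e
    · obtain ⟨v, hva, rfl⟩ := exists_eq_pair hc hae
      rw [facetCount_eq_zero_of_notMem_nodes haL hae, herase v hva, zero_add]
      exact hdeg v
    · rw [Finset.erase_eq_of_notMem hae]
      by_cases heγ : e ∈ pathEdges γ
      · rw [h.facetCount_pathEdge heγ]
        have : facetCount (pathEdges γ) e ≤ 1 := by
          refine Finset.card_le_one.2 fun s hs t ht => ?_
          rw [Finset.mem_filter] at hs ht
          rw [← Finset.eq_of_subset_of_card_le hs.2
            (by rw [card_of_mem_pathEdges h.path.1 hs.1, hc]),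
            ← Finset.eq_of_subset_of_card_le ht.2
            (by rw [card_of_mem_pathEdges h.path.1 ht.1, hc])]
        omega
      · have h0 : facetCount (pathEdges γ) e = 0 := by
          rw [facetCount_eq_zero, mem_faces]
          rintro ⟨s, hs, hes⟩
          rw [Finset.eq_of_subset_of_card_le hes
            (by rw [card_of_mem_pathEdges h.path.1 hs, hc])] at heγ
          exact heγ hs
        rw [h0]
        exact hS.facetCount_le_two hc
  · intro v hv
    by_cases hva : v = a
    · subst hva
      have hl : link (IL ∪ (pathEdges γ).image (insert v)) v = pathEdges γ := by
        ext s
        rw [mem_link, Finset.mem_union, mem_image_insert haγ]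
        constructor
        · rintro ⟨h1, h2 | h2⟩
          · exact absurd (Finset.mem_insert_self _ _) (notMem_of_notMem_nodes haL h2)
          · rw [Finset.erase_insert h1] at h2; exact h2.2
        · intro hs
          have := notMem_of_notMem_nodes haγ hs
          exact ⟨this, Or.inr ⟨by simp, by rwa [Finset.erase_insert this]⟩⟩
      rw [hl, isConnected_iff]
      intro p hp u hu w hw hpu
      obtain ⟨e, he, hue⟩ := mem_nodes.1 hu
      obtain ⟨e', he', hwe⟩ := mem_nodes.1 hw
      exact forall_of_pathEdges hp (mem_of_mem_pathEdges he hue) (mem_of_mem_pathEdges he' hwe) hpu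
    · rw [link_union, isConnected_iff]
      intro p hp
      have hvL : v ∈ nodes IL := by
        obtain ⟨t, ht, hvt⟩ := mem_nodes.1 hv
        rcases Finset.mem_union.1 ht with ht | ht
        · exact mem_nodes.2 ⟨t, ht, hvt⟩
        · obtain ⟨e, he, rfl⟩ := Finset.mem_image.1 ht
          exact (h.mem_path.1 (mem_of_mem_pathEdges he
            ((Finset.mem_insert.1 hvt).resolve_left hva))).1
      -- every node of the link has a neighbour in the link of `v` in `IL`
      have hnb : ∀ u ∈ nodes (link IL v ∪ link ((pathEdges γ).image (insert a)) v),
          ∃ u' ∈ nodes (link IL v), (p u ↔ p u') := by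
        intro u hu
        obtain ⟨s, hs, hus⟩ := mem_nodes.1 hu
        rcases Finset.mem_union.1 hs with hs | hs
        · exact ⟨u, mem_nodes.2 ⟨s, hs, hus⟩, Iff.rfl⟩
        · have hs' := mem_link.1 hs
          rw [mem_image_insert haγ, Finset.erase_insert_of_ne hva] at hs'
          obtain ⟨hvs, has, he⟩ := hs'
          have has' : a ∈ s := (Finset.mem_insert.1 has).resolve_left (Ne.symm hva)
          have hc := card_of_mem_pathEdges h.path.1 he
          obtain ⟨w, hwv, hw⟩ := exists_eq_pair hc (Finset.mem_insert_self v _)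
          have hwL : w ∈ nodes (link IL v) :=
            mem_nodes_link.2 ⟨hwv, ((h.mem_pathEdges (Finset.card_pair hwv)).1 (hw ▸ he)).1⟩
          have hws : w ∈ s := by
            have : w ∈ insert v (s.erase a) := hw ▸ by simp
            exact Finset.mem_of_mem_erase ((Finset.mem_insert.1 this).resolve_left hwv)
          exact ⟨w, hwL, hp s (Finset.mem_union_right _ hs) u hus w hws,
            hp s (Finset.mem_union_right _ hs) w hws u hus⟩
      intro u hu w hw hpu
      obtain ⟨u', hu', h1⟩ := hnb u hu
      obtain ⟨w', hw', h2⟩ := hnb w hw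
      exact h2.2 (isConnected_iff.1 (hS.link_connected v hvL) p
        (fun t ht => hp t (Finset.mem_union_left _ ht)) u' hu' w' hw' (h1.1 hpu))
  · rw [isConnected_iff]
    intro p hp
    have hnb : ∀ u ∈ nodes (IL ∪ (pathEdges γ).image (insert a)),
        ∃ u' ∈ nodes IL, (p u ↔ p u') := by
      intro u hu
      obtain ⟨s, hs, hus⟩ := mem_nodes.1 hu
      rcases Finset.mem_union.1 hs with hs' | hs'
      · exact ⟨u, mem_nodes.2 ⟨s, hs', hus⟩, Iff.rfl⟩
      · obtain ⟨e, he, rfl⟩ := Finset.mem_image.1 hs'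
        obtain ⟨w, hw⟩ := Finset.card_pos.1
          (show 0 < e.card by rw [card_of_mem_pathEdges h.path.1 he]; omega)
        exact ⟨w, (h.mem_path.1 (mem_of_mem_pathEdges he hw)).1,
          hp _ hs u hus w (Finset.mem_insert_of_mem hw),
          hp _ hs w (Finset.mem_insert_of_mem hw) u hus⟩
    intro u hu w hw hpu
    obtain ⟨u', hu', h1⟩ := hnb u hu
    obtain ⟨w', hw', h2⟩ := hnb w hw
    exact h2.2 (isConnected_iff.1 hS.connected p
      (fun t ht => hp t (Finset.mem_union_left _ ht)) u' hu' w' hw' (h1.1 hpu))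
  -- At an end `x` the path has only one edge, so only one triangle of the cone contains `{x, a}`.
  · refine ⟨{x, a}, mem_boundary.2 ⟨Finset.card_pair hxa, ?_⟩⟩
    rw [hcount, facetCount_eq_zero_of_notMem_nodes haL (by simp), herase x hxa,
      h.path.facetCount_eq hxγ, if_pos hxb]
  · have hint : faces IL ∩ faces ((pathEdges γ).image (insert a)) = faces (pathEdges γ) := by
      ext s
      rw [Finset.mem_inter, mem_faces_image_insert haγ]
      constructor
      · rintro ⟨hs, hs'⟩
        rwa [Finset.erase_eq_of_notMem fun h' => haL (mem_nodes_of_faces hs h')] at hs'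
      · intro hs
        exact ⟨(h.mem_faces_inter.1 hs).1, faces_mono_left (Finset.erase_subset _ _) hs⟩
    have := altSum_union (faces IL) (faces ((pathEdges γ).image (insert a)))
    rw [hint, altSum_faces_cone haγ, altSum_faces_pathEdges h.path.1 h.path.two_le_length,
      (isTriangulatedPolygon_iff.1 hP).2.2, ← faces_union] at this
    simpa using this

end Cone

/-! ### Subsurfaces, and paths from boundary to boundary. -/

section Subsurface

variable {V : Type*} [DecidableEq V] {I K : Finset (Finset V)} {e t : Finset V} {u v x y : V}

/-- A subsurface contains no interior node which lies on the boundary of the whole surface. -/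
theorem IsSurface.mem_boundaryNodes_of_subset (hK : IsSurface K) (hI : IsSurface I) (hKI : K ⊆ I)
    (hv : v ∈ nodes K) (hvI : v ∈ boundaryNodes I) : v ∈ boundaryNodes K := by
  by_contra hvb
  -- If `v` were interior to `K`, both triangles at each edge of `K` at `v` would lie in `K`. The
  -- link of `v` in `K` would then be closed under adjacency in the link in `I` and reach the
  -- boundary edge `{u, v}`.
  have htwo : ∀ u ∈ nodes (link K v), facetCount K {u, v} = 2 := by
    intro u hu
    obtain ⟨huv, hf⟩ := mem_nodes_link.1 hu
    have h1 := facetCount_pos.2 hf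
    have h2 := hK.facetCount_le_two (Finset.card_pair huv)
    have h3 : facetCount K {u, v} ≠ 1 := fun h => hvb (mem_boundaryNodes_iff_pair.2 ⟨u, huv, h⟩)
    omega
  obtain ⟨u, huv, hu⟩ := mem_boundaryNodes_iff_pair.1 hvI
  obtain ⟨t, ht, hvt⟩ := mem_nodes.1 hv
  obtain ⟨a, ha⟩ := Finset.card_pos.1
    (show 0 < (t.erase v).card by rw [Finset.card_erase_of_mem hvt, hK.card_eq t ht]; omega)
  have haK := mem_nodes_link_of_mem_mem ht (Finset.mem_of_mem_erase ha) hvt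
    (Finset.ne_of_mem_erase ha)
  have := isConnected_iff.1 (hI.link_connected v (nodes_mono hKI hv))
    (fun x => x ∈ nodes (link K v)) (by
      intro t ht a ha b hb hav
      rw [mem_link] at ht
      have hav' := (mem_nodes_link.1 hav).1
      have hsub : K.filter (fun t => {a, v} ⊆ t) ⊆ I.filter (fun t => {a, v} ⊆ t) :=
        Finset.filter_subset_filter _ hKI
      have heq := Finset.eq_of_subset_of_card_le hsub (by
        change facetCount I {a, v} ≤ facetCount K {a, v}
        rw [htwo a hav]
        exact hI.facetCount_le_two (Finset.card_pair hav'))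
      have hmem : insert v t ∈ I.filter (fun t => {a, v} ⊆ t) :=
        Finset.mem_filter.2 ⟨ht.2, by grind⟩
      rw [← heq, Finset.mem_filter] at hmem
      have hbv : b ≠ v := by rintro rfl; exact ht.1 hb
      exact mem_nodes_link_of_mem_mem hmem.1 (Finset.mem_insert_of_mem hb)
        (Finset.mem_insert_self _ _) hbv) a
    (nodes_mono (link_mono hKI) haK) u
    (mem_nodes_link.2 ⟨huv, facetCount_pos.1 (by omega)⟩) haK
  have h1 := htwo u this
  have h2 := facetCount_mono hKI (s := {u, v})
  omega

/-- The walk avoids `y` because it runs in the link of `y`; it is cut off at its first boundary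
node. -/
theorem exists_path_of_isPath {y : V} {u : V} (hu : u ∈ boundaryNodes K) :
    ∀ {x : V} (p : (skeleton (link K y)).Walk x u), p.IsPath → x ≠ y → x ∉ boundaryNodes K →
    ∃ m z, (x :: (m ++ [z])).Nodup ∧ (∀ v ∈ x :: (m ++ [z]), v ∈ p.support ∧ v ≠ y) ∧
      pathEdges (x :: (m ++ [z])) ⊆ simplices 2 K ∧
      (∀ v ∈ m, v ∉ boundaryNodes K) ∧ z ∈ boundaryNodes K := by
  intro x p
  induction p with
  | nil => intro _ _ h; exact absurd hu h
  | @cons a b c hadj p ih =>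
    intro hp hay hab
    rw [SimpleGraph.Walk.cons_isPath_iff] at hp
    have hadj' := hadj
    obtain ⟨hne, t, ht, hat, hbt⟩ := hadj'
    rw [mem_link] at ht
    have hby : b ≠ y := by rintro rfl; exact ht.1 hbt
    have hedge : ({a, b} : Finset V) ∈ simplices 2 K :=
      mem_simplices.2 ⟨mem_faces.2 ⟨_, ht.2, by grind⟩, Finset.card_pair hne⟩
    by_cases hb : b ∈ boundaryNodes K
    · refine ⟨[], b, by simpa using hne, ?_, ?_, by simp, hb⟩
      · intro v hv
        simp only [List.nil_append, List.mem_cons, List.not_mem_nil, or_false] at hv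
        rcases hv with rfl | rfl
        · exact ⟨by simp, hay⟩
        · exact ⟨by simp, hby⟩
      · rw [List.nil_append, pathEdges_cons_cons, pathEdges_singleton]
        intro e he
        rw [Finset.mem_insert] at he
        rcases he with rfl | he
        · exact hedge
        · simp at he
    · obtain ⟨m, z, hnd, hsupp, hedges, hm, hz⟩ := ih hu hp.1 hby hb
      refine ⟨b :: m, z, ?_, ?_, ?_, ?_, hz⟩
      · exact List.nodup_cons.2 ⟨fun h => hp.2 (hsupp a h).1, hnd⟩
      · intro v hv
        rcases List.mem_cons.1 hv with rfl | hv
        · exact ⟨by simp, hay⟩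
        · exact ⟨by rw [SimpleGraph.Walk.support_cons]; exact List.mem_cons_of_mem _ (hsupp v hv).1,
            (hsupp v hv).2⟩
      · rw [List.cons_append, pathEdges_cons_cons]
        exact Finset.insert_subset hedge hedges
      · intro v hv
        rcases List.mem_cons.1 hv with rfl | hv
        · exact hb
        · exact hm v hv

/-- An edge from a boundary node `y` to an interior node continues to another boundary node. -/
theorem IsSurface.exists_path (hK : IsSurface K) (hy : y ∈ boundaryNodes K)
    (hx : x ∉ boundaryNodes K) (hxy : x ≠ y) (he : {x, y} ∈ faces K) :
    ∃ m z, (y :: x :: (m ++ [z])).Nodup ∧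
      pathEdges (y :: x :: (m ++ [z])) ⊆ simplices 2 K ∧
      (∀ v ∈ m, v ∉ boundaryNodes K) ∧ z ∈ boundaryNodes K := by
  obtain ⟨u, huy, hu⟩ := mem_boundaryNodes_iff_pair.1 hy
  have hub : u ∈ boundaryNodes K := mem_boundaryNodes_iff_pair.2
    ⟨y, huy.symm, by rwa [Finset.pair_comm]⟩
  -- The connected link of `y` contains `x` and also the other end `u` of a boundary edge at `y`.
  obtain ⟨p, hp⟩ := (hK.link_connected y (boundaryNodes_subset_nodes hy) x
    (mem_nodes_link.2 ⟨hxy, he⟩) u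
    (mem_nodes_link.2 ⟨huy, facetCount_pos.1 (by omega)⟩)).exists_isPath
  obtain ⟨m, z, hnd, hsupp, hedges, hm, hz⟩ := exists_path_of_isPath hub p hp hxy hx
  refine ⟨m, z, List.nodup_cons.2 ⟨fun h => (hsupp y h).2 rfl, hnd⟩, ?_, hm, hz⟩
  rw [pathEdges_cons_cons]
  refine Finset.insert_subset ?_ hedges
  rw [Finset.pair_comm]
  exact mem_simplices.2 ⟨he, Finset.card_pair hxy⟩

end Subsurface

/-! ### Node splits of 3-manifolds: external faces, node types, hemispheres. -/

section SplitNode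

variable {V : Type*} [DecidableEq V] {T IL IR : Finset (Finset V)} {γ : List V}
  {n nL nR u v w x y : V} {e f t : Finset V}

theorem mem_boundary_link {k : ℕ} :
    e ∈ boundary k (link T n) ↔ n ∉ e ∧ insert n e ∈ boundary (k + 1) T := by
  rw [mem_boundary, mem_boundary]
  constructor
  · rintro ⟨hc, h⟩
    have hn : n ∉ e := (mem_faces_link.1 (facetCount_pos.1
      (show 0 < facetCount (link T n) e by omega))).1
    rw [facetCount_link hn] at h
    exact ⟨hn, by rw [Finset.card_insert_of_notMem hn, hc], h⟩
  · rintro ⟨hn, hc, h⟩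
    rw [facetCount_link hn]
    rw [Finset.card_insert_of_notMem hn] at hc
    exact ⟨by omega, h⟩

/-- The nodes `u` and `v` lie in a common external face. -/
def ExternalPair (T : Finset (Finset V)) (u v : V) : Prop := ∃ f ∈ boundary 3 T, u ∈ f ∧ v ∈ f

theorem ExternalPair.symm (h : ExternalPair T u v) : ExternalPair T v u := by
  obtain ⟨f, hf, h1, h2⟩ := h
  exact ⟨f, hf, h2, h1⟩

/-- This form is symmetric in `n` and `v`, so a boundary relation can be followed from either
hemisphere. -/
theorem mem_boundaryNodes_link :
    v ∈ boundaryNodes (link T n) ↔ v ≠ n ∧ ExternalPair T n v := by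
  rw [boundaryNodes, mem_nodes]
  constructor
  · rintro ⟨e, he, hv⟩
    obtain ⟨hn, h⟩ := mem_boundary_link.1 he
    exact ⟨by rintro rfl; exact hn hv, _, h, by simp, by simp [hv]⟩
  · rintro ⟨hvn, f, hf, hn, hv⟩
    exact ⟨f.erase n, mem_boundary_link.2 ⟨Finset.notMem_erase _ _, by
      rwa [Finset.insert_erase hn]⟩, Finset.mem_erase.2 ⟨hvn, hv⟩⟩

theorem facetCount_pathEdges_of_notMem_of_card (hγ : γ.Nodup) (hc : 2 ≤ e.card)
    (he : e ∉ pathEdges γ) : facetCount (pathEdges γ) e = 0 := by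
  rw [facetCount_eq_zero, mem_faces]
  rintro ⟨s, hs, hes⟩
  rw [Finset.eq_of_subset_of_card_le hes (by rwa [card_of_mem_pathEdges hγ hs])] at he
  exact he hs

/-- A node split of a triangulated 3-manifold along a splitting path. -/
structure NodeSplit (T : Finset (Finset V)) (n nL nR : V) (γ : List V)
    (IL IR : Finset (Finset V)) : Prop where
  card_eq : ∀ t ∈ T, t.card = 4
  polygon : IsTriangulatedPolygon (link T n)
  cut : Cut (link T n) γ IL IR
  ne : nL ≠ nR
  notMem_left : nL ∉ nodes T
  notMem_right : nR ∉ nodes T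

namespace NodeSplit

theorem symm (h : NodeSplit T n nL nR γ IL IR) : NodeSplit T n nR nL γ IR IL :=
  ⟨h.card_eq, h.polygon, h.cut.symm, h.ne.symm, h.notMem_right, h.notMem_left⟩

theorem mem_nodes_center (h : NodeSplit T n nL nR γ IL IR) : n ∈ nodes T := by
  by_contra hn
  obtain ⟨t, ht⟩ := h.polygon.1.nonempty
  rw [link_eq_empty.2 hn] at ht
  simp at ht

theorem splitData (h : NodeSplit T n nL nR γ IL IR) :
    SplitData T n nL nR IL IR (pathEdges γ) where
  union_eq := h.cut.union_eq
  faces_inter := h.cut.faces_inter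
  disjoint := h.cut.disjoint
  ne := h.ne
  ne_left := fun h' => h.notMem_left (h' ▸ h.mem_nodes_center)
  ne_right := fun h' => h.notMem_right (h' ▸ h.mem_nodes_center)
  notMem_left := h.notMem_left
  notMem_right := h.notMem_right

theorem splitNode_eq (T : Finset (Finset V)) (n nL nR : V) (γ : List V)
    (IL IR : Finset (Finset V)) :
    splitNode T n nL nR γ IL IR = vertexSplit T n nL nR IL IR (pathEdges γ) := rfl

theorem splitNode_swap (T : Finset (Finset V)) (n nL nR : V) (γ : List V)
    (IL IR : Finset (Finset V)) :
    splitNode T n nL nR γ IL IR = splitNode T n nR nL γ IR IL := by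
  rw [splitNode_eq, splitNode_eq, vertexSplit_swap]

theorem card_of_mem_splitNode (h : NodeSplit T n nL nR γ IL IR) :
    ∀ t ∈ splitNode T n nL nR γ IL IR, t.card = 4 := by
  intro t ht
  have hc : ∀ s ∈ link T n, s.card = 3 := h.polygon.1.card_eq
  rw [splitNode_eq, h.splitData.mem_vertexSplit] at ht
  rcases ht with ht | ht | ht | ht
  · exact h.card_eq t ht.1
  · rw [← Finset.card_erase_add_one ht.1, hc _ (h.cut.left_subset ht.2)]
  · rw [← Finset.card_erase_add_one ht.1, hc _ (h.cut.right_subset ht.2)]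
  · have := h.ne
    rw [← Finset.card_erase_add_one ht.1,
      ← Finset.card_erase_add_one (Finset.mem_erase.2 ⟨this.symm, ht.2.1⟩),
      card_of_mem_pathEdges h.cut.path.1 ht.2.2]

theorem boundary_of_notMem (h : NodeSplit T n nL nR γ IL IR) (hf : f ∈ boundary 3 T)
    (hn : n ∉ f) : f ∈ boundary 3 (splitNode T n nL nR γ IL IR) := by
  rw [mem_boundary] at hf ⊢
  have hfT : f ∈ faces T := facetCount_pos.1 (by omega)
  rw [splitNode_eq, h.splitData.facetCount_of_notMem hn
    (fun h' => h.notMem_left (mem_nodes_of_faces hfT h'))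
    (fun h' => h.notMem_right (mem_nodes_of_faces hfT h')),
    facetCount_pathEdges_of_notMem_of_card h.cut.path.1 (by omega)
      (fun h' => by have := card_of_mem_pathEdges h.cut.path.1 h'; omega)]
  exact ⟨hf.1, hf.2⟩

theorem notMem_of_mem_faces_left (h : NodeSplit T n nL nR γ IL IR) (he : e ∈ faces IL) :
    nL ∉ e ∧ nR ∉ e :=
  ⟨fun h' => h.splitData.left_notMem_L (mem_nodes_of_faces he h'),
    fun h' => h.splitData.right_notMem_L (mem_nodes_of_faces he h')⟩

/-- Path edges are interior, so a boundary edge is not among them and its only triangle gives the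
only tetrahedron. -/
theorem boundary_insert_left (h : NodeSplit T n nL nR γ IL IR) (he : e ∈ boundary 2 (link T n))
    (heL : e ∈ faces IL) : insert nL e ∈ boundary 3 (splitNode T n nL nR γ IL IR) := by
  obtain ⟨h1, h2⟩ := h.notMem_of_mem_faces_left heL
  rw [mem_boundary] at he
  rw [mem_boundary, splitNode_eq, h.splitData.facetCount_insert_left h1 h2,
    Finset.card_insert_of_notMem h1, he.1]
  have hnot : e ∉ pathEdges γ := fun h' => by
    have := (mem_interiorEdges.1 (h.cut.path.2.1 h')).2.2
    exact this he.2
  rw [facetCount_pathEdges_of_notMem_of_card h.cut.path.1 (by omega) hnot]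
  have h3 := h.cut.facetCount_add e
  have h4 := facetCount_pos.2 heL
  exact ⟨rfl, by omega⟩

/-- Tetrahedra on `nL`, `nR`, `v` correspond to path edges at `v`, and an end of the path has just
one. These faces make C1 nodes removable. -/
theorem boundary_insert_insert (h : NodeSplit T n nL nR γ IL IR) (hv : v ∈ γ)
    (hvb : v ∈ boundaryNodes (link T n)) :
    insert nL (insert nR {v}) ∈ boundary 3 (splitNode T n nL nR γ IL IR) := by
  obtain ⟨h1, h2⟩ := h.notMem_of_mem_faces_left (mem_nodes_iff_faces.1 (h.cut.mem_path.1 hv).1)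
  have h3 : nL ∉ insert nR ({v} : Finset V) := by
    rw [Finset.mem_insert]; rintro (h' | h'); exacts [h.ne h', h1 h']
  rw [mem_boundary, splitNode_eq, h.splitData.facetCount_insert_insert h1 h2,
    h.cut.path.facetCount_eq hv, if_pos hvb, Finset.card_insert_of_notMem h3,
    Finset.card_insert_of_notMem h2]
  simp

theorem mem_nodes_splitNode (h : NodeSplit T n nL nR γ IL IR) (hx : x ∈ nodes T) (hxn : x ≠ n) :
    x ∈ nodes (splitNode T n nL nR γ IL IR) := by
  obtain ⟨t, ht, hxt⟩ := mem_nodes.1 hx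
  by_cases hn : n ∈ t
  · have hl : t.erase n ∈ link T n :=
      mem_link.2 ⟨Finset.notMem_erase _ _, by rwa [Finset.insert_erase hn]⟩
    have hxe : x ∈ t.erase n := Finset.mem_erase.2 ⟨hxn, hxt⟩
    rw [← h.cut.union_eq, Finset.mem_union] at hl
    rcases hl with hl | hl
    · exact mem_nodes.2 ⟨_, h.splitData.insert_left_mem hl, Finset.mem_insert_of_mem hxe⟩
    · exact mem_nodes.2 ⟨_, h.splitData.insert_right_mem hl, Finset.mem_insert_of_mem hxe⟩
  · exact mem_nodes.2 ⟨t, SplitData.mem_of_mem ht hn, hxt⟩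

theorem externalPair_of_ne (h : NodeSplit T n nL nR γ IL IR) (hu : u ≠ n) (hv : v ≠ n)
    (huv : ExternalPair T u v) : ExternalPair (splitNode T n nL nR γ IL IR) u v := by
  obtain ⟨f, hf, huf, hvf⟩ := huv
  by_cases hn : n ∈ f
  · have hb : f.erase n ∈ boundary 2 (link T n) :=
      mem_boundary_link.2 ⟨Finset.notMem_erase _ _, by rwa [Finset.insert_erase hn]⟩
    have hue : u ∈ f.erase n := Finset.mem_erase.2 ⟨hu, huf⟩
    have hve : v ∈ f.erase n := Finset.mem_erase.2 ⟨hv, hvf⟩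
    have hfaces : f.erase n ∈ faces (link T n) :=
      facetCount_pos.1 (by rw [(mem_boundary.1 hb).2]; omega)
    rw [← h.cut.union_eq, faces_union, Finset.mem_union] at hfaces
    rcases hfaces with hl | hl
    · exact ⟨_, h.boundary_insert_left hb hl, Finset.mem_insert_of_mem hue,
        Finset.mem_insert_of_mem hve⟩
    · rw [splitNode_swap]
      exact ⟨_, h.symm.boundary_insert_left hb hl, Finset.mem_insert_of_mem hue,
        Finset.mem_insert_of_mem hve⟩
  · exact ⟨f, h.boundary_of_notMem hf hn, huf, hvf⟩

/-- On the path, `v` is an end and the face with `nL` and `nR` serves; off the path, a boundary edge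
at `v` must lie in `IL`. -/
theorem externalPair_left (h : NodeSplit T n nL nR γ IL IR) (hv : v ∈ nodes IL)
    (hvb : v ∈ boundaryNodes (link T n)) :
    ExternalPair (splitNode T n nL nR γ IL IR) nL v := by
  by_cases hvγ : v ∈ γ
  · exact ⟨_, h.boundary_insert_insert hvγ hvb, by simp, by simp⟩
  · obtain ⟨e, hb, hve⟩ := mem_nodes.1 hvb
    have hfaces : e ∈ faces (link T n) :=
      facetCount_pos.1 (by rw [(mem_boundary.1 hb).2]; omega)
    rw [← h.cut.union_eq, faces_union, Finset.mem_union] at hfaces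
    rcases hfaces with hl | hl
    · exact ⟨_, h.boundary_insert_left hb hl, by simp, Finset.mem_insert_of_mem hve⟩
    · exact absurd (h.cut.mem_path.2 ⟨hv, mem_nodes_of_faces hl hve⟩) hvγ

theorem externalPair_new (h : NodeSplit T n nL nR γ IL IR) :
    ExternalPair (splitNode T n nL nR γ IL IR) nL nR := by
  obtain ⟨-, -, a, m, b, hγ, ha, -⟩ := id h.cut.path
  exact ⟨_, h.boundary_insert_insert (by rw [hγ]; simp) ha, by simp, by simp⟩

/-- Over a path edge, `nL` has a tetrahedron in the left part and one with `nR`; so external faces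
with `nL` alone come from boundary edges of the old hemisphere. -/
theorem external_of_boundary_left (h : NodeSplit T n nL nR γ IL IR)
    (hf : f ∈ boundary 3 (splitNode T n nL nR γ IL IR)) (hx : x ∈ f) (hxL : x ≠ nL)
    (hL : nL ∈ f) (hR : nR ∉ f) : IsExternalNode T x := by
  rw [mem_boundary, splitNode_eq] at hf
  have hL' := Finset.notMem_erase nL f
  have hR' : nR ∉ f.erase nL := fun h' => hR (Finset.mem_of_mem_erase h')
  rw [← Finset.insert_erase hL, h.splitData.facetCount_insert_left hL' hR',
    Finset.card_insert_of_notMem hL'] at hf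
  have hxe : x ∈ f.erase nL := Finset.mem_erase.2 ⟨hxL, hx⟩
  obtain ⟨hc, hcount⟩ := hf
  have hc2 : (f.erase nL).card = 2 := by omega
  by_cases hγ : f.erase nL ∈ pathEdges γ
  · have h1 := h.cut.facetCount_pathEdge hγ
    have h2 := facetCount_pos.2 (mem_faces_of_mem hγ)
    omega
  · have h0 := facetCount_pathEdges_of_notMem_of_card h.cut.path.1 hc2.ge hγ
    have hIL : f.erase nL ∈ faces IL := facetCount_pos.1 (by omega)
    have hIR : facetCount IR (f.erase nL) = 0 :=
      facetCount_eq_zero.2 fun h' => hγ ((h.cut.mem_pathEdges hc2).2 ⟨hIL, h'⟩)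
    have hadd := h.cut.facetCount_add (f.erase nL)
    have hb : f.erase nL ∈ boundary 2 (link T n) := mem_boundary.2 ⟨hc2, by omega⟩
    exact ⟨_, (mem_boundary_link.1 hb).2, Finset.mem_insert_of_mem hxe⟩

/-- No old node becomes external. An external face on both new nodes has an end of the path as third
node, which was external before. -/
theorem isExternalNode_of_splitNode (h : NodeSplit T n nL nR γ IL IR) (hx : x ∈ nodes T)
    (hext : IsExternalNode (splitNode T n nL nR γ IL IR) x) : IsExternalNode T x := by
  obtain ⟨f, hf, hxf⟩ := hext
  have hxL : x ≠ nL := by rintro rfl; exact h.notMem_left hx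
  have hxR : x ≠ nR := by rintro rfl; exact h.notMem_right hx
  by_cases hL : nL ∈ f <;> by_cases hR : nR ∈ f
  · have hf' := mem_boundary.1 hf
    have hR1 : nR ∈ f.erase nL := Finset.mem_erase.2 ⟨h.ne.symm, hR⟩
    have h1 := Finset.notMem_erase nR (f.erase nL)
    have h2 : nL ∉ (f.erase nL).erase nR :=
      fun h' => Finset.notMem_erase _ _ (Finset.mem_of_mem_erase h')
    have hfe : insert nL (insert nR ((f.erase nL).erase nR)) = f := by
      rw [Finset.insert_erase hR1, Finset.insert_erase hL]
    have hc : ((f.erase nL).erase nR).card = 1 := by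
      rw [Finset.card_erase_of_mem hR1, Finset.card_erase_of_mem hL, hf'.1]
    obtain ⟨z, hz⟩ := Finset.card_eq_one.1 hc
    have hxz : x = z := by
      have : x ∈ (f.erase nL).erase nR :=
        Finset.mem_erase.2 ⟨hxR, Finset.mem_erase.2 ⟨hxL, hxf⟩⟩
      rw [hz] at this
      exact Finset.mem_singleton.1 this
    subst hxz
    have hcount := hf'.2
    rw [← hfe, splitNode_eq, h.splitData.facetCount_insert_insert h2 h1, hz] at hcount
    by_cases hxγ : x ∈ γ
    · rw [h.cut.path.facetCount_eq hxγ] at hcount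
      by_cases hxb : x ∈ boundaryNodes (link T n)
      · obtain ⟨-, g, hg, -, hxg⟩ := mem_boundaryNodes_link.1 hxb
        exact ⟨g, hg, hxg⟩
      · rw [if_neg hxb] at hcount; omega
    · rw [facetCount_pathEdges_of_notMem hxγ] at hcount; omega
  · exact h.external_of_boundary_left hf hxf hxL hL hR
  · rw [splitNode_swap] at hf
    exact h.symm.external_of_boundary_left hf hxf hxR hR hL
  · have hf' := mem_boundary.1 hf
    have hn : n ∉ f := fun h' => h.splitData.center_notMem
      (mem_nodes_of_faces (facetCount_pos.1 (Nat.zero_lt_one.trans_eq hf'.2.symm)) h')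
    refine ⟨f, mem_boundary.2 ⟨hf'.1, ?_⟩, hxf⟩
    have := hf'.2
    rwa [splitNode_eq, h.splitData.facetCount_of_notMem hn hL hR,
      facetCount_pathEdges_of_notMem_of_card h.cut.path.1 (by omega)
      (fun h' => by have := card_of_mem_pathEdges h.cut.path.1 h'; omega)] at this

theorem isInternalNode (h : NodeSplit T n nL nR γ IL IR) (hx : IsInternalNode T x)
    (hxn : x ≠ n) : IsInternalNode (splitNode T n nL nR γ IL IR) x :=
  ⟨h.mem_nodes_splitNode hx.1 hxn, fun h' => hx.2 (h.isExternalNode_of_splitNode hx.1 h')⟩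

theorem exists_isC0_face_left (h : NodeSplit T n nL nR γ IL IR) (hxn : x ≠ n) (ht : t ∈ T)
    (hx : x ∈ t) (hn : n ∈ t) (hb : t.erase x ∈ boundary 3 T) (hl : t.erase n ∈ IL) :
    ∃ t' ∈ splitNode T n nL nR γ IL IR, x ∈ t' ∧
      t'.erase x ∈ boundary 3 (splitNode T n nL nR γ IL IR) := by
  have hxT : x ∈ nodes T := mem_nodes.2 ⟨t, ht, hx⟩
  have hxL : nL ≠ x := by rintro rfl; exact h.notMem_left hxT
  refine ⟨_, h.splitData.insert_left_mem hl,
    Finset.mem_insert_of_mem (Finset.mem_erase.2 ⟨hxn, hx⟩), ?_⟩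
  rw [Finset.erase_insert_of_ne hxL]
  refine h.boundary_insert_left (mem_boundary_link.2 ⟨?_, ?_⟩)
    (mem_faces.2 ⟨_, hl, Finset.erase_subset _ _⟩)
  · exact fun h' => Finset.notMem_erase n t (Finset.mem_of_mem_erase h')
  · rwa [Finset.erase_right_comm, Finset.insert_erase (Finset.mem_erase.2 ⟨hxn.symm, hn⟩)]

theorem isC0 (h : NodeSplit T n nL nR γ IL IR) (hx : IsC0 T x) (hxn : x ≠ n) :
    IsC0 (splitNode T n nL nR γ IL IR) x := by
  obtain ⟨hint, t, ht, hxt, hb⟩ := hx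
  refine ⟨h.isInternalNode hint hxn, ?_⟩
  by_cases hn : n ∈ t
  · have hl : t.erase n ∈ link T n :=
      mem_link.2 ⟨Finset.notMem_erase _ _, by rwa [Finset.insert_erase hn]⟩
    rw [← h.cut.union_eq, Finset.mem_union] at hl
    rcases hl with hl | hl
    · exact h.exists_isC0_face_left hxn ht hxt hn hb hl
    · rw [splitNode_swap]
      exact h.symm.exists_isC0_face_left hxn ht hxt hn hb hl
  · exact ⟨t, SplitData.mem_of_mem ht hn, hxt,
      h.boundary_of_notMem hb fun h' => hn (Finset.mem_of_mem_erase h')⟩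

/-- The removable tetrahedron is the new one over the edge `{x, y}`: opposite to `x` is the external
face on `nL`, `nR` and the end `y`. -/
theorem isC0_of_mem_pathEdges (h : NodeSplit T n nL nR γ IL IR) (hx : IsInternalNode T x)
    (hxn : x ≠ n) (hxy : {x, y} ∈ pathEdges γ) (hy : y ∈ boundaryNodes (link T n)) :
    IsC0 (splitNode T n nL nR γ IL IR) x := by
  have hc := card_of_mem_pathEdges h.cut.path.1 hxy
  have hne : x ≠ y := by rintro rfl; simp at hc
  have hxL : nL ≠ x := by rintro rfl; exact h.notMem_left hx.1
  have hxR : nR ≠ x := by rintro rfl; exact h.notMem_right hx.1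
  refine ⟨h.isInternalNode hx hxn, _, SplitData.insert_insert_mem hxy, by simp, ?_⟩
  have : (insert nL (insert nR {x, y}) : Finset V).erase x = insert nL (insert nR {y}) := by
    rw [Finset.erase_insert_of_ne hxL, Finset.erase_insert_of_ne hxR,
      Finset.erase_insert (by simpa using hne)]
  rw [this]
  exact h.boundary_insert_insert (mem_of_mem_pathEdges hxy (by simp)) hy

theorem polygon_left (h : NodeSplit T n nL nR γ IL IR) :
    IsTriangulatedPolygon (link (splitNode T n nL nR γ IL IR) nL) := by
  rw [splitNode_eq, h.splitData.link_left]
  exact h.cut.isTriangulatedPolygon_cone h.polygon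
    fun h' => h.notMem_right (nodes_link_subset h')

theorem polygon_right (h : NodeSplit T n nL nR γ IL IR) :
    IsTriangulatedPolygon (link (splitNode T n nL nR γ IL IR) nR) := by
  rw [splitNode_swap]; exact h.symm.polygon_left

/-- The hemisphere of `w` is split too; its local conditions at a new node `a` are read off from the
hemisphere of `a`, since iterated links commute. -/
theorem polygon_of_ne (h : NodeSplit T n nL nR γ IL IR) (hw : IsTriangulatedPolygon (link T w))
    (hwn : w ≠ n) (hwL : w ≠ nL) (hwR : w ≠ nR) :
    IsTriangulatedPolygon (link (splitNode T n nL nR γ IL IR) w) := by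
  obtain ⟨hd, heq⟩ := h.splitData.link_of_ne hwn hwL hwR
  have hpoly : ∀ a, (a = nL ∨ a = nR) →
      IsTriangulatedPolygon (link (splitNode T n nL nR γ IL IR) a) ∧ a ≠ w := by
    rintro a (rfl | rfl)
    · exact ⟨h.polygon_left, hwL.symm⟩
    · exact ⟨h.polygon_right, hwR.symm⟩
  rw [splitNode_eq, heq]
  refine hd.isTriangulatedPolygon hw ?_ ?_ ?_ ?_ <;> rw [← heq, ← splitNode_eq]
  · exact card_of_mem_link h.card_of_mem_splitNode
  · intro a ha haw
    obtain ⟨hp, hne⟩ := hpoly a ha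
    rw [link_comm hne]
    refine hp.1.link_connected w (mem_nodes_link.2 ⟨hne.symm, ?_⟩)
    rw [Finset.pair_comm]
    exact (mem_nodes_link.1 haw).2
  · intro a ha e hc hae
    obtain ⟨hp, hne⟩ := hpoly a ha
    by_cases hwe : w ∈ e
    · rw [facetCount_eq_zero_of_notMem_nodes notMem_nodes_link hwe]; omega
    · have hea : e = insert a (e.erase a) := (Finset.insert_erase hae).symm
      have haw : a ∉ insert w (e.erase a) := by
        rw [Finset.mem_insert]; rintro (h' | h')
        exacts [hne h', Finset.notMem_erase _ _ h']
      rw [facetCount_link hwe, hea, Finset.insert_comm, ← facetCount_link haw]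
      refine hp.1.facetCount_le_two ?_
      rw [Finset.card_insert_of_notMem (fun h' => hwe (Finset.mem_of_mem_erase h')),
        Finset.card_erase_of_mem hae, hc]
  -- A boundary edge of the old hemisphere of `w` has an end other than `n`, whose external face
  -- with `w` persists in some form.
  · obtain ⟨e, he⟩ := hw.2.1
    obtain ⟨a, ha⟩ := Finset.card_pos.1 (show 0 < (e.erase n).card by
      have := Finset.pred_card_le_card_erase (s := e) (a := n)
      rw [(mem_boundary.1 he).1] at this; omega)
    have hae := Finset.mem_of_mem_erase ha
    have hext : ExternalPair T w a := (mem_boundaryNodes_link.1 (mem_nodes.2 ⟨e, he, hae⟩)).2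
    have hext' := h.externalPair_of_ne hwn (Finset.ne_of_mem_erase ha) hext
    have haw : a ≠ w := by
      rintro rfl
      exact (mem_boundary_link.1 he).1 hae
    obtain ⟨e', he', -⟩ := mem_nodes.1 (mem_boundaryNodes_link.2 ⟨haw, hext'⟩)
    exact ⟨e', he'⟩

end NodeSplit

end SplitNode

/-! ### Recognizing splitting paths, and appending a tip. -/

section PathExtension

variable {V : Type*} [DecidableEq V] {I K : Finset (Finset V)} {γ : List V} {e : Finset V}
  {a b v w : V}

theorem exists_mem_mid_of_mem_pathEdges {m : List V} :
    ∀ {a : V}, m ≠ [] → e ∈ pathEdges (a :: (m ++ [b])) → ∃ v ∈ m, v ∈ e := by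
  induction m with
  | nil => intro a h; exact absurd rfl h
  | cons c m ih =>
    intro a _ he
    rw [List.cons_append, pathEdges_cons_cons, Finset.mem_insert] at he
    rcases he with rfl | he
    · exact ⟨c, by simp, by simp⟩
    · cases m with
      | nil =>
        rw [List.nil_append, pathEdges_cons_cons, pathEdges_singleton, Finset.mem_insert] at he
        rcases he with rfl | he
        · exact ⟨c, by simp, by simp⟩
        · simp at he
      | cons d m =>
        obtain ⟨v, hv, hve⟩ := ih (by simp) he
        exact ⟨v, List.mem_cons_of_mem _ hv, hve⟩

/-- Every edge contains an inner node and is therefore interior. A single edge is excluded by `hm`,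
as it could be a boundary edge. -/
theorem isSplittingPath_of_mid {m : List V} (hm : m ≠ []) (hnd : (a :: (m ++ [b])).Nodup)
    (hedges : pathEdges (a :: (m ++ [b])) ⊆ simplices 2 I) (ha : a ∈ boundaryNodes I)
    (hb : b ∈ boundaryNodes I) (hmid : ∀ v ∈ m, v ∉ boundaryNodes I) :
    IsSplittingPath I (a :: (m ++ [b])) := by
  refine ⟨hnd, fun e he => ?_, a, m, b, rfl, ha, hb, hmid⟩
  obtain ⟨v, hv, hve⟩ := exists_mem_mid_of_mem_pathEdges hm he
  obtain ⟨hf, hc⟩ := mem_simplices.1 (hedges he)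
  exact mem_interiorEdges_of_notMem_boundaryNodes hc hf hve (hmid v hv)

theorem mem_pathEdges_concat (he : e ∈ pathEdges (γ ++ [w])) : e ∈ pathEdges γ ∨ w ∈ e := by
  rcases List.eq_nil_or_concat γ with rfl | ⟨l, z, rfl⟩
  · simp [pathEdges_singleton] at he
  · rw [List.concat_eq_append] at he ⊢
    rw [List.append_assoc, List.singleton_append, pathEdges_append, Finset.mem_union,
      pathEdges_cons_cons, pathEdges_singleton, Finset.mem_insert] at he
    rcases he with he | rfl | he
    · exact Or.inl he
    · exact Or.inr (by simp)
    · simp at he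

theorem pathEdges_subset_concat : pathEdges γ ⊆ pathEdges (γ ++ [w]) := by
  rcases List.eq_nil_or_concat γ with rfl | ⟨l, z, rfl⟩
  · simp [pathEdges_nil]
  · rw [List.concat_eq_append, List.append_assoc, List.singleton_append, pathEdges_append l z [w]]
    exact Finset.subset_union_left

end PathExtension

/-! ### The invariant and the existence of the next round. -/

section Algorithm

variable {V : Type*} [DecidableEq V]

/-- The invariant of the algorithm: `P` lists the paths used on the way to the state `s`. -/
structure Invariant (T : Finset (Finset V)) (n : V) (y : V → V) (P : List (List V))
    (s : State V) : Prop where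
  card_eq : ∀ t ∈ s.tri, t.card = 4
  leaf_unique : ∀ q ∈ s.leaves, ∀ r ∈ s.leaves, q.1 = r.1 → q = r
  leaf_new : ∀ q ∈ s.leaves, q.1 ∉ nodes (hemisphere T n)
  subset_link : ∀ q ∈ s.leaves, q.2 ⊆ link s.tri q.1
  polygon : ∀ q ∈ s.leaves, IsTriangulatedPolygon q.2
  link_polygon : ∀ q ∈ s.leaves, IsTriangulatedPolygon (link s.tri q.1)
  -- Outside its piece a hemisphere consists of remains of cones from earlier splits. With
  -- `leaf_pair`, this provides an end on the boundary of the hemisphere for paths that leave the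
  -- piece.
  tip : ∀ q ∈ s.leaves, ∀ t ∈ link s.tri q.1, t ∉ q.2 → ∃ r ∈ s.leaves, r.1 ∈ t
  leaf_pair : ∀ q ∈ s.leaves, ∀ r ∈ s.leaves, q.1 ≠ r.1 → {q.1, r.1} ∈ faces s.tri →
    ExternalPair s.tri q.1 r.1
  outer : ∀ q ∈ s.leaves, ∀ v ∈ nodes q.2, v ∈ boundaryNodes (hemisphere T n) →
    ExternalPair s.tri q.1 v
  cover : s.leaves.biUnion Prod.snd = hemisphere T n
  disjoint : ∀ q ∈ s.leaves, ∀ r ∈ s.leaves, q ≠ r → Disjoint q.2 r.2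
  edges : ∀ e ∈ interiorEdges (hemisphere T n), (∃ γ ∈ P, e ∈ pathEdges γ) ↔
    ∃ q ∈ s.leaves, ∃ r ∈ s.leaves, q ≠ r ∧ e ∈ simplices 2 q.2 ∧ e ∈ simplices 2 r.2
  internal : ∀ x ∈ nodes (hemisphere T n), IsInternalNode T x → IsInternalNode s.tri x
  todo : ∀ p ∈ s.todo, IsPromotable T n p.1 ∧ p.2 = y p.1 ∧ ∀ γ ∈ P, {p.1, p.2} ∉ pathEdges γ
  done : ∀ x, IsPromotable T n x → (x, y x) ∉ s.todo → IsC0 s.tri x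
  nodup : ∀ γ ∈ P, γ.Nodup
  pairwise : ∀ e ∈ interiorEdges (hemisphere T n), P.Pairwise fun γ δ =>
    ¬ (e ∈ pathEdges γ ∧ e ∈ pathEdges δ)
  length : P.length + s.todo.card ≤ (initState T n y).todo.card

variable {T : Finset (Finset V)} {n : V} {y : V → V} {P : List (List V)} {s : State V}

theorem IsWitness.mem_nodes {x z : V} (h : IsWitness T n x z) :
    x ∈ nodes (hemisphere T n) ∧ z ∈ nodes (hemisphere T n) :=
  ⟨mem_nodes_of_faces (mem_simplices.1 h.2).1 (by simp),
    mem_nodes_of_faces (mem_simplices.1 h.2).1 (by simp)⟩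

theorem IsPromotable.mem_nodes {x : V} (h : IsPromotable T n x) :
    x ∈ nodes (hemisphere T n) := by
  obtain ⟨-, z, hz⟩ := h
  exact hz.mem_nodes.1

/-- The edge from a promotable node to its witness is interior. -/
theorem IsPromotable.mem_interiorEdges {x z : V} (h : IsPromotable T n x)
    (hz : IsWitness T n x z) : {x, z} ∈ interiorEdges (hemisphere T n) := by
  obtain ⟨hf, hc⟩ := mem_simplices.1 hz.2
  refine BallSplitting.mem_interiorEdges.2 ⟨hc, hf, fun h1 => h.1.1.2 ?_⟩
  exact ⟨_, (mem_boundary_link.1 (mem_boundary.2 ⟨hc, h1⟩)).2, by simp⟩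

theorem invariant_initState (hT : ∀ t ∈ T, t.card = 4) (hI : IsTriangulatedPolygon (link T n))
    (hy : ∀ x, IsPromotable T n x → IsWitness T n x (y x)) :
    Invariant T n y [] (initState T n y) := by
  have hleaf : ∀ q ∈ (initState T n y).leaves, q = (n, hemisphere T n) := by
    intro q hq; exact Finset.mem_singleton.1 hq
  have htri : (initState T n y).tri = T := rfl
  refine ⟨hT, ?_, ?_, ?_, ?_, ?_, ?_, ?_, ?_, ?_, ?_, ?_, ?_, ?_, ?_, ?_, ?_, ?_⟩
  · intro q hq r hr _; rw [hleaf q hq, hleaf r hr]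
  · intro q hq; rw [hleaf q hq]; exact notMem_nodes_link
  · intro q hq; rw [hleaf q hq, htri]
  · intro q hq; rw [hleaf q hq]; exact hI
  · intro q hq; rw [hleaf q hq]; exact hI
  · intro q hq t ht htq; rw [hleaf q hq] at ht htq; exact absurd ht htq
  · intro q hq r hr hne; rw [hleaf q hq, hleaf r hr] at hne; exact absurd rfl hne
  · intro q hq v _ hvb
    rw [hleaf q hq, htri]
    exact (mem_boundaryNodes_link.1 hvb).2
  · exact Finset.singleton_biUnion
  · intro q hq r hr hne; rw [hleaf q hq, hleaf r hr] at hne; exact absurd rfl hne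
  · intro e _
    constructor
    · rintro ⟨γ, hγ, -⟩; simp at hγ
    · rintro ⟨q, hq, r, hr, hne, -⟩
      rw [hleaf q hq, hleaf r hr] at hne; exact absurd rfl hne
  · exact fun _ _ h => h
  · intro p hp
    simp only [initState, Finset.mem_image, Finset.mem_filter] at hp
    obtain ⟨x, ⟨-, hx⟩, rfl⟩ := hp
    exact ⟨hx, rfl, by simp⟩
  · intro x hx hnot
    refine absurd ?_ hnot
    simp only [initState, Finset.mem_image, Finset.mem_filter]
    exact ⟨x, ⟨(hy x hx).mem_nodes.1, hx⟩, rfl⟩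
  · simp
  · simp
  · simp

namespace Invariant

variable {x : V} {q r : V × Finset (Finset V)} {γ : List V} {IL IR : Finset (Finset V)}
  {e t : Finset V} {nL nR v : V}

theorem piece_subset (h : Invariant T n y P s) (hq : q ∈ s.leaves) : q.2 ⊆ hemisphere T n := by
  rw [← h.cover]
  exact Finset.subset_biUnion_of_mem Prod.snd hq

theorem leaf_notMem (h : Invariant T n y P s) (hq : q ∈ s.leaves) (hr : r ∈ s.leaves) :
    r.1 ∉ nodes q.2 :=
  fun h' => h.leaf_new r hr (nodes_mono (h.piece_subset hq) h')

theorem exists_leaf (h : Invariant T n y P s) (ht : t ∈ hemisphere T n) :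
    ∃ q ∈ s.leaves, t ∈ q.2 := by
  rw [← h.cover, Finset.mem_biUnion] at ht
  exact ht

theorem nodes_subset (h : Invariant T n y P s) : nodes (hemisphere T n) ⊆ nodes s.tri := by
  intro v hv
  obtain ⟨t, ht, hvt⟩ := mem_nodes.1 hv
  obtain ⟨q, hq, htq⟩ := h.exists_leaf ht
  exact nodes_link_subset (nodes_mono (h.subset_link q hq) (mem_nodes.2 ⟨t, htq, hvt⟩))

theorem leaf_mem_nodes (h : Invariant T n y P s) (hq : q ∈ s.leaves) : q.1 ∈ nodes s.tri := by
  by_contra hn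
  obtain ⟨t, ht⟩ := (h.link_polygon q hq).1.nonempty
  rw [link_eq_empty.2 hn] at ht
  simp at ht

theorem ne_leaf (h : Invariant T n y P s) (hq : q ∈ s.leaves) (hv : v ∈ nodes (hemisphere T n)) :
    v ≠ q.1 := by
  rintro rfl; exact h.leaf_new q hq hv

theorem outer_link (h : Invariant T n y P s) (hq : q ∈ s.leaves) (hv : v ∈ nodes q.2)
    (hvb : v ∈ boundaryNodes (hemisphere T n)) : v ∈ boundaryNodes (link s.tri q.1) :=
  mem_boundaryNodes_link.2 ⟨h.ne_leaf hq (boundaryNodes_subset_nodes hvb), h.outer q hq v hv hvb⟩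

/-- Also used in the contrapositive: inner nodes of a path in the piece are interior to the whole
hemisphere. -/
theorem piece_boundary (h : Invariant T n y P s) (hq : q ∈ s.leaves) (hv : v ∈ nodes q.2)
    (hvb : v ∈ boundaryNodes (link s.tri q.1)) : v ∈ boundaryNodes q.2 :=
  (h.polygon q hq).1.mem_boundaryNodes_of_subset (h.link_polygon q hq).1 (h.subset_link q hq) hv hvb

/-- Otherwise the second triangle at the edge would lie in another piece, and by `edges` some path
would have used the edge. -/
theorem mem_interiorEdges_piece (h : Invariant T n y P s) (hI : IsTriangulatedPolygon (link T n))
    (hq : q ∈ s.leaves) (he : e ∈ interiorEdges (hemisphere T n)) (heq : e ∈ faces q.2)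
    (hP : ∀ γ ∈ P, e ∉ pathEdges γ) : e ∈ interiorEdges q.2 := by
  have hc := (BallSplitting.mem_interiorEdges.1 he).1
  refine BallSplitting.mem_interiorEdges.2 ⟨hc, heq, fun h1 => ?_⟩
  have h2 := (hI.1.mem_interiorEdges.1 he).2
  have : ∃ t ∈ hemisphere T n, e ⊆ t ∧ t ∉ q.2 := by
    by_contra! hcon
    have : facetCount (hemisphere T n) e ≤ facetCount q.2 e := by
      refine Finset.card_le_card fun t ht => ?_
      rw [Finset.mem_filter] at ht ⊢
      exact ⟨hcon t ht.1 ht.2, ht.2⟩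
    change facetCount (hemisphere T n) e = 2 at h2
    omega
  obtain ⟨t, ht, het, htq⟩ := this
  obtain ⟨r, hr, htr⟩ := h.exists_leaf ht
  obtain ⟨γ, hγ, heγ⟩ := (h.edges e he).2 ⟨q, hq, r, hr, by rintro rfl; exact htq htr,
    mem_simplices.2 ⟨heq, hc⟩, mem_simplices.2 ⟨mem_faces.2 ⟨t, htr, het⟩, hc⟩⟩
  exact hP γ hγ heγ

/-- The part inside the piece of a path chosen by the algorithm is a splitting path of the
piece. -/
theorem exists_inner_path (h : Invariant T n y P s) (hI : IsTriangulatedPolygon (link T n))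
    (hy : ∀ x, IsPromotable T n x → IsWitness T n x (y x)) {z : V} (hp : (x, z) ∈ s.todo)
    (hq : q ∈ s.leaves) (hxz : {x, z} ∈ simplices 2 q.2)
    (hγ : IsAlgorithmPath s q.1 q.2 x z γ) :
    ∃ δ, IsSplittingPath q.2 δ ∧ {x, z} ∈ pathEdges δ ∧
      (γ = δ ∨ ∃ r ∈ s.leaves, γ = δ ++ [r.1]) := by
  obtain ⟨hprom, hz, hP⟩ := h.todo _ hp
  simp only at hz hprom hP
  subst hz
  have hw := hy x hprom
  obtain ⟨hf, hc⟩ := mem_simplices.1 hxz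
  have hyn : y x ∈ nodes q.2 := mem_nodes_of_faces hf (by simp)
  have hyb : y x ∈ boundaryNodes q.2 := h.piece_boundary hq hyn (h.outer_link hq hyn hw.1)
  have hint := h.mem_interiorEdges_piece hI hq (hprom.mem_interiorEdges hw) hf hP
  have hne : x ≠ y x := by intro h'; rw [← h'] at hc; simp at hc
  rcases hγ with ⟨hx, m, z, hnd, hedges, hm, hz, htail⟩ | ⟨hx, w, ⟨⟨K, hK⟩, -⟩, rfl⟩
  · refine ⟨y x :: x :: (m ++ [z]), ?_, ?_, ?_⟩
    · refine isSplittingPath_of_mid (m := x :: m) (by simp) hnd hedges hyb hz ?_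
      intro v hv
      rcases List.mem_cons.1 hv with rfl | hv
      · exact hx
      · exact hm v hv
    · rw [pathEdges_cons_cons, Finset.pair_comm]; exact Finset.mem_insert_self _ _
    · rcases htail with ⟨-, rfl⟩ | ⟨-, w, ⟨⟨K, hK⟩, -⟩, rfl⟩
      · exact Or.inl rfl
      · exact Or.inr ⟨_, hK, by simp⟩
  -- Both ends are on the boundary of the piece, yet the edge is interior to it because no earlier
  -- path used it.
  · refine ⟨[y x, x], ⟨by simpa using hne.symm, ?_, y x, [], x, rfl, hyb, hx, by simp⟩, ?_,
      Or.inr ⟨_, hK, rfl⟩⟩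
    · intro e he
      rw [pathEdges_cons_cons, pathEdges_singleton, Finset.mem_insert] at he
      rcases he with rfl | he
      · rwa [Finset.pair_comm]
      · simp at he
    · rw [pathEdges_cons_cons, Finset.pair_comm]; exact Finset.mem_insert_self _ _

/-- A division of the current hemisphere restricts to a division of the piece. -/
theorem cut_piece (h : Invariant T n y P s) (hq : q ∈ s.leaves)
    (hcut : Cut (link s.tri q.1) γ IL IR) {δ : List V} (hδ : IsSplittingPath q.2 δ)
    (hγδ : γ = δ ∨ ∃ r ∈ s.leaves, γ = δ ++ [r.1]) : Cut q.2 δ (q.2 ∩ IL) (q.2 ∩ IR) := by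
  refine ⟨(h.polygon q hq).1, hδ, (divides_iff hδ.1 hδ.two_le_length).2 ⟨?_, ?_⟩⟩
  · rw [← Finset.inter_union_distrib_left, hcut.union_eq]
    exact Finset.inter_eq_left.2 (h.subset_link q hq)
  ext s'
  rw [Finset.mem_inter]
  constructor
  · rintro ⟨h1, h2⟩
    have hmem := hcut.mem_faces_inter.2 ⟨faces_mono Finset.inter_subset_right h1,
      faces_mono Finset.inter_subset_right h2⟩
    have hK := faces_mono Finset.inter_subset_left h1
    rcases hγδ with rfl | ⟨r, hr, rfl⟩
    · exact hmem
    · have hr' := h.leaf_notMem hq hr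
      have hrs : r.1 ∉ s' := fun h' => hr' (mem_nodes_of_faces hK h')
      rw [mem_faces_pathEdges hcut.path.1 hcut.path.two_le_length] at hmem
      rw [mem_faces_pathEdges hδ.1 hδ.two_le_length]
      rcases hmem with h' | ⟨v, hv, rfl⟩ | h'
      · exact Or.inl h'
      · refine Or.inr (Or.inl ⟨v, ?_, rfl⟩)
        rcases List.mem_append.1 hv with hv | hv
        · exact hv
        · rw [List.mem_singleton] at hv; subst hv; simp at hrs
      · exact Or.inr (Or.inr ((mem_pathEdges_concat h').resolve_right hrs))
  · intro h'
    obtain ⟨e, he, hs⟩ := mem_faces.1 h'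
    have heγ : e ∈ pathEdges γ := by
      rcases hγδ with rfl | ⟨r, hr, rfl⟩
      · exact he
      · exact pathEdges_subset_concat he
    have hei := ((h.polygon q hq).1.mem_interiorEdges.1 (hδ.2.1 he))
    -- An interior edge of the piece has both its triangles there, so the triangles on either side
    -- of `γ` at this edge belong to the piece.
    have hsub : q.2.filter (fun t => e ⊆ t) ⊆ (link s.tri q.1).filter (fun t => e ⊆ t) :=
      Finset.filter_subset_filter _ (h.subset_link q hq)
    have heq := Finset.eq_of_subset_of_card_le hsub (by
      change facetCount _ e ≤ facetCount q.2 e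
      rw [hei.2]
      exact (h.link_polygon q hq).1.facetCount_le_two hei.1)
    have hin : ∀ t ∈ link s.tri q.1, e ⊆ t → t ∈ q.2 := by
      intro t ht het
      have : t ∈ (link s.tri q.1).filter (fun t => e ⊆ t) := Finset.mem_filter.2 ⟨ht, het⟩
      rw [← heq] at this
      exact (Finset.mem_filter.1 this).1
    obtain ⟨hL, hR⟩ := (hcut.mem_pathEdges hei.1).1 heγ
    obtain ⟨t, ht, het⟩ := mem_faces.1 hL
    obtain ⟨t', ht', het'⟩ := mem_faces.1 hR
    exact ⟨mem_faces.2 ⟨t, Finset.mem_inter.2 ⟨hin t (hcut.left_subset ht) het, ht⟩, hs.trans het⟩,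
      mem_faces.2 ⟨t', Finset.mem_inter.2 ⟨hin t' (hcut.right_subset ht') het', ht'⟩,
        hs.trans het'⟩⟩

/-- At a node of the piece which is interior to the hemisphere but not to the piece, a cone is
attached. -/
theorem exists_isTip (h : Invariant T n y P s) (hq : q ∈ s.leaves) (hv : v ∈ boundaryNodes q.2)
    (hvb : v ∉ boundaryNodes (link s.tri q.1)) :
    ∃ w, IsTip s q.1 v w ∧ w ∉ nodes q.2 ∧ w ∈ boundaryNodes (link s.tri q.1) := by
  obtain ⟨u, huv, h1⟩ := mem_boundaryNodes_iff_pair.1 hv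
  have hf := faces_mono (h.subset_link q hq)
    (facetCount_pos.1 (show 0 < facetCount q.2 {u, v} by omega))
  have h2 := ((h.link_polygon q hq).1.mem_interiorEdges.1
    (mem_interiorEdges_of_notMem_boundaryNodes (Finset.card_pair huv) hf (by simp) hvb)).2
  -- The edge `{u, v}` has one triangle in the piece but two in the hemisphere; the second contains
  -- a tip, which `leaf_pair` places on the boundary of the hemisphere.
  have : ∃ t ∈ link s.tri q.1, {u, v} ⊆ t ∧ t ∉ q.2 := by
    by_contra! hcon
    have : facetCount (link s.tri q.1) {u, v} ≤ facetCount q.2 {u, v} := by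
      refine Finset.card_le_card fun t ht => ?_
      rw [Finset.mem_filter] at ht ⊢
      exact ⟨hcon t ht.1 ht.2, ht.2⟩
    omega
  obtain ⟨t, ht, hsub, htq⟩ := this
  obtain ⟨r, hr, hrt⟩ := h.tip q hq t ht htq
  have hvt : v ∈ t := hsub (by simp)
  have hvI : v ∈ nodes (hemisphere T n) :=
    nodes_mono (h.piece_subset hq) (boundaryNodes_subset_nodes hv)
  have hvr := h.ne_leaf hr hvI
  have hrn : r.1 ∈ nodes (link s.tri q.1) := mem_nodes.2 ⟨t, ht, hrt⟩
  have hrq := mem_nodes_link.1 hrn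
  refine ⟨r.1, ⟨⟨r.2, hr⟩, mem_simplices.2 ⟨mem_faces.2 ⟨t, ht, by grind⟩,
    Finset.card_pair hvr⟩⟩, h.leaf_notMem hq hr, mem_boundaryNodes_link.2 ⟨hrq.1, ?_⟩⟩
  exact h.leaf_pair q hq r hr hrq.1.symm (by rw [Finset.pair_comm]; exact hrq.2)

/-- Every edge of the list can be treated. -/
theorem exists_step [Infinite V] (h : Invariant T n y P s)
    (hy : ∀ x, IsPromotable T n x → IsWitness T n x (y x)) {p : V × V} (hp : p ∈ s.todo) :
    ∃ γ s', Step s p.1 p.2 γ s' := by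
  obtain ⟨x, z⟩ := p
  obtain ⟨hprom, hz, hP⟩ := h.todo _ hp
  simp only at hz hprom hP ⊢
  subst hz
  have hw := hy x hprom
  obtain ⟨hfI, hc⟩ := mem_simplices.1 hw.2
  have hne : x ≠ y x := by intro h'; rw [← h'] at hc; simp at hc
  obtain ⟨t, ht, hsub⟩ := mem_faces.1 hfI
  obtain ⟨q, hq, htq⟩ := h.exists_leaf ht
  have hf : {x, y x} ∈ faces q.2 := mem_faces.2 ⟨t, htq, hsub⟩
  have hxn : x ∈ nodes q.2 := mem_nodes_of_faces hf (by simp)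
  have hyn : y x ∈ nodes q.2 := mem_nodes_of_faces hf (by simp)
  have hyl : y x ∈ boundaryNodes (link s.tri q.1) := h.outer_link hq hyn hw.1
  have hyb : y x ∈ boundaryNodes q.2 := h.piece_boundary hq hyn hyl
  have hedgesub : ∀ e ∈ simplices 2 q.2, e ∈ simplices 2 (link s.tri q.1) := by
    intro e he
    rw [mem_simplices] at he ⊢
    exact ⟨faces_mono (h.subset_link q hq) he.1, he.2⟩
  have hpath : ∃ γ, IsAlgorithmPath s q.1 q.2 x (y x) γ ∧ IsSplittingPath (link s.tri q.1) γ := by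
    by_cases hx : x ∈ boundaryNodes q.2
    -- Though on the boundary of the piece, `x` is still an internal node of the triangulation, so a
    -- tip is available at `x`.
    · have hxl : x ∉ boundaryNodes (link s.tri q.1) := by
        intro h'
        obtain ⟨-, f, hf, -, hxf⟩ := mem_boundaryNodes_link.1 h'
        exact (h.internal x hprom.mem_nodes hprom.1.1).2 ⟨f, hf, hxf⟩
      obtain ⟨w, hw, hwn, hwb⟩ := h.exists_isTip hq hx hxl
      refine ⟨[y x, x, w], Or.inr ⟨hx, w, hw, rfl⟩,
        isSplittingPath_of_mid (m := [x]) (by simp) ?_ ?_ hyl hwb (by simpa using hxl)⟩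
      · have h1 : x ≠ w := by rintro rfl; exact hwn hxn
        have h2 : y x ≠ w := by intro h'; rw [h'] at hyn; exact hwn hyn
        simp [hne.symm, h1, h2]
      · intro e he
        simp only [List.singleton_append, pathEdges_cons_cons, pathEdges_singleton,
          Finset.mem_insert, Finset.notMem_empty, or_false] at he
        rcases he with rfl | rfl
        · rw [Finset.pair_comm]; exact hedgesub _ (mem_simplices.2 ⟨hf, hc⟩)
        · exact hw.2
    · obtain ⟨m, z, hnd, hedges, hm, hz⟩ := (h.polygon q hq).1.exists_path hyb hx hne hf
      have hnode : ∀ v ∈ y x :: x :: (m ++ [z]), v ∈ nodes q.2 := by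
        intro v hv
        obtain ⟨e, he, hve⟩ := exists_mem_pathEdges (by simp) hv
        exact mem_nodes_of_faces (mem_simplices.1 (hedges he)).1 hve
      have hmid : ∀ v ∈ x :: m, v ∉ boundaryNodes (link s.tri q.1) := by
        intro v hv h'
        have hvq : v ∈ nodes q.2 := hnode v (by simp at hv ⊢; tauto)
        have := h.piece_boundary hq hvq h'
        rcases List.mem_cons.1 hv with rfl | hv
        · exact hx this
        · exact hm v hv this
      by_cases hzl : z ∈ boundaryNodes (link s.tri q.1)
      · exact ⟨_, Or.inl ⟨hx, m, z, hnd, hedges, hm, hz, Or.inl ⟨hzl, rfl⟩⟩,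
          isSplittingPath_of_mid (m := x :: m) (by simp) hnd
            (fun e he => hedgesub e (hedges he)) hyl hzl hmid⟩
      · obtain ⟨w, hw, hwn, hwb⟩ := h.exists_isTip hq hz hzl
        refine ⟨y x :: x :: (m ++ [z, w]),
          Or.inl ⟨hx, m, z, hnd, hedges, hm, hz, Or.inr ⟨hzl, w, hw, rfl⟩⟩, ?_⟩
        have hlist : y x :: x :: (m ++ [z, w]) = y x :: ((x :: (m ++ [z])) ++ [w]) := by simp
        have hnd' : (y x :: ((x :: (m ++ [z])) ++ [w])).Nodup := by
          rw [← List.cons_append, List.nodup_append]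
          refine ⟨hnd, by simp, ?_⟩
          intro a ha b hb
          rw [List.mem_singleton] at hb
          rintro rfl
          subst hb
          exact hwn (hnode _ ha)
        rw [hlist]
        refine isSplittingPath_of_mid (m := x :: (m ++ [z])) (by simp) hnd' ?_ hyl hwb ?_
        · intro e he
          rw [← hlist, show y x :: x :: (m ++ [z, w]) = (y x :: x :: m) ++ z :: [w] by simp,
            pathEdges_append, Finset.mem_union] at he
          rcases he with he | he
          · exact hedgesub e (hedges (by simpa using he))
          · rw [pathEdges_cons_cons, pathEdges_singleton, Finset.mem_insert] at he
            rcases he with rfl | he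
            · exact hw.2
            · simp at he
        · intro v hv
          rw [← List.cons_append, List.mem_append, List.mem_singleton] at hv
          rcases hv with hv | rfl
          · exact hmid v hv
          · exact hzl
  obtain ⟨γ, hγ, hsplit⟩ := hpath
  obtain ⟨IL, IR, hdiv⟩ := (h.link_polygon q hq).exists_divides hsplit
  obtain ⟨nL, hnL⟩ := Infinite.exists_notMem_finset (nodes s.tri)
  obtain ⟨nR, hnR⟩ := Infinite.exists_notMem_finset (insert nL (nodes s.tri))
  rw [Finset.mem_insert, not_or] at hnR
  exact ⟨γ, ⟨_, _, _⟩, hp, q.1, q.2, hq, mem_simplices.2 ⟨hf, hc⟩, hγ, hsplit, IL, IR, nL, nR,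
    hdiv, Ne.symm hnR.1, hnL, hnR.2, rfl, rfl, rfl⟩

end Invariant

end Algorithm

/-! ### Preservation of the invariant, termination and conclusion. -/

section Step

variable {V : Type*} [DecidableEq V] {T : Finset (Finset V)} {n : V} {y : V → V}
  {P : List (List V)} {s : State V} {x z v w : V} {q r : V × Finset (Finset V)} {γ δ : List V}
  {IL IR K : Finset (Finset V)} {e t f : Finset V} {m nL nR : V}

theorem NodeSplit.faces_of_splitNode (h : NodeSplit T n nL nR γ IL IR)
    (hf : f ∈ faces (splitNode T n nL nR γ IL IR)) (hL : nL ∉ f) (hR : nR ∉ f) : f ∈ faces T := by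
  have hn : n ∉ f := fun h' => h.splitData.center_notMem (mem_nodes_of_faces hf h')
  rw [← facetCount_pos, splitNode_eq, h.splitData.facetCount_of_notMem hn hL hR] at hf
  by_contra hcon
  have h0 := facetCount_eq_zero.2 hcon
  have hE : f ∈ faces (pathEdges γ) := facetCount_pos.1 (by omega)
  have hL := faces_mono h.cut.left_subset (h.cut.mem_faces_inter.1 hE).1
  exact hcon (faces_mono_left (Finset.subset_insert _ _) (mem_faces_link.1 hL).2)

theorem NodeSplit.mem_of_mem_splitNode (h : NodeSplit T n nL nR γ IL IR)
    (ht : t ∈ splitNode T n nL nR γ IL IR) (hL : nL ∉ t) (hR : nR ∉ t) : t ∈ T := by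
  rw [splitNode_eq, h.splitData.mem_vertexSplit] at ht
  tauto

theorem NodeSplit.mem_nodes_left (h : NodeSplit T n nL nR γ IL IR)
    (hw : w ∈ nodes (link (splitNode T n nL nR γ IL IR) nL)) (hwR : w ≠ nR) : w ∈ nodes IL := by
  rw [splitNode_eq, h.splitData.link_left] at hw
  obtain ⟨t, ht, hwt⟩ := mem_nodes.1 hw
  rcases Finset.mem_union.1 ht with ht | ht
  · exact mem_nodes.2 ⟨t, ht, hwt⟩
  · obtain ⟨e, he, rfl⟩ := Finset.mem_image.1 ht
    exact (h.cut.mem_path.1 (mem_of_mem_pathEdges he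
      ((Finset.mem_insert.1 hwt).resolve_left hwR))).1

namespace Invariant

/-- The situation in one round of the algorithm, without regard to the list of edges. -/
structure Round (T : Finset (Finset V)) (n : V) (y : V → V) (P : List (List V)) (s : State V)
    (m : V) (K : Finset (Finset V)) (γ δ : List V) (IL IR : Finset (Finset V)) (nL nR : V) :
    Prop where
  surface : IsSurface (hemisphere T n)
  inv : Invariant T n y P s
  leaf : (m, K) ∈ s.leaves
  split : NodeSplit s.tri m nL nR γ IL IR
  inner : Cut K δ (K ∩ IL) (K ∩ IR)
  path : γ = δ ∨ ∃ r ∈ s.leaves, γ = δ ++ [r.1]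

namespace Round

theorem symm (h : Round T n y P s m K γ δ IL IR nL nR) : Round T n y P s m K γ δ IR IL nR nL :=

  ⟨h.surface, h.inv, h.leaf, h.split.symm, h.inner.symm, h.path⟩

theorem pathEdges_subset (h : Round T n y P s m K γ δ IL IR nL nR) :
    pathEdges δ ⊆ pathEdges γ := by
  rcases h.path with h' | ⟨r, -, h'⟩
  · rw [h']
  · rw [h']; exact pathEdges_subset_concat

/-- An edge of `γ` outside `δ` contains the tip, which is no node of the original hemisphere. -/
theorem mem_inner (h : Round T n y P s m K γ δ IL IR nL nR) (he : e ∈ pathEdges γ)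
    (hn : ∀ v ∈ e, v ∈ nodes (hemisphere T n)) : e ∈ pathEdges δ := by
  rcases h.path with h' | ⟨r, hr, h'⟩
  · rwa [← h']
  · rw [h'] at he
    exact (mem_pathEdges_concat he).resolve_right fun hre => h.inv.leaf_new r hr (hn _ hre)

theorem inner_of_interiorEdges (h : Round T n y P s m K γ δ IL IR nL nR) (he : e ∈ pathEdges γ)
    (hI : e ∈ interiorEdges (hemisphere T n)) : e ∈ pathEdges δ :=
  h.mem_inner he fun _ hv => mem_nodes_of_faces (BallSplitting.mem_interiorEdges.1 hI).2.1 hv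

theorem ne_of_ne (h : Round T n y P s m K γ δ IL IR nL nR) (hr : r ∈ s.leaves)
    (hne : r ≠ (m, K)) : r.1 ≠ m ∧ r.1 ≠ nL ∧ r.1 ≠ nR := by
  refine ⟨fun h' => hne (h.inv.leaf_unique r hr _ h.leaf h'), ?_, ?_⟩
  · intro h'; exact h.split.notMem_left (h' ▸ h.inv.leaf_mem_nodes hr)
  · intro h'; exact h.split.notMem_right (h' ▸ h.inv.leaf_mem_nodes hr)

theorem ne_center (h : Round T n y P s m K γ δ IL IR nL nR)
    (hx : x ∈ nodes (hemisphere T n)) : x ≠ m := h.inv.ne_leaf h.leaf hx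

theorem new_notMem (h : Round T n y P s m K γ δ IL IR nL nR) : nL ∉ nodes (hemisphere T n) :=
  fun h' => h.split.notMem_left (h.inv.nodes_subset h')

/-- A triangle of the new hemisphere lies in `IL`, where the old invariant applies, or in the cone
with apex `nR`. -/
theorem tip_new (h : Round T n y P s m K γ δ IL IR nL nR)
    (ht : t ∈ link (splitNode s.tri m nL nR γ IL IR) nL) (htK : t ∉ K ∩ IL) :
    nR ∈ t ∨ ∃ r ∈ s.leaves, r ≠ (m, K) ∧ r.1 ∈ t := by
  rw [NodeSplit.splitNode_eq, h.split.splitData.link_left] at ht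
  rcases Finset.mem_union.1 ht with ht | ht
  · have hl := h.split.cut.left_subset ht
    obtain ⟨r, hr, hrt⟩ := h.inv.tip _ h.leaf t hl fun h' => htK (Finset.mem_inter.2 ⟨h', ht⟩)
    refine Or.inr ⟨r, hr, ?_, hrt⟩
    rintro rfl
    exact (mem_link.1 hl).1 hrt
  · obtain ⟨e, -, rfl⟩ := Finset.mem_image.1 ht
    exact Or.inl (Finset.mem_insert_self _ _)

theorem tip_old (h : Round T n y P s m K γ δ IL IR nL nR) (hr : r ∈ s.leaves) (hne : r ≠ (m, K))
    (ht : t ∈ link (splitNode s.tri m nL nR γ IL IR) r.1) (htr : t ∉ r.2) :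
    nL ∈ t ∨ nR ∈ t ∨ ∃ r ∈ s.leaves, r ≠ (m, K) ∧ r.1 ∈ t := by
  by_cases hL : nL ∈ t
  · exact Or.inl hL
  by_cases hR : nR ∈ t
  · exact Or.inr (Or.inl hR)
  obtain ⟨-, h1, h2⟩ := h.ne_of_ne hr hne
  obtain ⟨hrt, ht'⟩ := mem_link.1 ht
  have hT := h.split.mem_of_mem_splitNode ht'
    (by rw [Finset.mem_insert]; rintro (h' | h'); exacts [h1 h'.symm, hL h'])
    (by rw [Finset.mem_insert]; rintro (h' | h'); exacts [h2 h'.symm, hR h'])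
  obtain ⟨u, hu, hut⟩ := h.inv.tip r hr t (mem_link.2 ⟨hrt, hT⟩) htr
  refine Or.inr (Or.inr ⟨u, hu, ?_, hut⟩)
  rintro rfl
  exact h.split.splitData.center_notMem (mem_nodes.2 ⟨_, ht', Finset.mem_insert_of_mem hut⟩)

theorem subset_link_new (h : Round T n y P s m K γ δ IL IR nL nR) :
    K ∩ IL ⊆ link (splitNode s.tri m nL nR γ IL IR) nL := by
  rw [NodeSplit.splitNode_eq, h.split.splitData.link_left]
  exact Finset.inter_subset_right.trans Finset.subset_union_left

theorem subset_link_old (h : Round T n y P s m K γ δ IL IR nL nR) (hr : r ∈ s.leaves)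
    (hne : r ≠ (m, K)) : r.2 ⊆ link (splitNode s.tri m nL nR γ IL IR) r.1 := by
  intro t ht
  obtain ⟨h1, h2⟩ := mem_link.1 (h.inv.subset_link r hr ht)
  refine mem_link.2 ⟨h1, SplitData.mem_of_mem h2 ?_⟩
  rw [Finset.mem_insert]
  rintro (h' | h')
  · exact (h.ne_of_ne hr hne).1 h'.symm
  · exact h.inv.leaf_notMem hr h.leaf (mem_nodes.2 ⟨t, ht, h'⟩)

/-- A tip adjacent to `nL` was adjacent to `m`, hence on the boundary of its hemisphere, and in
`IL`; such nodes share an external face with `nL`. -/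
theorem leaf_pair_new (h : Round T n y P s m K γ δ IL IR nL nR) (hr : r ∈ s.leaves)
    (hne : r ≠ (m, K)) (hf : {nL, r.1} ∈ faces (splitNode s.tri m nL nR γ IL IR)) :
    ExternalPair (splitNode s.tri m nL nR γ IL IR) nL r.1 := by
  obtain ⟨h1, h2, h3⟩ := h.ne_of_ne hr hne
  have hL := h.split.mem_nodes_left (mem_nodes_link.2 ⟨h2, by rwa [Finset.pair_comm]⟩) h3
  refine h.split.externalPair_left hL (mem_boundaryNodes_link.2 ⟨h1, ?_⟩)
  have hm : {r.1, m} ∈ faces s.tri :=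
    (mem_nodes_link.1 (nodes_mono h.split.cut.left_subset hL)).2
  exact h.inv.leaf_pair _ h.leaf r hr h1.symm (by rwa [Finset.pair_comm])

theorem leaf_pair_old (h : Round T n y P s m K γ δ IL IR nL nR) (hq : q ∈ s.leaves)
    (hqm : q ≠ (m, K)) (hr : r ∈ s.leaves) (hrm : r ≠ (m, K)) (hne : q.1 ≠ r.1)
    (hf : {q.1, r.1} ∈ faces (splitNode s.tri m nL nR γ IL IR)) :
    ExternalPair (splitNode s.tri m nL nR γ IL IR) q.1 r.1 := by
  obtain ⟨h1, h2, h3⟩ := h.ne_of_ne hr hrm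
  obtain ⟨h4, h5, h6⟩ := h.ne_of_ne hq hqm
  refine h.split.externalPair_of_ne h4 h1 (h.inv.leaf_pair q hq r hr hne
    (h.split.faces_of_splitNode hf ?_ ?_)) <;>
  · rw [Finset.mem_insert, Finset.mem_singleton]; tauto

theorem boundary_of_outer (h : Round T n y P s m K γ δ IL IR nL nR) (hv : v ∈ nodes K)
    (hvb : v ∈ boundaryNodes (hemisphere T n)) : v ∈ boundaryNodes (link s.tri m) := by
  have hq : v ∈ nodes (m, K).2 := hv
  have := h.inv.outer_link (q := (m, K)) h.leaf hq hvb
  exact this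

theorem outer_new (h : Round T n y P s m K γ δ IL IR nL nR) (hv : v ∈ nodes (K ∩ IL))
    (hvb : v ∈ boundaryNodes (hemisphere T n)) :
    ExternalPair (splitNode s.tri m nL nR γ IL IR) nL v :=
  h.split.externalPair_left (nodes_mono Finset.inter_subset_right hv)
    (h.boundary_of_outer (nodes_mono Finset.inter_subset_left hv) hvb)

theorem inter_union_inter (h : Round T n y P s m K γ δ IL IR nL nR) :
    (K ∩ IL) ∪ (K ∩ IR) = K := h.inner.union_eq

theorem edges_pathEdges (h : Round T n y P s m K γ δ IL IR nL nR) (he : e ∈ pathEdges γ)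
    (hI : e ∈ interiorEdges (hemisphere T n)) :
    e ∈ simplices 2 (K ∩ IL) ∧ e ∈ simplices 2 (K ∩ IR) := by
  have hδ := h.inner_of_interiorEdges he hI
  have hc := card_of_mem_pathEdges h.inner.path.1 hδ
  obtain ⟨h1, h2⟩ := (h.inner.mem_pathEdges hc).1 hδ
  exact ⟨mem_simplices.2 ⟨h1, hc⟩, mem_simplices.2 ⟨h2, hc⟩⟩

/-- An edge of an earlier path lies in two pieces, whereas an edge of `δ` is interior to `K`, which
leaves no triangle at it for another piece. -/
theorem notMem_previous (h : Round T n y P s m K γ δ IL IR nL nR) (he : e ∈ pathEdges γ)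
    (hI : e ∈ interiorEdges (hemisphere T n)) : ∀ ε ∈ P, e ∉ pathEdges ε := by
  intro ε hε heε
  obtain ⟨q, hq, r, hr, hqr, heq, her⟩ := (h.inv.edges e hI).1 ⟨ε, hε, heε⟩
  have hint := h.inner.path.2.1 (h.inner_of_interiorEdges he hI)
  obtain ⟨hc, h2⟩ := h.inner.surface.mem_interiorEdges.1 hint
  -- both triangles at the edge belong to the piece that is divided
  have hle : facetCount (hemisphere T n) e ≤ 2 := h.surface.facetCount_le_two hc
  have key : ∀ q ∈ s.leaves, e ∈ simplices 2 q.2 → q = (m, K) := by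
    intro q hq heq
    by_contra hne
    have hdisj : Disjoint q.2 K := h.inv.disjoint q hq _ h.leaf hne
    have h4 := facetCount_pos.2 (mem_simplices.1 heq).1
    have h5 := facetCount_mono (s := e)
      (Finset.union_subset (h.inv.piece_subset hq) (h.inv.piece_subset h.leaf))
    rw [facetCount_union hdisj] at h5
    omega
  exact hqr ((key q hq heq).trans (key r hr her).symm)

theorem leaf_unique (h : Round T n y P s m K γ δ IL IR nL nR) {s' : State V}
    (hmem : ∀ q, q ∈ s'.leaves ↔ (q ∈ s.leaves ∧ q ≠ (m, K)) ∨ q = (nL, K ∩ IL) ∨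
      q = (nR, K ∩ IR)) :
    ∀ q ∈ s'.leaves, ∀ r ∈ s'.leaves, q.1 = r.1 → q = r := by
  have hr := h
  replace h := hr.inv
  have hne := hr.split.ne
  intro q hq r hr' hqr
  rcases (hmem q).1 hq with ⟨hq, hqm⟩ | rfl | rfl <;>
    rcases (hmem r).1 hr' with ⟨hr', hrm⟩ | rfl | rfl
  · exact h.leaf_unique q hq r hr' hqr
  · exact absurd hqr (hr.ne_of_ne hq hqm).2.1
  · exact absurd hqr (hr.ne_of_ne hq hqm).2.2
  · exact absurd hqr.symm (hr.ne_of_ne hr' hrm).2.1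
  · rfl
  · exact absurd hqr hne
  · exact absurd hqr.symm (hr.ne_of_ne hr' hrm).2.2
  · exact absurd hqr hne.symm
  · rfl

theorem tip (h : Round T n y P s m K γ δ IL IR nL nR) {s' : State V}
    (htri : s'.tri = splitNode s.tri m nL nR γ IL IR)
    (hmem : ∀ q, q ∈ s'.leaves ↔ (q ∈ s.leaves ∧ q ≠ (m, K)) ∨ q = (nL, K ∩ IL) ∨
      q = (nR, K ∩ IR)) :
    ∀ q ∈ s'.leaves, ∀ t ∈ link s'.tri q.1, t ∉ q.2 → ∃ r ∈ s'.leaves, r.1 ∈ t := by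
  have hr := h
  have hLmem : (nL, K ∩ IL) ∈ s'.leaves := (hmem _).2 (Or.inr (Or.inl rfl))
  have hRmem : (nR, K ∩ IR) ∈ s'.leaves := (hmem _).2 (Or.inr (Or.inr rfl))
  have hswap : s'.tri = splitNode s.tri m nR nL γ IR IL := by
    rw [htri, NodeSplit.splitNode_swap]
  intro q hq t ht htq
  rcases (hmem q).1 hq with ⟨hq, hqm⟩ | rfl | rfl
  · rw [htri] at ht
    rcases hr.tip_old hq hqm ht htq with h' | h' | ⟨r, hr', hrm, hrt⟩
    · exact ⟨_, hLmem, h'⟩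
    · exact ⟨_, hRmem, h'⟩
    · exact ⟨r, (hmem r).2 (Or.inl ⟨hr', hrm⟩), hrt⟩
  · rw [htri] at ht
    rcases hr.tip_new ht htq with h' | ⟨r, hr', hrm, hrt⟩
    · exact ⟨_, hRmem, h'⟩
    · exact ⟨r, (hmem r).2 (Or.inl ⟨hr', hrm⟩), hrt⟩
  · rw [hswap] at ht
    rcases hr.symm.tip_new ht htq with h' | ⟨r, hr', hrm, hrt⟩
    · exact ⟨_, hLmem, h'⟩
    · exact ⟨r, (hmem r).2 (Or.inl ⟨hr', hrm⟩), hrt⟩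

theorem leaf_pair (h : Round T n y P s m K γ δ IL IR nL nR) {s' : State V}
    (htri : s'.tri = splitNode s.tri m nL nR γ IL IR)
    (hmem : ∀ q, q ∈ s'.leaves ↔ (q ∈ s.leaves ∧ q ≠ (m, K)) ∨ q = (nL, K ∩ IL) ∨
      q = (nR, K ∩ IR)) :
    ∀ q ∈ s'.leaves, ∀ r ∈ s'.leaves, q.1 ≠ r.1 → {q.1, r.1} ∈ faces s'.tri →
      ExternalPair s'.tri q.1 r.1 := by
  have hr := h
  have hns := hr.split
  have hswap : s'.tri = splitNode s.tri m nR nL γ IR IL := by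
    rw [htri, NodeSplit.splitNode_swap]
  intro q hq r hr' hqr hf
  rcases (hmem q).1 hq with ⟨hq, hqm⟩ | rfl | rfl <;>
    rcases (hmem r).1 hr' with ⟨hr', hrm⟩ | rfl | rfl
  · rw [htri] at hf ⊢; exact hr.leaf_pair_old hq hqm hr' hrm hqr hf
  · rw [htri] at hf ⊢
    rw [Finset.pair_comm] at hf
    exact (hr.leaf_pair_new hq hqm hf).symm
  · rw [hswap] at hf ⊢
    rw [Finset.pair_comm] at hf
    exact (hr.symm.leaf_pair_new hq hqm hf).symm
  · rw [htri] at hf ⊢; exact hr.leaf_pair_new hr' hrm hf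
  · exact absurd rfl hqr
  · rw [htri]; exact hns.externalPair_new
  · rw [hswap] at hf ⊢; exact hr.symm.leaf_pair_new hr' hrm hf
  · rw [htri]; exact hns.externalPair_new.symm
  · exact absurd rfl hqr

theorem cover (h : Round T n y P s m K γ δ IL IR nL nR) {s' : State V}
    (hmem : ∀ q, q ∈ s'.leaves ↔ (q ∈ s.leaves ∧ q ≠ (m, K)) ∨ q = (nL, K ∩ IL) ∨
      q = (nR, K ∩ IR)) :
    s'.leaves.biUnion Prod.snd = hemisphere T n := by
  have hr := h
  replace h := hr.inv
  have hleaf := hr.leaf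
  have hLmem : (nL, K ∩ IL) ∈ s'.leaves := (hmem _).2 (Or.inr (Or.inl rfl))
  have hRmem : (nR, K ∩ IR) ∈ s'.leaves := (hmem _).2 (Or.inr (Or.inr rfl))
  ext t
  rw [← h.cover, Finset.mem_biUnion, Finset.mem_biUnion]
  constructor
  · rintro ⟨q, hq, ht⟩
    rcases (hmem q).1 hq with ⟨hq, hqm⟩ | rfl | rfl
    · exact ⟨q, hq, ht⟩
    · exact ⟨_, hleaf, (Finset.mem_inter.1 ht).1⟩
    · exact ⟨_, hleaf, (Finset.mem_inter.1 ht).1⟩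
  · rintro ⟨q, hq, ht⟩
    by_cases hqm : q = (m, K)
    · subst hqm
      have ht' : t ∈ K := ht
      rw [← hr.inter_union_inter, Finset.mem_union] at ht'
      rcases ht' with ht' | ht'
      · exact ⟨_, hLmem, ht'⟩
      · exact ⟨_, hRmem, ht'⟩
    · exact ⟨q, (hmem q).2 (Or.inl ⟨hq, hqm⟩), ht⟩

theorem disjoint (h : Round T n y P s m K γ δ IL IR nL nR) {s' : State V}
    (hmem : ∀ q, q ∈ s'.leaves ↔ (q ∈ s.leaves ∧ q ≠ (m, K)) ∨ q = (nL, K ∩ IL) ∨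
      q = (nR, K ∩ IR)) :
    ∀ q ∈ s'.leaves, ∀ r ∈ s'.leaves, q ≠ r → Disjoint q.2 r.2 := by
  have hr := h
  replace h := hr.inv
  have hleaf := hr.leaf
  have hold : ∀ q ∈ s.leaves, q ≠ (m, K) → ∀ L ⊆ K, Disjoint q.2 L := by
    intro q hq hqm L hL
    exact (h.disjoint q hq _ hleaf hqm).mono_right hL
  intro q hq r hr' hqr
  rcases (hmem q).1 hq with ⟨hq, hqm⟩ | rfl | rfl <;>
    rcases (hmem r).1 hr' with ⟨hr', hrm⟩ | rfl | rfl
  · exact h.disjoint q hq r hr' hqr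
  · exact hold q hq hqm _ Finset.inter_subset_left
  · exact hold q hq hqm _ Finset.inter_subset_left
  · exact (hold r hr' hrm _ Finset.inter_subset_left).symm
  · exact absurd rfl hqr
  · exact hr.inner.disjoint
  · exact (hold r hr' hrm _ Finset.inter_subset_left).symm
  · exact hr.inner.disjoint.symm
  · exact absurd rfl hqr

theorem exists_pieces (h : Round T n y P s m K γ δ IL IR nL nR) {s' : State V}
    (hmem : ∀ q, q ∈ s'.leaves ↔ (q ∈ s.leaves ∧ q ≠ (m, K)) ∨ q = (nL, K ∩ IL) ∨ q = (nR, K ∩ IR))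
    (he : e ∈ interiorEdges (hemisphere T n)) :
    (∃ ε ∈ P ++ [γ], e ∈ pathEdges ε) →
      ∃ q ∈ s'.leaves, ∃ r ∈ s'.leaves, q ≠ r ∧ e ∈ simplices 2 q.2 ∧ e ∈ simplices 2 r.2 := by
  have hr := h
  replace h := hr.inv
  have hleaf := hr.leaf
  have hne := hr.split.ne
  have hLmem : (nL, K ∩ IL) ∈ s'.leaves := (hmem _).2 (Or.inr (Or.inl rfl))
  have hRmem : (nR, K ∩ IR) ∈ s'.leaves := (hmem _).2 (Or.inr (Or.inr rfl))
  have hc := (BallSplitting.mem_interiorEdges.1 he).1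
  rintro ⟨ε, hε, heε⟩
  rcases List.mem_append.1 hε with hε | hε
  · obtain ⟨q, hq, r, hr', hqr, heq, her⟩ := (h.edges e he).1 ⟨ε, hε, heε⟩
    have hpart : e ∈ simplices 2 K → ∃ q ∈ s'.leaves, q.2 ⊆ K ∧ e ∈ simplices 2 q.2 := by
      intro heK
      rw [← hr.inter_union_inter, mem_simplices, faces_union, Finset.mem_union] at heK
      rcases heK.1 with h' | h'
      · exact ⟨_, hLmem, Finset.inter_subset_left, mem_simplices.2 ⟨h', hc⟩⟩
      · exact ⟨_, hRmem, Finset.inter_subset_left, mem_simplices.2 ⟨h', hc⟩⟩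
    -- If one of the two pieces at the edge is the divided one, some half of it still contains the
    -- edge.
    have haux : ∀ q ∈ s.leaves, q ≠ (m, K) → e ∈ simplices 2 q.2 → e ∈ simplices 2 K →
        ∃ q ∈ s'.leaves, ∃ r ∈ s'.leaves, q ≠ r ∧ e ∈ simplices 2 q.2 ∧
          e ∈ simplices 2 r.2 := by
      intro q hq hqm heq heK
      obtain ⟨u, hu, huK, heu⟩ := hpart heK
      refine ⟨q, (hmem q).2 (Or.inl ⟨hq, hqm⟩), u, hu, ?_, heq, heu⟩
      rintro rfl
      obtain ⟨t, ht, -⟩ := mem_faces.1 (mem_simplices.1 heq).1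
      exact Finset.disjoint_left.1 (h.disjoint q hq _ hleaf hqm) ht (huK ht)
    by_cases hqm : q = (m, K)
    · subst hqm
      exact haux r hr' hqr.symm her heq
    · by_cases hrm : r = (m, K)
      · subst hrm
        exact haux q hq hqm heq her
      · exact ⟨q, (hmem q).2 (Or.inl ⟨hq, hqm⟩), r, (hmem r).2 (Or.inl ⟨hr', hrm⟩), hqr, heq,
          her⟩
  · rw [List.mem_singleton] at hε
    subst hε
    obtain ⟨h1, h2⟩ := hr.edges_pathEdges heε he
    exact ⟨_, hLmem, _, hRmem, fun h' => hne (congrArg Prod.fst h'), h1, h2⟩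

theorem exists_path (h : Round T n y P s m K γ δ IL IR nL nR) {s' : State V}
    (hmem : ∀ q, q ∈ s'.leaves ↔ (q ∈ s.leaves ∧ q ≠ (m, K)) ∨ q = (nL, K ∩ IL) ∨ q = (nR, K ∩ IR))
    (he : e ∈ interiorEdges (hemisphere T n)) :
    (∃ q ∈ s'.leaves, ∃ r ∈ s'.leaves, q ≠ r ∧ e ∈ simplices 2 q.2 ∧ e ∈ simplices 2 r.2) →
      ∃ ε ∈ P ++ [γ], e ∈ pathEdges ε := by
  have hr := h
  replace h := hr.inv
  have hleaf := hr.leaf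
  have hc := (BallSplitting.mem_interiorEdges.1 he).1
  have hup : ∀ L ⊆ K, e ∈ simplices 2 L → e ∈ simplices 2 K := by
    intro L hL heL
    rw [mem_simplices] at heL ⊢
    exact ⟨faces_mono hL heL.1, heL.2⟩
  have hnew : e ∈ simplices 2 (K ∩ IL) → e ∈ simplices 2 (K ∩ IR) →
      ∃ ε ∈ P ++ [γ], e ∈ pathEdges ε := by
    intro h1 h2
    refine ⟨γ, by simp, hr.pathEdges_subset ((hr.inner.mem_pathEdges hc).2 ?_)⟩
    exact ⟨(mem_simplices.1 h1).1, (mem_simplices.1 h2).1⟩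
  have hprev : ∀ q ∈ s.leaves, ∀ r ∈ s.leaves, q ≠ r → e ∈ simplices 2 q.2 →
      e ∈ simplices 2 r.2 → ∃ ε ∈ P ++ [γ], e ∈ pathEdges ε := by
    intro q hq r hr' hqr heq her
    obtain ⟨ε, hε, heε⟩ := (h.edges e he).2 ⟨q, hq, r, hr', hqr, heq, her⟩
    exact ⟨ε, List.mem_append_left _ hε, heε⟩
  rintro ⟨q, hq, r, hr', hqr, heq, her⟩
  rcases (hmem q).1 hq with ⟨hq, hqm⟩ | rfl | rfl <;>
    rcases (hmem r).1 hr' with ⟨hr', hrm⟩ | rfl | rfl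
  · exact hprev q hq r hr' hqr heq her
  · exact hprev q hq _ hleaf hqm heq (hup _ Finset.inter_subset_left her)
  · exact hprev q hq _ hleaf hqm heq (hup _ Finset.inter_subset_left her)
  · exact hprev r hr' _ hleaf hrm her (hup _ Finset.inter_subset_left heq)
  · exact absurd rfl hqr
  · exact hnew heq her
  · exact hprev r hr' _ hleaf hrm her (hup _ Finset.inter_subset_left heq)
  · exact hnew her heq
  · exact absurd rfl hqr

end Round

/-- A round of the algorithm preserves the invariant. -/
theorem step (h : Invariant T n y P s) (hI : IsTriangulatedPolygon (link T n))
    (hy : ∀ x, IsPromotable T n x → IsWitness T n x (y x)) {s' : State V}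
    (hs : Step s x z γ s') : Invariant T n y (P ++ [γ]) s' := by
  obtain ⟨hp, m, K, hleaf, hxz, hγ, hsplit, IL, IR, nL, nR, hdiv, hne, hnL, hnR, htri, hleaves,
    htodo⟩ := hs
  have hcut : Cut (link s.tri m) γ IL IR := ⟨(h.link_polygon _ hleaf).1, hsplit, hdiv⟩
  have hns : NodeSplit s.tri m nL nR γ IL IR :=
    ⟨h.card_eq, h.link_polygon _ hleaf, hcut, hne, hnL, hnR⟩
  obtain ⟨δ, hδ, hxzδ, hγδ⟩ := h.exists_inner_path hI hy hp hleaf hxz hγ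
  have hr : Round T n y P s m K γ δ IL IR nL nR :=
    ⟨hI.1, h, hleaf, hns, h.cut_piece hleaf hcut hδ hγδ, hγδ⟩
  have hswap : s'.tri = splitNode s.tri m nR nL γ IR IL := by
    rw [htri, NodeSplit.splitNode_swap]
  have hmem : ∀ q, q ∈ s'.leaves ↔ (q ∈ s.leaves ∧ q ≠ (m, K)) ∨ q = (nL, K ∩ IL) ∨
      q = (nR, K ∩ IR) := by
    intro q
    rw [hleaves, Finset.mem_union, Finset.mem_erase, Finset.mem_insert, Finset.mem_singleton]
    tauto
  have htodo' : ∀ p, p ∈ s'.todo ↔ p ∈ s.todo ∧ {p.1, p.2} ∉ pathEdges γ := by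
    intro p; rw [htodo, Finset.mem_filter]
  refine ⟨?_, ?_, ?_, ?_, ?_, ?_, ?_, ?_, ?_, ?_, ?_, ?_, ?_, ?_, ?_, ?_, ?_, ?_⟩
  · rw [htri]; exact hns.card_of_mem_splitNode
  · exact hr.leaf_unique hmem
  · intro q hq
    rcases (hmem q).1 hq with ⟨hq, hqm⟩ | rfl | rfl
    · exact h.leaf_new q hq
    · exact hr.new_notMem
    · exact hr.symm.new_notMem
  · intro q hq
    rcases (hmem q).1 hq with ⟨hq, hqm⟩ | rfl | rfl
    · rw [htri]; exact hr.subset_link_old hq hqm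
    · rw [htri]; exact hr.subset_link_new
    · rw [hswap]; exact hr.symm.subset_link_new
  · intro q hq
    rcases (hmem q).1 hq with ⟨hq, hqm⟩ | rfl | rfl
    · exact h.polygon q hq
    · exact hr.inner.isTriangulatedPolygon_left (h.polygon _ hleaf)
    · exact hr.inner.symm.isTriangulatedPolygon_left (h.polygon _ hleaf)
  · intro q hq
    rw [htri]
    rcases (hmem q).1 hq with ⟨hq, hqm⟩ | rfl | rfl
    · obtain ⟨h1, h2, h3⟩ := hr.ne_of_ne hq hqm
      exact hns.polygon_of_ne (h.link_polygon q hq) h1 h2 h3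
    · exact hns.polygon_left
    · exact hns.polygon_right
  · exact hr.tip htri hmem
  · exact hr.leaf_pair htri hmem
  · intro q hq v hv hvb
    have hvm := hr.ne_center (boundaryNodes_subset_nodes hvb)
    rcases (hmem q).1 hq with ⟨hq, hqm⟩ | rfl | rfl
    · rw [htri]
      exact hns.externalPair_of_ne (hr.ne_of_ne hq hqm).1 hvm (h.outer q hq v hv hvb)
    · rw [htri]; exact hr.outer_new hv hvb
    · rw [hswap]; exact hr.symm.outer_new hv hvb
  · exact hr.cover hmem
  · exact hr.disjoint hmem
  · exact fun e he => ⟨hr.exists_pieces hmem he, hr.exists_path hmem he⟩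
  · intro v hv hint
    rw [htri]
    exact hns.isInternalNode (h.internal v hv hint) (hr.ne_center hv)
  · intro p hp'
    obtain ⟨hp1, hp2⟩ := (htodo' p).1 hp'
    obtain ⟨h1, h2, h3⟩ := h.todo p hp1
    refine ⟨h1, h2, fun ε hε => ?_⟩
    rcases List.mem_append.1 hε with hε | hε
    · exact h3 ε hε
    · rw [List.mem_singleton] at hε; rw [hε]; exact hp2
  · intro v hv hnot
    rw [htri]
    have hvm := hr.ne_center hv.mem_nodes
    -- An edge leaving the list in this round lies on `γ` and makes `v` a C0 node; if it left
    -- earlier, the C0 property survives the split.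
    by_cases hold : (v, y v) ∈ s.todo
    · have hvγ : {v, y v} ∈ pathEdges γ := by
        by_contra h'
        exact hnot ((htodo' _).2 ⟨hold, h'⟩)
      have hw := hy v hv
      have hvδ : {v, y v} ∈ pathEdges δ := hr.mem_inner hvγ (by
        intro u hu
        rw [Finset.mem_insert, Finset.mem_singleton] at hu
        rcases hu with rfl | rfl
        · exact hw.mem_nodes.1
        · exact hw.mem_nodes.2)
      have hyK : y v ∈ nodes K := mem_nodes_of_faces
        (BallSplitting.mem_interiorEdges.1 (hδ.2.1 hvδ)).2.1 (by simp)
      exact hns.isC0_of_mem_pathEdges (h.internal v hv.mem_nodes hv.1.1) hvm hvγ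
        (hr.boundary_of_outer hyK hw.1)
    · exact hns.isC0 (h.done v hv hold) hvm
  · intro ε hε
    rcases List.mem_append.1 hε with hε | hε
    · exact h.nodup ε hε
    · rw [List.mem_singleton] at hε; rw [hε]; exact hsplit.1
  · intro e he
    rw [List.pairwise_append]
    refine ⟨h.pairwise e he, List.pairwise_singleton _ _, ?_⟩
    rintro ε hε ζ hζ ⟨h1, h2⟩
    rw [List.mem_singleton] at hζ
    subst hζ
    exact hr.notMem_previous h2 he ε hε h1
  -- The treated edge lies on `δ`, hence on `γ`, so its removal pays for the new path.
  · have hlt : s'.todo.card < s.todo.card := by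
      rw [htodo]
      refine Finset.card_lt_card (Finset.filter_ssubset.2 ⟨(x, z), hp, ?_⟩)
      exact not_not.2 (hr.pathEdges_subset hxzδ)
    have := h.length
    rw [List.length_append, List.length_singleton]
    omega

theorem of_run (hT : ∀ t ∈ T, t.card = 4) (hI : IsTriangulatedPolygon (link T n))
    (hy : ∀ x, IsPromotable T n x → IsWitness T n x (y x))
    (h : Run (initState T n y) P s) : Invariant T n y P s := by
  induction h with
  | start => exact invariant_initState hT hI hy
  | step _ hs ih => exact ih.step hI hy hs

end Invariant

/-- Every run of the algorithm can be continued to one that treats all edges. -/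
theorem exists_run_todo_eq_empty [Infinite V] {P : List (List V)} {s : State V}
    (hT : ∀ t ∈ T, t.card = 4) (hI : IsTriangulatedPolygon (link T n))
    (hy : ∀ x, IsPromotable T n x → IsWitness T n x (y x)) (h : Run (initState T n y) P s) :
    ∃ P' s', Run (initState T n y) P' s' ∧ s'.todo = ∅ := by
  have hinv := Invariant.of_run hT hI hy h
  by_cases hs : s.todo = ∅
  · exact ⟨P, s, h, hs⟩
  obtain ⟨p, hp⟩ := Finset.nonempty_iff_ne_empty.2 hs
  obtain ⟨γ, s', hstep⟩ := hinv.exists_step hy hp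
  have hrun := Run.step h hstep
  -- The bound keeps the number of paths below the initial list size, so the termination measure
  -- strictly decreases despite truncated subtraction.
  have hlen := (Invariant.of_run hT hI hy hrun).length
  have hlen' : (P ++ [γ]).length = P.length + 1 := by simp
  exact exists_run_todo_eq_empty hT hI hy hrun
termination_by (initState T n y).todo.card - P.length
decreasing_by omega

/-- An external face at `n` gives a boundary edge of the link, which excludes a sphere. -/
theorem IsTriangulatedBall.isTriangulatedPolygon_hemisphere (hT : IsTriangulatedBall T)
    (hn : IsExternalNode T n) : IsTriangulatedPolygon (hemisphere T n) := by
  obtain ⟨f, hf, hnf⟩ := hn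
  have hnT : n ∈ nodes T := mem_nodes_of_faces
    (facetCount_pos.1 (Nat.zero_lt_one.trans_eq (mem_boundary.1 hf).2.symm)) hnf
  refine (hT.link_node n hnT).resolve_right fun h => ?_
  have hb : f.erase n ∈ boundary 2 (link T n) :=
    mem_boundary_link.2 ⟨Finset.notMem_erase _ _, by rwa [Finset.insert_erase hnf]⟩
  rw [h.2.1] at hb
  simp at hb

end Step

end BallSplitting

open BallSplitting in
/-- For every choice `y` of boundary nodes, every edge picked from the list can be treated, in every
reachable state; the algorithm terminates; the paths are simple, an interior edge of the
hemisphere lies on at most one of them, and they decompose the hemisphere; and when the list is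
empty, all promotable C1 nodes have become C0 nodes. -/
theorem theorem4p2 {V : Type*} [DecidableEq V] [Infinite V]
    (T : Finset (Finset V)) (hT : IsTriangulatedBall T)
    (n : V) (hn : IsExternalNode T n)
    (y : V → V) (hy : ∀ x, IsPromotable T n x → IsWitness T n x (y x)) :
    (∃ P s, Run (initState T n y) P s ∧ s.todo = ∅) ∧
    ∀ P s, Run (initState T n y) P s →
      (∀ p ∈ s.todo, ∃ γ s', Step s p.1 p.2 γ s') ∧
      P.length + s.todo.card ≤ (initState T n y).todo.card ∧
      (∀ γ ∈ P, γ.Nodup) ∧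
      (∀ e ∈ interiorEdges (hemisphere T n), P.Pairwise fun γ δ =>
        ¬ (e ∈ pathEdges γ ∧ e ∈ pathEdges δ)) ∧
      (s.leaves.biUnion Prod.snd = hemisphere T n ∧
        (∀ q ∈ s.leaves, IsTriangulatedPolygon q.2) ∧
        (∀ q ∈ s.leaves, ∀ r ∈ s.leaves, q ≠ r → Disjoint q.2 r.2) ∧
        ∀ e ∈ interiorEdges (hemisphere T n), (∃ γ ∈ P, e ∈ pathEdges γ) ↔
          ∃ q ∈ s.leaves, ∃ r ∈ s.leaves, q ≠ r ∧
            e ∈ simplices 2 q.2 ∧ e ∈ simplices 2 r.2) ∧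
      (s.todo = ∅ → ∀ x, IsPromotable T n x → IsC0 s.tri x) := by
  have hI := hT.isTriangulatedPolygon_hemisphere hn
  refine ⟨exists_run_todo_eq_empty hT.card_eq hI hy Run.start, fun P s h => ?_⟩
  have hinv := Invariant.of_run hT.card_eq hI hy h
  refine ⟨fun p hp => hinv.exists_step hy hp, hinv.length, hinv.nodup, hinv.pairwise,
    ⟨hinv.cover, hinv.polygon, hinv.disjoint, hinv.edges⟩, fun hs x hx => ?_⟩
  exact hinv.done x hx (by rw [hs]; simp)
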